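/- Let $N\in\mathbb N^+$, $T\in(0,\infty)$, and let $V:\mathbb R^N\to\mathbb R$ be measurable. Consider the adjoint parabolic Cauchy problems $$\partial_t u=\tfrac12\Delta u-Vu \ \text{ on } \mathbb R^N\times(0,T],\quad u(\cdot,0)=\varphi_0,\qquad\qquad -\partial_t v=\tfrac12\Delta v-Vv\ \text{ on } \mathbb R^N\times[0,T),\quad v(\cdot,T)=\psi_T .$$ Their *parabolic Green function* is the minimal nonnegative fundamental solution: a function $g(x,t,y)\ge 0$ on $\mathbb R^N\times(0,T]\times\mathbb R^N$ such that, in the sense of distributions, $(x,t)\mapsto g(x,t,y)$ solves the forward equation with initial datum $\delta_y$ for every $y$, $(y,t)\mapsto g(x,T-t,y)$ solves the backward equation with final datum $\delta_x$ for every $x$, and, for every $\tau\in(0,T]$, every nonnegative (measure-valued) distributional solution $(w_t)_{0\le t\le\tau}$ of the forward equation satisfies $w_t(dx)\ge \big(\int g(x,t,y)\,w_0(dy)\big)dx$ for $t\in(0,\tau]$. Assume: (H1) the Green function $g$ is jointly continuous on $\mathbb R^N\times(0,T]\times\mathbb R^N$, and $g(x,t,y)>0$ for all $x,y\in\mathbb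 R^N$ and all $t\in(0,T]$; (H2) $\varphi_0,\psi_T$ are positive (locally finite Borel) measures on $\mathbb R^N$, the forward problem has a unique classical (that is, $C^{2,1}$) positive solution, the backward problem has a unique classical positive solution (the initial and final data being attained in the sense of vague convergence of measures), and these solutions are $$u_{\varphi_0}(x,t)=\int_{\mathbb R^N}g(x,t,y)\,\varphi_0(dy),\qquad v_{\psi_T}(x,t)=\int_{\mathbb R^N}g(x,T-t,y)\,\psi_T(dy).$$ Let $\mu(dx,dy)=\varphi_0(dx)\,\psi_T(dy)\,g(x,T,y)$, and suppose that $\mu(\mathbb R^N\times\mathbb R^N)=1$. An $\mathbb R^N$-valued process $(Z_\tau)_{\tau\in[0,T]}$ on a complete probability space $(\Omega,\mathcal F,\mathbb P)$ is a *Bernstein process* if $\mathbb E(f(Z_r)\mid \sigma(Z_\tau:\tau\le s)\vee\sigma(Z_\tau:\tau\ge t))=\mathbb E(f(Z_r)\mid Z_s,Z_t)$ almost surely for every bounded Borel $f:\mathbb R^N\to\mathbb R$ and all $0\le s<r<t\le T$. Then there is a Bernstein process $(Z_\tau)_{\tau\in[0,T]}$ on some complete probability space such that the law of $(Z_0,Z_T)$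 is $\mu$ and such that, for all $0\le s<r<t\le T$ and every Borel set $E\subseteq\mathbb R^N$, almost surely $$\mathbb P(Z_r\in E\mid Z_s,Z_t)=\int_E\frac{g(Z_t,t-r,z)\,g(z,r-s,Z_s)}{g(Z_t,t-s,Z_s)}\,dz .$$ Moreover, every such process is Markovian, and for all Borel sets $E,E_1,\dots,E_n\subseteq\mathbb R^N$ it satisfies: 1. for every $n\ge1$ and all $0<t_1<\dots<t_n<T$, $$\mathbb P(Z_{t_1}\in E_1,\dots,Z_{t_n}\in E_n)=\int_{E_1}dx_1\cdots\int_{E_n}dx_n\ \prod_{k=2}^n g(x_k,t_k-t_{k-1},x_{k-1})\;u_{\varphi_0}(x_1,t_1)\,v_{\psi_T}(x_n,t_n);$$ 2. for every $t\in(0,T)$, $\ \mathbb P(Z_t\in E)=\int_E u_{\varphi_0}(x,t)\,v_{\psi_T}(x,t)\,dx$; 3. $\mathbb P(Z_0\in E)=\int_E v_{\psi_T}(x,0)\,\varphi_0(dx)$ and $\ \mathbb P(Z_T\in E)=\int_E u_{\varphi_0}(x,T)\,\psi_T(dx)$. -/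

import Mathlib

open MeasureTheory Set Filter Topology
open scoped ENNReal

noncomputable section

namespace Bernstein

/-- The state space `ℝ^N` with its Euclidean structure. -/
abbrev Space (N : ℕ) : Type := EuclideanSpace ℝ (Fin N)

variable {N : ℕ}

/-! ### The parabolic equation, its weak solutions and its Green function -/

/-- The elliptic operator `½ Δ f - V f`. -/
def ellipticOp (V : Space N → ℝ) (f : Space N → ℝ) (x : Space N) : ℝ :=
  (1 / 2 : ℝ) * Laplacian.laplacian f x - V x * f x

/-- `(w t)_{0 ≤ t ≤ τ}` is a family of positive Radon measures on `ℝ^N` which solves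
`∂_t w = ½ Δ w - V w` on `ℝ^N × (0, τ]` in the sense of distributions, with initial datum
the measure `w 0`. -/
structure IsWeakSolution (V : Space N → ℝ) (τ : ℝ) (w : ℝ → Measure (Space N)) : Prop where
  locallyFinite : ∀ t ∈ Icc (0 : ℝ) τ, IsLocallyFiniteMeasure (w t)
  measurable : Measurable (fun t : Icc (0 : ℝ) τ => w t)
  mass_finite : ∀ K : Set (Space N), IsCompact K →
    ∫⁻ r in Icc (0 : ℝ) τ, w r K < ∞
  potential_finite : ∀ K : Set (Space N), IsCompact K →
    ∫⁻ r in Icc (0 : ℝ) τ, ∫⁻ x in K, ENNReal.ofReal |V x| ∂(w r) < ∞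
  equation : ∀ f : Space N → ℝ, ContDiff ℝ (⊤ : ℕ∞) f → HasCompactSupport f →
    ∀ t ∈ Icc (0 : ℝ) τ,
      ∫ x, f x ∂(w t) = ∫ x, f x ∂(w 0) + ∫ r in (0 : ℝ)..t, ∫ x, ellipticOp V f x ∂(w r)

/-- The evolution of the measure `φ` under the kernel `g`: it is `φ` at time `0`, and the measure
with Lebesgue density `x ↦ ∫ φ(dy) g(x, t, y)` at the other times. -/
def kernelFlow (g : Space N → ℝ → Space N → ℝ) (φ : Measure (Space N)) (t : ℝ) :
    Measure (Space N) :=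
  if t = 0 then φ
  else volume.withDensity (fun x => ∫⁻ y, ENNReal.ofReal (g x t y) ∂φ)

/-- `g` is the parabolic Green function on `ℝ^N × (0, T] × ℝ^N` of the adjoint problems
`∂_t u = ½ Δ u - V u` and `-∂_t v = ½ Δ v - V v`, i.e. the minimal nonnegative fundamental
solution. -/
structure IsGreenFunction (V : Space N → ℝ) (T : ℝ) (g : Space N → ℝ → Space N → ℝ) : Prop where
  nonneg : ∀ x, ∀ t ∈ Ioc (0 : ℝ) T, ∀ y, 0 ≤ g x t y
  /-- For every pole `y`, `(x, t) ↦ g(x, t, y)` solves the forward equation with initial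
  datum `δ_y`. -/
  forward : ∀ y, IsWeakSolution V T (kernelFlow g (Measure.dirac y))
  /-- For every pole `x`, `(y, t) ↦ g(x, T - t, y)` solves the adjoint backward equation with
  final datum `δ_x`; this is written here after the change of time `t ↦ T - t`. -/
  adjoint : ∀ x, IsWeakSolution V T (kernelFlow (fun b t a => g a t b) (Measure.dirac x))
  /-- `∫ φ(dy) g(x, t, y)` lies below every nonnegative solution of the Cauchy problem with
  initial datum `φ`. -/
  minimal : ∀ τ ∈ Ioc (0 : ℝ) T, ∀ w : ℝ → Measure (Space N), IsWeakSolution V τ w →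
    ∀ t ∈ Icc (0 : ℝ) τ, kernelFlow g (w 0) t ≤ w t

/-- The Green function of the measurable potential `V` is jointly continuous and strictly positive. -/
structure PotentialHypothesis (V : Space N → ℝ) (T : ℝ) (g : Space N → ℝ → Space N → ℝ) : Prop where
  measurable_potential : Measurable V
  green : IsGreenFunction V T g
  continuousOn : ContinuousOn (fun p : Space N × ℝ × Space N => g p.1 p.2.1 p.2.2)
    (univ ×ˢ (Ioc (0 : ℝ) T ×ˢ univ))
  pos : ∀ x, ∀ t ∈ Ioc (0 : ℝ) T, ∀ y, 0 < g x t y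

/-! ### Classical positive solutions -/

/-- `u` is a function of class `C^{2,1}` on `ℝ^N × I`, where `I` is an interval of times. -/
structure IsClassTwoOne (I : Set ℝ) (u : Space N → ℝ → ℝ) : Prop where
  contDiff : ∀ t ∈ I, ContDiff ℝ 2 (fun x => u x t)
  continuousOn_space : ∀ k : ℕ, k ≤ 2 →
    ContinuousOn (fun p : Space N × ℝ => iteratedFDeriv ℝ k (fun x => u x p.2) p.1) (univ ×ˢ I)
  differentiable_time : ∀ x, DifferentiableOn ℝ (u x) I
  continuousOn_time :
    ContinuousOn (fun p : Space N × ℝ => derivWithin (u p.1) I p.2) (univ ×ˢ I)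

/-- `u` is a classical positive solution of the forward Cauchy problem
`∂_t u = ½ Δ u - V u` on `ℝ^N × (0, T]`, `u(·, 0) = φ`. The initial measure is taken in the sense
of vague convergence. -/
structure IsClassicalForwardSolution (V : Space N → ℝ) (T : ℝ) (φ : Measure (Space N))
    (u : Space N → ℝ → ℝ) : Prop where
  pos : ∀ x, ∀ t ∈ Ioc (0 : ℝ) T, 0 < u x t
  regular : IsClassTwoOne (Ioc (0 : ℝ) T) u
  equation : ∀ x, ∀ t ∈ Ioc (0 : ℝ) T,
    derivWithin (u x) (Ioc (0 : ℝ) T) t = ellipticOp V (fun z => u z t) x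
  initial : ∀ f : Space N → ℝ, Continuous f → HasCompactSupport f →
    Tendsto (fun t => ∫ x, f x * u x t) (𝓝[>] (0 : ℝ)) (𝓝 (∫ x, f x ∂φ))

/-- `v` is a classical positive solution of the backward Cauchy problem
`-∂_t v = ½ Δ v - V v` on `ℝ^N × [0, T)`, `v(·, T) = ψ`. -/
structure IsClassicalBackwardSolution (V : Space N → ℝ) (T : ℝ) (ψ : Measure (Space N))
    (v : Space N → ℝ → ℝ) : Prop where
  pos : ∀ x, ∀ t ∈ Ico (0 : ℝ) T, 0 < v x t
  regular : IsClassTwoOne (Ico (0 : ℝ) T) v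
  equation : ∀ x, ∀ t ∈ Ico (0 : ℝ) T,
    - derivWithin (v x) (Ico (0 : ℝ) T) t = ellipticOp V (fun z => v z t) x
  final : ∀ f : Space N → ℝ, Continuous f → HasCompactSupport f →
    Tendsto (fun t => ∫ x, f x * v x t) (𝓝[<] T) (𝓝 (∫ x, f x ∂ψ))

/-- `u_φ(x, t) = ∫ φ(dy) g(x, t, y)`. -/
def forwardSol (g : Space N → ℝ → Space N → ℝ) (φ : Measure (Space N)) (x : Space N) (t : ℝ) : ℝ :=
  ∫ y, g x t y ∂φ

/-- `v_ψ(x, t) = ∫ ψ(dy) g(x, T - t, y)`. -/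
def backwardSol (g : Space N → ℝ → Space N → ℝ) (T : ℝ) (ψ : Measure (Space N)) (x : Space N)
    (t : ℝ) : ℝ :=
  ∫ y, g x (T - t) y ∂ψ

/-- `φ₀` and `ψT` are positive (that is, locally finite Borel) measures for which `u_{φ₀}` and
`v_{ψT}` are the unique classical positive solutions of the forward and the backward problem. -/
structure DataHypothesis (V : Space N → ℝ) (T : ℝ) (g : Space N → ℝ → Space N → ℝ)
    (φ₀ ψT : Measure (Space N)) : Prop where
  locallyFinite_initial : IsLocallyFiniteMeasure φ₀
  locallyFinite_final : IsLocallyFiniteMeasure ψT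
  forward_integrable : ∀ x, ∀ t ∈ Ioc (0 : ℝ) T, Integrable (fun y => g x t y) φ₀
  forward_solution : IsClassicalForwardSolution V T φ₀ (forwardSol g φ₀)
  forward_unique : ∀ u, IsClassicalForwardSolution V T φ₀ u →
    ∀ x, ∀ t ∈ Ioc (0 : ℝ) T, u x t = forwardSol g φ₀ x t
  backward_integrable : ∀ x, ∀ t ∈ Ico (0 : ℝ) T, Integrable (fun y => g x (T - t) y) ψT
  backward_solution : IsClassicalBackwardSolution V T ψT (backwardSol g T ψT)
  backward_unique : ∀ v, IsClassicalBackwardSolution V T ψT v →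
    ∀ x, ∀ t ∈ Ico (0 : ℝ) T, v x t = backwardSol g T ψT x t

/-! ### Bernstein and Markov processes -/

/-- `σ(Z_τ : 0 ≤ τ ≤ s)`. -/
abbrev pastAlgebra {Ω : Type*} (Z : ℝ → Ω → Space N) (s : ℝ) : MeasurableSpace Ω :=
  ⨆ τ ∈ Icc (0 : ℝ) s, MeasurableSpace.comap (Z τ) inferInstance

/-- `σ(Z_τ : t ≤ τ ≤ T)`. -/
abbrev futureAlgebra {Ω : Type*} (T : ℝ) (Z : ℝ → Ω → Space N) (t : ℝ) : MeasurableSpace Ω :=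
  ⨆ τ ∈ Icc t T, MeasurableSpace.comap (Z τ) inferInstance

/-- `σ(Z_s)`. -/
abbrev timeAlgebra {Ω : Type*} (Z : ℝ → Ω → Space N) (s : ℝ) : MeasurableSpace Ω :=
  MeasurableSpace.comap (Z s) inferInstance

/-- `(Z_τ)_{0 ≤ τ ≤ T}` is a Bernstein (reciprocal) process on the complete probability space
`(Ω, P)`. Only the times in `[0, T]` matter. -/
structure IsBernsteinProcess {Ω : Type*} [MeasurableSpace Ω] (T : ℝ) (P : Measure Ω)
    (Z : ℝ → Ω → Space N) : Prop where
  probability : IsProbabilityMeasure P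
  complete : P.IsComplete
  measurable : ∀ τ ∈ Icc (0 : ℝ) T, Measurable (Z τ)
  bernstein : ∀ f : Space N → ℝ, Measurable f → (∃ C, ∀ x, |f x| ≤ C) →
    ∀ s r t : ℝ, 0 ≤ s → s < r → r < t → t ≤ T →
      P[fun ω => f (Z r ω) | pastAlgebra Z s ⊔ futureAlgebra T Z t]
        =ᵐ[P] P[fun ω => f (Z r ω) | timeAlgebra Z s ⊔ timeAlgebra Z t]

/-- The Markov property of `(Z_τ)_{0 ≤ τ ≤ T}`. -/
def IsMarkovProcess {Ω : Type*} [MeasurableSpace Ω] (T : ℝ) (P : Measure Ω)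
    (Z : ℝ → Ω → Space N) : Prop :=
  ∀ f : Space N → ℝ, Measurable f → (∃ C, ∀ x, |f x| ≤ C) →
    ∀ s t : ℝ, 0 ≤ s → s < t → t ≤ T →
      P[fun ω => f (Z t ω) | pastAlgebra Z s] =ᵐ[P] P[fun ω => f (Z t ω) | timeAlgebra Z s]

/-- `p(x, t; z, r; y, s) = g(x, t - r, z) g(z, r - s, y) / g(x, t - s, y)`. -/
def bernsteinDensity (g : Space N → ℝ → Space N → ℝ) (x : Space N) (t : ℝ) (z : Space N) (r : ℝ)
    (y : Space N) (s : ℝ) : ℝ :=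
  g x (t - r) z * g z (r - s) y / g x (t - s) y

/-- `P(x, t; E, r; y, s) = ∫_E p(x, t; z, r; y, s) dz`. -/
def transitionFunction (g : Space N → ℝ → Space N → ℝ) (x : Space N) (t : ℝ) (E : Set (Space N))
    (r : ℝ) (y : Space N) (s : ℝ) : ℝ :=
  ∫ z in E, bernsteinDensity g x t z r y s

/-- The Bernstein process determined by the Green function `g` and the probability measure `μ` on
`ℝ^N × ℝ^N`: `bernsteinDensity` gives its transition function and `μ` is the joint law of
`(Z_0, Z_T)`. These properties determine all the finite-dimensional laws. -/
structure IsBernsteinProcessOf {Ω : Type*} [MeasurableSpace Ω] (g : Space N → ℝ → Space N → ℝ)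
    (T : ℝ) (μ : Measure (Space N × Space N)) (P : Measure Ω) (Z : ℝ → Ω → Space N) : Prop where
  isBernstein : IsBernsteinProcess T P Z
  transition : ∀ E : Set (Space N), MeasurableSet E →
    ∀ s r t : ℝ, 0 ≤ s → s < r → r < t → t ≤ T →
      P[(Z r ⁻¹' E).indicator (fun _ => (1 : ℝ)) | timeAlgebra Z s ⊔ timeAlgebra Z t]
        =ᵐ[P] fun ω => transitionFunction g (Z t ω) t E r (Z s ω) s
  endpoints : P.map (fun ω => (Z 0 ω, Z T ω)) = μ

/-- The measure `φ₀(dx) ψT(dy) g(x, T, y)`. -/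
def markovianMeasure (g : Space N → ℝ → Space N → ℝ) (T : ℝ) (φ₀ ψT : Measure (Space N)) :
    Measure (Space N × Space N) :=
  (φ₀.prod ψT).withDensity (fun p => ENNReal.ofReal (g p.1 T p.2))

end Bernstein

end

/-! The analytic input is that minimality, continuity and positivity force `g` to be symmetric and
to satisfy the Chapman-Kolmogorov equation at every pair of points. Symmetry (`symm`): the adjoint
clause, after reversal of time, says that `g(y, t, ·)` solves the same forward equation from `δ_y`
as `g(·, t, y)`; minimality gives `g(x, t, y) ≤ g(y, t, x)` for almost every `x`, continuity for
every `x`, and exchanging the points gives equality. Chapman-Kolmogorov (`lintegral_green_mul`):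
restarting `g(·, ·, y)` at time `s` gives a weak solution above the Green flow of its own datum.
Conversely, that flow is a weak solution (`isWeakSolution_kernelFlow`), and following `g` up to `s`
by it gives a weak solution started from `δ_y`, hence above `g`. So the identity holds almost
everywhere; Fatou's lemma and the concentration of `g(x, r, ·)` at `x` as `r → 0` remove the
exceptional set.

The probabilistic part is Doob's `h`-transform by `h = v_ψ`. By Chapman-Kolmogorov the kernels
`Q_{s,t}(x, dy) = g(x, t-s, y) h(y, t) / h(x, s) dy` have mass one and compose; at time `T` the
convention is `h = 1` with reference measure `ψ`. With `b` the kernel of density `bernsteinDensity`,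
the decisive identity is `Q_{s,t}(x, dy) b(y, x; dz) = Q_{s,r}(x, dz) Q_{r,t}(z, dy)`
(`lintegral_bridge_markovKernel`), both sides having the same density after cancellation. Moreover
`φ(dx) h(x, 0) Q_{0,T}(x, dy)` is exactly `μ`, because `μ` is a product measure weighted by `g`.

Existence: Kolmogorov extension yields a Markov process with kernels `Q` and initial law `φ(dx) h(x,
0)`; the identity makes `b` its bridges, which gives the Bernstein property. Conversely, in any
process with these bridges and endpoint law `μ`, the law of `Z_T` given finitely many earlier times
is `Q_{m,T}(Z_m)`, where `m` is the latest of them: it is true for time `0` alone, and the identity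
lets further times be inserted one by one in increasing order (`isMarkovOn_of_bridge`). Hence every
such process is Markov with kernels `Q`, and in its finite-dimensional laws the factors `h` cancel
telescopically, leaving `u_φ` at the first time and `v_ψ` at the last. -/

noncomputable section

namespace Bernstein

variable {N : ℕ} {V : Space N → ℝ} {T τ : ℝ} {w : ℝ → Measure (Space N)}

/-! ### Integrability of the elliptic term -/

lemma continuous_laplacian {f : Space N → ℝ} (hf : ContDiff ℝ (⊤ : ℕ∞) f) :
    Continuous (Laplacian.laplacian f) := by
  have h2 : ContDiff ℝ 2 f := hf.of_le (WithTop.coe_le_coe.2 le_top)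
  rw [InnerProductSpace.laplacian_eq_iteratedFDeriv_stdOrthonormalBasis]
  refine continuous_finsetSum _ fun i _ => ?_
  exact (h2.continuous_iteratedFDeriv le_rfl).eval_const _

lemma laplacian_eq_zero_of_notMem_tsupport {f : Space N → ℝ} {x : Space N}
    (hx : x ∉ tsupport f) : Laplacian.laplacian f x = 0 := by
  have h0 : f =ᶠ[𝓝 x] fun _ => 0 := notMem_tsupport_iff_eventuallyEq.1 hx
  have := InnerProductSpace.laplacian_congr_nhds h0
  have h1 := this.eq_of_nhds
  rw [h1]
  simp [InnerProductSpace.laplacian_eq_iteratedFDeriv_stdOrthonormalBasis]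

lemma measurable_ellipticOp (hV : Measurable V) {f : Space N → ℝ}
    (hf : ContDiff ℝ (⊤ : ℕ∞) f) : Measurable (ellipticOp V f) := by
  unfold ellipticOp
  exact ((continuous_laplacian hf).measurable.const_mul _).sub
    (hV.mul hf.continuous.measurable)

/-- The bound is shaped to match the two finiteness clauses of `IsWeakSolution`, on the mass and on
the integral of `|V|` over compact sets. Since `V` is only measurable, no bound independent of `|V|`
is available. -/
lemma exists_enorm_ellipticOp_le (V : Space N → ℝ) {f : Space N → ℝ}
    (hf : ContDiff ℝ (⊤ : ℕ∞) f) (hc : HasCompactSupport f) :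
    ∃ C : ℝ≥0∞, C ≠ ∞ ∧ ∀ x, ‖ellipticOp V f x‖ₑ ≤
      (tsupport f).indicator (fun x => C * (1 + ENNReal.ofReal |V x|)) x := by
  obtain ⟨c₁, h₁⟩ :=
      hc.isCompact.exists_bound_of_continuousOn (continuous_laplacian hf).continuousOn
  obtain ⟨c₂, h₂⟩ := hc.isCompact.exists_bound_of_continuousOn hf.continuous.continuousOn
  refine ⟨ENNReal.ofReal (max c₁ c₂), ENNReal.ofReal_ne_top, fun x => ?_⟩
  by_cases hx : x ∈ tsupport f
  · rw [indicator_of_mem hx]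
    have a₁ := (h₁ x hx).trans (le_max_left c₁ c₂)
    have a₂ := (h₂ x hx).trans (le_max_right c₁ c₂)
    have hC : 0 ≤ max c₁ c₂ := (norm_nonneg _).trans a₁
    rw [← ENNReal.ofReal_one, ← ENNReal.ofReal_add zero_le_one (abs_nonneg _),
      ← ENNReal.ofReal_mul hC, ← ofReal_norm]
    refine ENNReal.ofReal_le_ofReal ?_
    unfold ellipticOp
    rw [Real.norm_eq_abs] at *
    calc |1 / 2 * Laplacian.laplacian f x - V x * f x|
        ≤ |1 / 2 * Laplacian.laplacian f x| + |V x * f x| := abs_sub _ _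
      _ = 1 / 2 * |Laplacian.laplacian f x| + |V x| * |f x| := by
          rw [abs_mul, abs_mul]; norm_num
      _ ≤ max c₁ c₂ + |V x| * max c₁ c₂ := by
          have := abs_nonneg (Laplacian.laplacian f x)
          gcongr
          linarith
      _ = _ := by ring
  · rw [indicator_of_notMem hx]
    simp [ellipticOp, laplacian_eq_zero_of_notMem_tsupport hx, image_eq_zero_of_notMem_tsupport hx]

/-! ### Weak solutions: integrability in time, restart and concatenation. -/

namespace IsWeakSolution

lemma lintegral_enorm_ellipticOp_lt_top (hw : IsWeakSolution V τ w) (hV : Measurable V)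
    {f : Space N → ℝ} (hf : ContDiff ℝ (⊤ : ℕ∞) f) (hc : HasCompactSupport f) :
    ∫⁻ r in Icc (0 : ℝ) τ, ∫⁻ x, ‖ellipticOp V f x‖ₑ ∂(w r) < ∞ := by
  obtain ⟨C, hC, hle⟩ := exists_enorm_ellipticOp_le V hf hc
  have hK := hc.isCompact
  have hKm : MeasurableSet (tsupport f) := hK.measurableSet
  have hVm : Measurable fun x => ENNReal.ofReal |V x| := hV.abs.ennreal_ofReal
  have hmeas : AEMeasurable (fun r => w r (tsupport f)) (volume.restrict (Icc (0 : ℝ) τ)) :=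
    aemeasurable_restrict_of_measurable_subtype measurableSet_Icc
      ((Measure.measurable_coe hKm).comp hw.measurable)
  calc ∫⁻ r in Icc (0 : ℝ) τ, ∫⁻ x, ‖ellipticOp V f x‖ₑ ∂(w r)
      ≤ ∫⁻ r in Icc (0 : ℝ) τ, C * (w r (tsupport f)
          + ∫⁻ x in tsupport f, ENNReal.ofReal |V x| ∂(w r)) := by
        refine lintegral_mono fun r => ?_
        refine (lintegral_mono hle).trans ?_
        rw [lintegral_indicator hKm, lintegral_const_mul _ (hVm.const_add 1),
          lintegral_add_left (f := fun _ => 1) measurable_const]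
        simp
    _ = C * ((∫⁻ r in Icc (0 : ℝ) τ, w r (tsupport f)) +
          ∫⁻ r in Icc (0 : ℝ) τ, ∫⁻ x in tsupport f, ENNReal.ofReal |V x| ∂(w r)) := by
        rw [lintegral_const_mul' _ _ hC, lintegral_add_left' hmeas]
    _ < ∞ := ENNReal.mul_lt_top hC.lt_top
        (ENNReal.add_lt_top.2 ⟨hw.mass_finite _ hK, hw.potential_finite _ hK⟩)

lemma aemeasurable_lintegral (hw : IsWeakSolution V τ w) {h : Space N → ℝ≥0∞} (hh : Measurable h) :
    AEMeasurable (fun r => ∫⁻ x, h x ∂(w r)) (volume.restrict (Icc (0 : ℝ) τ)) :=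
  aemeasurable_restrict_of_measurable_subtype measurableSet_Icc
    ((Measure.measurable_lintegral hh).comp hw.measurable)

lemma integrableOn_ellipticOp (hw : IsWeakSolution V τ w) (hV : Measurable V)
    {f : Space N → ℝ} (hf : ContDiff ℝ (⊤ : ℕ∞) f) (hc : HasCompactSupport f) :
    IntegrableOn (fun r => ∫ x, ellipticOp V f x ∂(w r)) (Icc (0 : ℝ) τ) := by
  have hm := measurable_ellipticOp hV hf
  have hfin := hw.lintegral_enorm_ellipticOp_lt_top hV hf hc
  have hae : ∀ᵐ r ∂(volume.restrict (Icc (0 : ℝ) τ)),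
      ∫⁻ x, ‖ellipticOp V f x‖ₑ ∂(w r) < ∞ :=
    ae_lt_top' (hw.aemeasurable_lintegral hm.enorm) hfin.ne
  -- Measurability in `r` of a Bochner integral against a varying measure is reached through
  -- positive and negative parts, a splitting that is legitimate only where the integrand is
  -- integrable, that is for almost every `r`.
  have heq : (fun r => ∫ x, ellipticOp V f x ∂(w r)) =ᵐ[volume.restrict (Icc (0 : ℝ) τ)]
      fun r => (∫⁻ x, ENNReal.ofReal (ellipticOp V f x) ∂(w r)).toReal
        - (∫⁻ x, ENNReal.ofReal (-ellipticOp V f x) ∂(w r)).toReal := by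
    filter_upwards [hae] with r hr
    exact integral_eq_lintegral_pos_part_sub_lintegral_neg_part
      ⟨hm.aestronglyMeasurable, hr⟩
  refine ⟨(AEMeasurable.congr ?_ heq.symm).aestronglyMeasurable, ?_⟩
  · exact (hw.aemeasurable_lintegral hm.ennreal_ofReal).ennreal_toReal.sub
      (hw.aemeasurable_lintegral hm.neg.ennreal_ofReal).ennreal_toReal
  · exact (lintegral_mono fun r => enorm_integral_le_lintegral_enorm _).trans_lt hfin

lemma intervalIntegrable_ellipticOp (hw : IsWeakSolution V τ w) (hV : Measurable V)
    {f : Space N → ℝ} (hf : ContDiff ℝ (⊤ : ℕ∞) f) (hc : HasCompactSupport f) {a b : ℝ}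
    (ha : a ∈ Icc 0 τ) (hb : b ∈ Icc 0 τ) :
    IntervalIntegrable (fun r => ∫ x, ellipticOp V f x ∂(w r)) volume a b :=
  ((hw.integrableOn_ellipticOp hV hf hc).mono_set
    ((uIcc_subset_Icc ha hb))).intervalIntegrable

lemma sub_nonneg_time {s t : ℝ} (h : t ∈ Icc 0 (τ - s)) (hs : 0 ≤ s) : s + t ∈ Icc 0 τ :=
  ⟨by linarith [h.1], by linarith [h.2]⟩

lemma setLIntegral_add_left_le {h : ℝ → ℝ≥0∞} {s : ℝ} (hs : 0 ≤ s) :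
    ∫⁻ r in Icc (0 : ℝ) (τ - s), h (s + r) ≤ ∫⁻ r in Icc (0 : ℝ) τ, h r := by
  have hpre : (fun r => s + r) ⁻¹' Icc s τ = Icc 0 (τ - s) := by
    simp
  rw [← hpre, (measurePreserving_add_left volume s).setLIntegral_comp_preimage_emb
    (measurableEmbedding_addLeft s)]
  exact lintegral_mono_set (Icc_subset_Icc_left hs)

/-- Restarting a weak solution at the time `s`. -/
lemma shift (hw : IsWeakSolution V τ w) (hV : Measurable V) {s : ℝ} (hs : s ∈ Icc 0 τ) :
    IsWeakSolution V (τ - s) fun r => w (s + r) where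
  locallyFinite t ht := hw.locallyFinite _ (sub_nonneg_time ht hs.1)
  measurable := by
    have : Measurable fun t : Icc (0 : ℝ) (τ - s) =>
        (⟨s + t, sub_nonneg_time t.2 hs.1⟩ : Icc (0 : ℝ) τ) :=
      (measurable_subtype_coe.const_add s).subtype_mk
    exact hw.measurable.comp this
  mass_finite K hK := (setLIntegral_add_left_le (h := fun r => w r K) hs.1).trans_lt
    (hw.mass_finite K hK)
  potential_finite K hK :=
    (setLIntegral_add_left_le (h := fun r => ∫⁻ x in K, ENNReal.ofReal |V x| ∂(w r)) hs.1).trans_lt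
      (hw.potential_finite K hK)
  equation f hf hc t ht := by
    have h0 : (0 : ℝ) ∈ Icc 0 τ := ⟨le_rfl, hs.1.trans hs.2⟩
    have hst := sub_nonneg_time ht hs.1
    have h1 := hw.equation f hf hc _ hst
    have h2 := hw.equation f hf hc s hs
    -- The restarted equation is the equation at `s + t` minus the equation at `s`; splitting the
    -- time integral requires its integrability.
    have h3 := intervalIntegral.integral_add_adjacent_intervals
      (hw.intervalIntegrable_ellipticOp hV hf hc h0 hs)
      (hw.intervalIntegrable_ellipticOp hV hf hc hs hst)
    have h4 := intervalIntegral.integral_comp_add_left (a := 0) (b := t)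
      (fun r => ∫ x, ellipticOp V f x ∂(w r)) s
    simp only [add_zero] at h4 ⊢
    rw [h4, h1, h2, ← h3]
    ring

/-- Concatenation of two weak solutions. -/
lemma concat (hw : IsWeakSolution V τ w) (hV : Measurable V) {s : ℝ} (hs : s ∈ Icc 0 τ)
    {w' : ℝ → Measure (Space N)} (hw' : IsWeakSolution V (τ - s) w') (h0 : w' 0 = w s) :
    IsWeakSolution V τ fun r => if r ≤ s then w r else w' (r - s) := by
  -- Both finiteness clauses are instances of this bound, with `H m = m K` and `H m = ∫_K |V| dm`.
  -- Only upper bounds are involved, so nothing need be measurable in `r`.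
  have hdom : ∀ H : Measure (Space N) → ℝ≥0∞,
      ∫⁻ r in Icc (0 : ℝ) τ, H (w r) < ∞ → ∫⁻ r in Icc (0 : ℝ) (τ - s), H (w' r) < ∞ →
      ∫⁻ r in Icc (0 : ℝ) τ, H (if r ≤ s then w r else w' (r - s)) < ∞ := by
    intro H h1 h2
    have hsplit : Icc 0 τ = Icc 0 s ∪ Ioc s τ := (Icc_union_Ioc_eq_Icc hs.1 hs.2).symm
    rw [hsplit]
    refine (lintegral_union_le _ _ _).trans_lt (ENNReal.add_lt_top.2 ⟨?_, ?_⟩)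
    · refine lt_of_le_of_lt ?_ h1
      rw [setLIntegral_congr_fun (g := fun r => H (w r)) measurableSet_Icc
        fun r hr => by simp [hr.2]]
      exact lintegral_mono_set (Icc_subset_Icc_right hs.2)
    · refine lt_of_le_of_lt ?_ h2
      rw [setLIntegral_congr_fun (g := fun r => H (w' (r - s))) measurableSet_Ioc
        fun r hr => by simp [hr.1.not_ge]]
      have hpre : (fun r => r - s) ⁻¹' Ioc 0 (τ - s) = Ioc s τ := by
        ext r; simp
      rw [← hpre, (measurePreserving_sub_right volume s).setLIntegral_comp_preimage_emb
        (f := fun r => H (w' r)) (measurableEmbedding_subRight s)]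
      exact lintegral_mono_set Ioc_subset_Icc_self
  refine ⟨fun t ht => ?_, ?_, fun K hK => hdom (fun m => m K) (hw.mass_finite K hK)
    (hw'.mass_finite K hK), fun K hK => hdom (fun m => ∫⁻ x in K, ENNReal.ofReal |V x| ∂m)
      (hw.potential_finite K hK) (hw'.potential_finite K hK), fun f hf hc t ht => ?_⟩
  · split_ifs with h
    · exact hw.locallyFinite t ht
    · exact hw'.locallyFinite _ ⟨by linarith, by linarith [ht.2]⟩
  -- The truncation `max (t - s) 0` keeps the time inside `[0, τ - s]`, where `w'` is known to be
  -- measurable; it has no effect in the branch that uses it.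
  · have hm1 : Measurable fun t : Icc (0 : ℝ) τ => w' (max (t - s) 0) := by
      have : Measurable fun t : Icc (0 : ℝ) τ =>
          (⟨max (t - s) 0, le_max_right _ _,
            max_le (by linarith [t.2.2]) (by linarith [hs.2])⟩ : Icc (0 : ℝ) (τ - s)) :=
        ((measurable_subtype_coe.sub_const s).max measurable_const).subtype_mk
      exact hw'.measurable.comp this
    have hset : MeasurableSet {t : Icc (0 : ℝ) τ | (t : ℝ) ≤ s} :=
      measurable_subtype_coe measurableSet_Iic
    have : Measurable fun t : Icc (0 : ℝ) τ =>
        if (t : ℝ) ≤ s then w t else w' (max (t - s) 0) := hw.measurable.ite hset hm1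
    convert this using 2 with t
    split_ifs with h
    · rfl
    · rw [max_eq_left (by linarith)]
  · have hτ0 : (0 : ℝ) ∈ Icc 0 τ := ⟨le_rfl, hs.1.trans hs.2⟩
    have hfirst : ∀ t, 0 ≤ t → t ≤ s →
        ∫ r in (0 : ℝ)..t, ∫ x, ellipticOp V f x ∂(if r ≤ s then w r else w' (r - s))
          = ∫ r in (0 : ℝ)..t, ∫ x, ellipticOp V f x ∂(w r) := by
      intro t h0t hts
      refine intervalIntegral.integral_congr fun r hr => ?_
      rw [uIcc_of_le h0t] at hr
      simp [hr.2.trans hts]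
    by_cases hts : t ≤ s
    · simp only [hts, hs.1, if_true]
      rw [hfirst t ht.1 hts]
      exact hw.equation f hf hc t ht
    · have hst : s ≤ t := (not_le.1 hts).le
      simp only [hts, hs.1, if_true, if_false]
      have hmem : t - s ∈ Icc 0 (τ - s) := ⟨by linarith, by linarith [ht.2]⟩
      have hmem0 : (0 : ℝ) ∈ Icc 0 (τ - s) := ⟨le_rfl, by linarith [hs.2]⟩
      have hcongr : ∀ r ∈ Ioc s t,
          ∫ x, ellipticOp V f x ∂(if r ≤ s then w r else w' (r - s))
            = ∫ x, ellipticOp V f x ∂(w' (r - s)) := fun r hr => by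
        simp [hr.1.not_ge]
      have hint1 : IntervalIntegrable (fun r => ∫ x, ellipticOp V f x
          ∂(if r ≤ s then w r else w' (r - s))) volume 0 s := by
        refine (hw.intervalIntegrable_ellipticOp hV hf hc hτ0 hs).congr fun r hr => ?_
        rw [uIoc_of_le hs.1] at hr
        simp [hr.2]
      have hint2 : IntervalIntegrable (fun r => ∫ x, ellipticOp V f x
          ∂(if r ≤ s then w r else w' (r - s))) volume s t := by
        have := (hw'.intervalIntegrable_ellipticOp hV hf hc hmem0 hmem).comp_sub_right s
        simp only [zero_add, sub_add_cancel] at this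
        refine this.congr fun r hr => ?_
        rw [uIoc_of_le hst] at hr
        exact (hcongr r hr).symm
      have h1 := hw.equation f hf hc s hs
      have h2 := hw'.equation f hf hc _ hmem
      have h3 := intervalIntegral.integral_comp_sub_right (a := s) (b := t)
        (fun r => ∫ x, ellipticOp V f x ∂(w' r)) s
      rw [sub_self] at h3
      have h4 : ∫ r in s..t, ∫ x, ellipticOp V f x ∂(if r ≤ s then w r else w' (r - s))
          = ∫ r in s..t, ∫ x, ellipticOp V f x ∂(w' (r - s)) := by
        rw [intervalIntegral.integral_of_le hst, intervalIntegral.integral_of_le hst]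
        exact setIntegral_congr_fun measurableSet_Ioc hcongr
      rw [← intervalIntegral.integral_add_adjacent_intervals hint1 hint2, hfirst s hs.1 le_rfl, h4,
        h3, h2, h0, h1]
      ring

end IsWeakSolution

end Bernstein
end

/-! ### The Green kernel and the flow of an initial measure. -/

noncomputable section

namespace Bernstein

variable {N : ℕ} {V : Space N → ℝ} {T τ : ℝ} {w : ℝ → Measure (Space N)}
  {g : Space N → ℝ → Space N → ℝ}

open ProbabilityTheory

/-- The Green function as an extended nonnegative function, extended by `0` outside `(0, T]`. -/
def greenDensity (g : Space N → ℝ → Space N → ℝ) (T t : ℝ) (x y : Space N) : ℝ≥0∞ :=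
  if t ∈ Ioc 0 T then ENNReal.ofReal (g x t y) else 0

lemma green_of_mem {t : ℝ} (ht : t ∈ Ioc 0 T) (x y : Space N) :
    greenDensity g T t x y = ENNReal.ofReal (g x t y) := if_pos ht

lemma green_ne_top (t : ℝ) (x y : Space N) : greenDensity g T t x y ≠ ∞ := by
  unfold greenDensity; split_ifs <;> simp

/-- The kernel `(t, y) ↦ g(x, t, y) dx`. -/
def greenKernel (g : Space N → ℝ → Space N → ℝ) (T : ℝ) : Kernel (ℝ × Space N) (Space N) :=
  Kernel.withDensity (Kernel.const _ volume) fun p x => greenDensity g T p.1 x p.2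

namespace PotentialHypothesis

lemma measurable_green (H : PotentialHypothesis V T g) : Measurable fun p :
    ℝ × Space N × Space N => greenDensity g T p.1 p.2.1 p.2.2 := by
  have hs : MeasurableSet ((univ : Set (Space N)) ×ˢ (Ioc (0 : ℝ) T ×ˢ (univ : Set (Space N)))) :=
    MeasurableSet.univ.prod (measurableSet_Ioc.prod MeasurableSet.univ)
  have h1 : Measurable (((univ : Set (Space N)) ×ˢ (Ioc (0 : ℝ) T ×ˢ (univ :
      Set (Space N)))).indicator
      fun p => g p.1 p.2.1 p.2.2) := by
    classical
    rw [← piecewise_eq_indicator]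
    exact H.continuousOn.measurable_piecewise continuousOn_const hs
  have h2 : Measurable fun p : ℝ × Space N × Space N => ((p.2.1, p.1, p.2.2)
      : Space N × ℝ × Space N) := by
    fun_prop
  have h3 := (h1.comp h2).ennreal_ofReal
  convert h3 using 2 with p
  by_cases hp : p.1 ∈ Ioc 0 T
  · rw [green_of_mem hp, Function.comp_apply, indicator_of_mem (by simpa using hp)]
  · rw [Function.comp_apply, indicator_of_notMem (by simpa using hp)]
    simp [greenDensity, hp]

lemma measurable_green_prod (H : PotentialHypothesis V T g) (t : ℝ) :
    Measurable fun p : Space N × Space N => greenDensity g T t p.1 p.2 :=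
  H.measurable_green.comp (measurable_const.prodMk measurable_id)

lemma measurable_green_left (H : PotentialHypothesis V T g) (t : ℝ) (y : Space N)
    : Measurable fun x => greenDensity g T t x y :=
  (H.measurable_green_prod t).comp (measurable_id.prodMk measurable_const)

lemma measurable_green_right (H : PotentialHypothesis V T g) (t : ℝ) (x : Space N)
    : Measurable fun y => greenDensity g T t x y :=
  (H.measurable_green_prod t).comp (measurable_const.prodMk measurable_id)

lemma continuous_prod (H : PotentialHypothesis V T g) {t : ℝ} (ht : t ∈ Ioc 0 T) :
    Continuous fun p : Space N × Space N => g p.1 t p.2 := by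
  rw [← continuousOn_univ]
  exact H.continuousOn.comp (f := fun p : Space N × Space N => (p.1, t, p.2)) (by fun_prop)
    fun p _ => by simpa using ht

lemma greenKernel_apply (H : PotentialHypothesis V T g) (t : ℝ) (y : Space N) :
    greenKernel g T (t, y) = volume.withDensity fun x => greenDensity g T t x y := by
  have : Measurable (Function.uncurry fun (p : ℝ × Space N) x => greenDensity g T p.1 x p.2) :=
    H.measurable_green.comp (g := fun p : ℝ × Space N × Space N => greenDensity g T p.1 p.2.1 p.2.2)
      (f := fun q : (ℝ × Space N) × Space N => (q.1.1, q.2, q.1.2)) (by fun_prop)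
  rw [greenKernel, Kernel.withDensity_apply _ this, Kernel.const_apply]

lemma kernelFlow_dirac (H : PotentialHypothesis V T g) {t : ℝ} (ht : t ∈ Ioc 0 T) (y : Space N) :
    kernelFlow g (Measure.dirac y) t = greenKernel g T (t, y) := by
  rw [H.greenKernel_apply, kernelFlow, if_neg ht.1.ne']
  simp only [lintegral_dirac, green_of_mem ht]

lemma lintegral_greenKernel (H : PotentialHypothesis V T g) (t : ℝ) (y : Space N) {f :
    Space N → ℝ≥0∞} (hf : Measurable f) :
    ∫⁻ x, f x ∂(greenKernel g T (t, y)) = ∫⁻ x, greenDensity g T t x y * f x := by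
  rw [H.greenKernel_apply,
      lintegral_withDensity_eq_lintegral_mul _ (H.measurable_green_left t y) hf]
  rfl

/-- By Tonelli, the flow of `ρ` is the mixture over the pole of the flows of Dirac masses. This
reduces its integrals to those with a single pole. -/
lemma kernelFlow_eq_bind (H : PotentialHypothesis V T g) {t : ℝ} (ht : t ∈ Ioc 0 T) (ρ :
    Measure (Space N)) [SFinite ρ] :
    kernelFlow g ρ t
      = (Kernel.comap (greenKernel g T) (fun y => (t, y)) measurable_prodMk_left) ∘ₘ ρ := by
  ext A hA
  rw [Measure.bind_apply hA (Kernel.aemeasurable _), kernelFlow, if_neg ht.1.ne',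
    withDensity_apply _ hA]
  simp only [Kernel.comap_apply, H.greenKernel_apply, withDensity_apply _ hA, ← green_of_mem ht]
  rw [lintegral_lintegral_swap]
  exact (H.measurable_green_prod t).aemeasurable

lemma lintegral_kernelFlow (H : PotentialHypothesis V T g) {t : ℝ} (ht : t ∈ Ioc 0 T) (ρ :
    Measure (Space N)) [SFinite ρ]
    {f : Space N → ℝ≥0∞} (hf : Measurable f) :
    ∫⁻ x, f x ∂(kernelFlow g ρ t) = ∫⁻ y, ∫⁻ x, f x ∂(greenKernel g T (t, y)) ∂ρ := by
  rw [H.kernelFlow_eq_bind ht, Measure.lintegral_bind (Kernel.aemeasurable _) hf.aemeasurable]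
  rfl

lemma integral_kernelFlow (H : PotentialHypothesis V T g) {t : ℝ} (ht : t ∈ Ioc 0 T) (ρ :
    Measure (Space N)) [SFinite ρ]
    {f : Space N → ℝ} (hf : Integrable f (kernelFlow g ρ t)) :
    ∫ x, f x ∂(kernelFlow g ρ t) = ∫ y, ∫ x, f x ∂(greenKernel g T (t, y)) ∂ρ := by
  rw [H.kernelFlow_eq_bind ht] at hf ⊢
  rw [Measure.comp_eq_comp_const_apply] at hf ⊢
  rw [Kernel.integral_comp hf, Kernel.const_apply]
  rfl

lemma integrable_of_isLocallyFinite {ρ : Measure (Space N)} [IsLocallyFiniteMeasure ρ]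
    {f : Space N → ℝ} (hf : ContDiff ℝ (⊤ : ℕ∞) f) (hc : HasCompactSupport f) :
    Integrable f ρ := hf.continuous.integrable_of_hasCompactSupport hc

/-- The flow of the initial datum of a weak solution under the Green function is again a weak
solution. -/
lemma isWeakSolution_kernelFlow (H : PotentialHypothesis V T g) (hτ : τ ∈ Ioc 0 T) (hw :
    IsWeakSolution V τ w) :
    IsWeakSolution V τ (kernelFlow g (w 0)) := by
  -- Minimality puts the flow below `w`, so local finiteness and both finiteness clauses are
  -- inherited from `w`.
  have hle := H.green.minimal τ hτ w hw
  have h0 : (0 : ℝ) ∈ Icc 0 τ := ⟨le_rfl, hτ.1.le⟩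
  have := hw.locallyFinite 0 h0
  set ρ := w 0 with hρ
  have hlf : ∀ t ∈ Icc (0 : ℝ) τ, IsLocallyFiniteMeasure (kernelFlow g ρ t) := fun t ht => by
    have := hw.locallyFinite t ht
    exact Measure.isLocallyFiniteMeasure_of_le (hle t ht)
  refine ⟨hlf, ?_, fun K hK => ?_, fun K hK => ?_, fun f hf hc t ht => ?_⟩
  · refine Measure.measurable_of_measurable_coe _ fun A hA => ?_
    have hm : Measurable fun t : ℝ => ∫⁻ x in A, ∫⁻ y, greenDensity g T t x y ∂ρ := by
      have h1 : Measurable fun p : (ℝ × Space N) × Space N => greenDensity g T p.1.1 p.1.2 p.2 :=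
        H.measurable_green.comp (g := fun p : ℝ × Space N × Space N =>
            greenDensity g T p.1 p.2.1 p.2.2)
          (f := fun q : (ℝ × Space N) × Space N => (q.1.1, q.1.2, q.2)) (by fun_prop)
      exact h1.lintegral_prod_right'.lintegral_prod_right'
    have hset : MeasurableSet {t : Icc (0 : ℝ) τ | (t : ℝ) = 0} :=
      measurable_subtype_coe (measurableSet_singleton 0)
    have : Measurable fun t : Icc (0 : ℝ) τ => if (t : ℝ) = 0 then ρ A else
        ∫⁻ x in A, ∫⁻ y, greenDensity g T t x y ∂ρ :=
      measurable_const.ite hset (hm.comp measurable_subtype_coe)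
    convert this using 2 with t
    unfold kernelFlow
    split_ifs with h
    · rfl
    · have ht : (t : ℝ) ∈ Ioc 0 T := ⟨lt_of_le_of_ne t.2.1 (Ne.symm h), t.2.2.trans hτ.2⟩
      rw [withDensity_apply _ hA]
      simp only [green_of_mem ht]
  · exact (setLIntegral_mono' measurableSet_Icc fun r hr => hle r hr K).trans_lt
      (hw.mass_finite K hK)
  · refine (setLIntegral_mono' measurableSet_Icc fun r hr => ?_).trans_lt
      (hw.potential_finite K hK)
    exact lintegral_mono' (Measure.restrict_mono le_rfl (hle r hr)) le_rfl
  · rcases ht.1.eq_or_lt with rfl | ht0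
    · simp [kernelFlow]
    have htT : t ∈ Ioc 0 T := ⟨ht0, ht.2.trans hτ.2⟩
    have := hlf t ht
    have hm := measurable_ellipticOp H.measurable_potential hf
    set e := ellipticOp V f with he
    -- Domination by `w` bounds the absolute elliptic term of the flow. This justifies Fubini
    -- between the time integral and the integral over poles.
    have hfin : ∫⁻ r in Ioc 0 t, ∫⁻ y, ∫⁻ x, ‖e x‖ₑ ∂(greenKernel g T (r, y)) ∂ρ < ∞ := by
      refine lt_of_le_of_lt ?_
        (hw.lintegral_enorm_ellipticOp_lt_top H.measurable_potential hf hc)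
      refine le_trans (setLIntegral_mono' measurableSet_Ioc
        (g := fun r => ∫⁻ x, ‖e x‖ₑ ∂(w r)) fun r hr => ?_)
        (lintegral_mono_set (Ioc_subset_Icc_self.trans (Icc_subset_Icc_right ht.2)))
      rw [← H.lintegral_kernelFlow ⟨hr.1, hr.2.trans htT.2⟩ ρ hm.enorm]
      exact lintegral_mono' (hle r ⟨hr.1.le, hr.2.trans ht.2⟩) le_rfl
    have hsm : StronglyMeasurable fun p : ℝ × Space N => ∫ x, e x ∂(greenKernel g T p) :=
      hm.stronglyMeasurable.integral_kernel
    have hint : Integrable (fun p : ℝ × Space N => ∫ x, e x ∂(greenKernel g T p))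
        ((volume.restrict (Ioc 0 t)).prod ρ) := by
      refine ⟨hsm.aestronglyMeasurable, ?_⟩
      refine lt_of_le_of_lt (lintegral_mono fun p => enorm_integral_le_lintegral_enorm _) ?_
      rw [lintegral_prod _ (Measurable.aemeasurable (hm.enorm.lintegral_kernel))]
      exact hfin
    have hfi : Integrable f ρ := integrable_of_isLocallyFinite hf hc
    -- The equation for one pole; integrating it against `ρ` and exchanging the integrals gives the
    -- equation for the flow of `ρ`.
    have hpole : ∀ y, ∫ x, f x ∂(greenKernel g T (t, y))
        = f y + ∫ r in Ioc 0 t, ∫ x, e x ∂(greenKernel g T (r, y)) := by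
      intro y
      have h1 := (H.green.forward y).equation f hf hc t ⟨ht.1, htT.2⟩
      rw [H.kernelFlow_dirac htT, intervalIntegral.integral_of_le ht.1] at h1
      rw [h1]
      congr 1
      · simp [kernelFlow, integral_dirac]
      · refine setIntegral_congr_fun measurableSet_Ioc fun r hr => ?_
        simp only [H.kernelFlow_dirac (t := r) ⟨hr.1, hr.2.trans htT.2⟩]
        rfl
    rw [H.integral_kernelFlow htT ρ (integrable_of_isLocallyFinite hf hc)]
    simp only [hpole]
    rw [integral_add hfi hint.integral_prod_right, ← integral_integral_swap hint,
      intervalIntegral.integral_of_le ht.1]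
    congr 1
    · simp [kernelFlow]
    · refine integral_congr_ae ?_
      -- Disintegrating the signed integral over the poles requires integrability at the given time,
      -- which `hfin` supplies for almost every `r`.
      have hae : ∀ᵐ r ∂(volume.restrict (Ioc 0 t)),
          ∫⁻ y, ∫⁻ x, ‖e x‖ₑ ∂(greenKernel g T (r, y)) ∂ρ < ∞ := by
        refine ae_lt_top ?_ hfin.ne
        exact (hm.enorm.lintegral_kernel (κ := greenKernel g T)).lintegral_prod_right'
      filter_upwards [hae, ae_restrict_mem measurableSet_Ioc] with r hr hrm
      have hrT : r ∈ Ioc 0 T := ⟨hrm.1, hrm.2.trans htT.2⟩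
      rw [H.integral_kernelFlow hrT ρ]
      refine ⟨hm.aestronglyMeasurable, ?_⟩
      rw [HasFiniteIntegral, H.lintegral_kernelFlow hrT ρ hm.enorm]
      exact hr

end PotentialHypothesis

end Bernstein
end

/-! ### From minimality to the Chapman-Kolmogorov equation. -/

noncomputable section

namespace Bernstein

variable {N : ℕ} {V : Space N → ℝ} {T τ : ℝ} {w : ℝ → Measure (Space N)}
  {g : Space N → ℝ → Space N → ℝ}

lemma ae_le_of_withDensity_le {f h : Space N → ℝ≥0∞} (hf : Measurable f)
    (hle : volume.withDensity f ≤ volume.withDensity h) : f ≤ᵐ[volume] h := by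
  refine ae_le_of_forall_setLIntegral_le_of_sigmaFinite hf fun s hs _ => ?_
  have := hle s
  rwa [withDensity_apply _ hs, withDensity_apply _ hs] at this

namespace PotentialHypothesis

/-! ### Symmetry and the semigroup property of the Green function -/

/-- The time-reversed adjoint solution with pole `y` solves the forward equation from `δ_y`, so
minimality bounds `g(·, t, y)` by it almost everywhere; the set where the bound holds is closed by
continuity and dense because its complement is null. -/
lemma le_swap (H : PotentialHypothesis V T g) {t : ℝ} (ht : t ∈ Ioc 0 T) (x y : Space N) :
    g x t y ≤ g y t x := by
  have hT : T ∈ Ioc 0 T := ⟨ht.1.trans_le ht.2, le_rfl⟩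
  have h1 := H.green.minimal T hT _ (H.green.adjoint y) t ⟨ht.1.le, ht.2⟩
  have h0 : kernelFlow (fun b t a => g a t b) (Measure.dirac y) 0 = Measure.dirac y := by
    simp [kernelFlow]
  rw [h0, kernelFlow, kernelFlow, if_neg ht.1.ne', if_neg ht.1.ne'] at h1
  simp only [lintegral_dirac] at h1
  have hm : Measurable fun x => ENNReal.ofReal (g x t y) := by
    simpa only [green_of_mem ht] using H.measurable_green_left t y
  have h2 := ae_le_of_withDensity_le hm h1
  have hclosed : IsClosed {x | g x t y ≤ g y t x} := by
    refine isClosed_le ?_ ?_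
    · exact (H.continuous_prod ht).comp (continuous_id.prodMk continuous_const)
    · exact (H.continuous_prod ht).comp (continuous_const.prodMk continuous_id)
  have hdense : Dense {x | g x t y ≤ g y t x} := by
    refine Measure.dense_of_ae (μ := volume) ?_
    filter_upwards [h2] with x hx
    exact (ENNReal.ofReal_le_ofReal_iff (H.pos _ _ ht _).le).1 hx
  have := hclosed.closure_eq ▸ hdense.closure_eq
  exact (this.symm ▸ mem_univ x : x ∈ {x | g x t y ≤ g y t x})

lemma symm (H : PotentialHypothesis V T g) {t : ℝ} (ht : t ∈ Ioc 0 T) (x y : Space N) :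
    g x t y = g y t x :=
  le_antisymm (H.le_swap ht x y) (H.le_swap ht y x)

lemma green_symm (H : PotentialHypothesis V T g) (t : ℝ) (x y : Space N) :
    greenDensity g T t x y = greenDensity g T t y x := by
  unfold greenDensity
  split_ifs with ht
  · rw [H.symm ht]
  · rfl

lemma green_ne_zero (H : PotentialHypothesis V T g) {t : ℝ} (ht : t ∈ Ioc 0 T) (x y : Space N) :
    greenDensity g T t x y ≠ 0 := by
  rw [green_of_mem ht]
  simpa using H.pos x t ht y

lemma kernelFlow_dirac_eq_withDensity (H : PotentialHypothesis V T g) {t : ℝ} (ht : t ∈ Ioc 0 T)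
    (y : Space N) : kernelFlow g (Measure.dirac y) t
      = volume.withDensity fun x => greenDensity g T t x y := by
  rw [H.kernelFlow_dirac ht, H.greenKernel_apply]

lemma kernelFlow_kernelFlow_dirac (H : PotentialHypothesis V T g) {s t : ℝ} (hs : s ∈ Ioc 0 T)
    (ht : t ∈ Ioc 0 T) (y : Space N) :
    kernelFlow g (kernelFlow g (Measure.dirac y) s) t
      = volume.withDensity fun x => ∫⁻ z, greenDensity g T t x z * greenDensity g T s z y := by
  rw [H.kernelFlow_dirac_eq_withDensity hs, kernelFlow, if_neg ht.1.ne']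
  congr 1 with x
  simp only [← green_of_mem ht]
  rw [lintegral_withDensity_eq_lintegral_mul _ (H.measurable_green_left s y)
    (H.measurable_green_right t x)]
  simp only [Pi.mul_apply, mul_comm]

lemma measurable_lintegral_green_mul (H : PotentialHypothesis V T g) (s t : ℝ) (y : Space N) :
    Measurable fun x => ∫⁻ z, greenDensity g T t x z * greenDensity g T s z y :=
  ((H.measurable_green_prod t).mul
    ((H.measurable_green_left s y).comp measurable_snd)).lintegral_prod_right'

lemma isWeakSolution_restart (H : PotentialHypothesis V T g) {s : ℝ} (hs : s ∈ Ioc 0 T)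
    (y : Space N) :
    IsWeakSolution V (T - s) fun r => kernelFlow g (Measure.dirac y) (s + r) :=
  (H.green.forward y).shift H.measurable_potential ⟨hs.1.le, hs.2⟩

/-- Minimality is used twice: against the solution restarted at `s`, for `≤`, and against the
solution that follows `g` up to `s` and the Green flow of `g(·, s, y)` afterwards, for `≥`. -/
lemma ae_lintegral_green_mul_eq (H : PotentialHypothesis V T g) {s t : ℝ} (hs : 0 < s)
    (ht : 0 < t) (hst : s + t ≤ T) (y : Space N) :
    ∀ᵐ x, ∫⁻ z, greenDensity g T t x z * greenDensity g T s z y = greenDensity g T (s + t) x y := by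
  have hsT : s ∈ Ioc 0 T := ⟨hs, by linarith⟩
  have htT : t ∈ Ioc 0 T := ⟨ht, by linarith⟩
  have hstT : s + t ∈ Ioc 0 T := ⟨by linarith, hst⟩
  have hTs : T - s ∈ Ioc 0 T := ⟨by linarith, by linarith⟩
  have htTs : t ∈ Icc 0 (T - s) := ⟨ht.le, by linarith⟩
  have hshift := H.isWeakSolution_restart hsT y
  have hle := H.green.minimal _ hTs _ hshift t htTs
  have hflow := H.isWeakSolution_kernelFlow hTs hshift
  simp only [add_zero] at hle hflow
  have hcon := (H.green.forward y).concat H.measurable_potential ⟨hs.le, hsT.2⟩ hflow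
    (by simp [kernelFlow])
  have hge := H.green.minimal T ⟨by linarith, le_rfl⟩ _ hcon (s + t) ⟨hstT.1.le, hst⟩
  simp only [hs.le, if_true] at hge
  rw [if_neg (by linarith), add_sub_cancel_left] at hge
  have h0 : kernelFlow g (Measure.dirac y) 0 = Measure.dirac y := by simp [kernelFlow]
  rw [h0] at hge
  rw [H.kernelFlow_kernelFlow_dirac hsT htT, H.kernelFlow_dirac_eq_withDensity hstT] at hle hge
  filter_upwards [ae_le_of_withDensity_le (H.measurable_lintegral_green_mul s t y) hle,
    ae_le_of_withDensity_le (H.measurable_green_left _ y) hge] with x h1 h2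
  exact le_antisymm h1 h2

/-- The convolution depends only on the total time and not on where it is split. This holds at every
pair of points, since the almost everywhere identity is applied only under the integral, on either
side of a Tonelli exchange. -/
lemma lintegral_green_mul_eq_lintegral_green_mul (H : PotentialHypothesis V T g) {a b c : ℝ}
    (ha : 0 < a) (hb : 0 < b) (hc : 0 < c) (habc : a + b + c ≤ T) (x y : Space N) :
    ∫⁻ z, greenDensity g T a x z * greenDensity g T (b + c) z y
      = ∫⁻ z, greenDensity g T (a + b) x z * greenDensity g T c z y := by
  have h1 : ∀ᵐ z, greenDensity g T (b + c) z y
      = ∫⁻ w, greenDensity g T b z w * greenDensity g T c w y := by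
    filter_upwards [H.ae_lintegral_green_mul_eq hc hb (by linarith) y] with z hz
    rw [hz, add_comm]
  -- The almost everywhere identity has its free variable in the first slot; symmetry moves it to
  -- the second.
  have h2 : ∀ᵐ w, greenDensity g T (a + b) x w
      = ∫⁻ z, greenDensity g T a x z * greenDensity g T b z w := by
    filter_upwards [H.ae_lintegral_green_mul_eq ha hb (by linarith) x] with w hw
    rw [H.green_symm, ← hw]
    refine lintegral_congr fun z => ?_
    rw [H.green_symm b w z, H.green_symm a z x, mul_comm]
  calc ∫⁻ z, greenDensity g T a x z * greenDensity g T (b + c) z y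
      = ∫⁻ z, ∫⁻ w, greenDensity g T a x z * (greenDensity g T b z w * greenDensity g T c w y) := by
        refine lintegral_congr_ae ?_
        filter_upwards [h1] with z hz
        rw [hz, lintegral_const_mul]
        exact (H.measurable_green_right b z).mul (H.measurable_green_left c y)
    _ = ∫⁻ w, ∫⁻ z, greenDensity g T a x z * (greenDensity g T b z w * greenDensity g T c w y) := by
        refine lintegral_lintegral_swap (Measurable.aemeasurable ?_)
        exact ((H.measurable_green_right a x).comp measurable_fst).mul
          ((H.measurable_green_prod b).mul ((H.measurable_green_left c y).comp measurable_snd))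
    _ = _ := by
        refine lintegral_congr_ae ?_
        filter_upwards [h2] with w hw
        simp only [← mul_assoc]
        rw [lintegral_mul_const, ← hw]
        exact (H.measurable_green_right a x).mul (H.measurable_green_left b w)

/-- The weak equation writes the integral as `f y` plus a primitive of an integrable function of
time, and this primitive vanishes at `0`. -/
lemma tendsto_integral_kernelFlow_dirac (H : PotentialHypothesis V T g) (hT : 0 < T)
    {f : Space N → ℝ} (hf : ContDiff ℝ (⊤ : ℕ∞) f) (hc : HasCompactSupport f) (y : Space N) :
    Tendsto (fun t => ∫ x, f x ∂(kernelFlow g (Measure.dirac y) t)) (𝓝[>] 0) (𝓝 (f y)) := by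
  have hw := H.green.forward y
  have hint := hw.integrableOn_ellipticOp H.measurable_potential hf hc
  rw [← uIcc_of_le hT.le] at hint
  have hcont := intervalIntegral.continuousOn_primitive_interval hint 0 left_mem_uIcc
  rw [ContinuousWithinAt, uIcc_of_le hT.le, intervalIntegral.integral_same] at hcont
  have h1 := (hcont.mono_left (nhdsWithin_mono _ Ioc_subset_Icc_self)).const_add (f y)
  rw [nhdsWithin_Ioc_eq_nhdsGT hT, add_zero] at h1
  refine h1.congr' ?_
  filter_upwards [Ioc_mem_nhdsGT hT] with t ht
  rw [hw.equation f hf hc t ⟨ht.1.le, ht.2⟩]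
  simp [kernelFlow]

/-- The integral is unchanged when the split point moves to a small time `r`. Then `g(x, r, ·)`
concentrates at `x`, while joint continuity keeps `g(z, a + b - r, y)` above any `c < g(x, a + b,
y)` for `z` near `x`. -/
lemma green_le_lintegral_green_mul (H : PotentialHypothesis V T g) {a b : ℝ}
    (ha : 0 < a) (hb : 0 < b) (hab : a + b ≤ T) (x y : Space N) :
    greenDensity g T (a + b) x y ≤ ∫⁻ z, greenDensity g T a x z * greenDensity g T b z y := by
  have hT : 0 < T := by linarith
  have habT : a + b ∈ Ioc 0 T := ⟨by linarith, hab⟩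
  set I := ∫⁻ z, greenDensity g T a x z * greenDensity g T b z y with hI
  have hconst : ∀ r ∈ Ioo 0 a,
      ∫⁻ z, greenDensity g T r x z * greenDensity g T (a + b - r) z y = I := by
    intro r hr
    have := H.lintegral_green_mul_eq_lintegral_green_mul (b := a - r) hr.1 (sub_pos.2 hr.2) hb
      (by linarith) x y
    rw [show a - r + b = a + b - r by ring, show r + (a - r) = a by ring] at this
    exact this
  have key : ∀ c : ℝ, 0 ≤ c → c < g x (a + b) y → ENNReal.ofReal c ≤ I := by
    intro c hc0 hc
    have hcont := H.continuousOn (x, a + b, y) (by simpa using habT)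
    have hmap : Tendsto (fun p : Space N × ℝ => ((p.1, a + b - p.2, y) : Space N × ℝ × Space N))
        (𝓝 x ×ˢ 𝓝[>] 0)
        (𝓝[(univ : Set (Space N)) ×ˢ (Ioc (0 : ℝ) T ×ˢ (univ : Set (Space N)))] (x, a + b, y)) := by
      refine tendsto_nhdsWithin_iff.2 ⟨?_, ?_⟩
      · have h1 : Tendsto (fun p : Space N × ℝ => ((p.1, a + b - p.2, y) : Space N × ℝ × Space N))
            (𝓝 (x, (0 : ℝ))) (𝓝 (x, a + b - 0, y)) :=
          Continuous.tendsto (f := fun p : Space N × ℝ =>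
            ((p.1, a + b - p.2, y) : Space N × ℝ × Space N)) (by fun_prop) (x, 0)
        rw [sub_zero, nhds_prod_eq] at h1
        exact h1.mono_left (Filter.prod_mono le_rfl nhdsWithin_le_nhds)
      · have : ∀ᶠ r in 𝓝[>] (0 : ℝ), a + b - r ∈ Ioc 0 T := by
          filter_upwards [Ioo_mem_nhdsGT ha] with r hr
          exact ⟨by linarith [hr.2], by linarith [hr.1]⟩
        exact (this.prod_inr (𝓝 x)).mono fun p hp => by simpa using hp
    have hev := (hcont.tendsto.comp hmap).eventually (lt_mem_nhds hc)
    obtain ⟨U, hU, hr⟩ := eventually_prod_iff.1 hev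
    obtain ⟨R, hR, hUR⟩ := hr
    obtain ⟨ε, hε, hball⟩ := Metric.eventually_nhds_iff_ball.1 hU
    -- A bump equal to `1` at `x` and vanishing outside the ball on which `g > c`: testing against
    -- it bounds the integral below by a quantity that tends to `c`.
    let f : ContDiffBump x := ⟨ε / 2, ε, by linarith, by linarith⟩
    have hfs : ContDiff ℝ (⊤ : ℕ∞) f := f.contDiff
    have htend := H.tendsto_integral_kernelFlow_dirac hT hfs f.hasCompactSupport x
    have htend2 : Tendsto (fun t => ENNReal.ofReal c *
        ENNReal.ofReal (∫ z, f z ∂(kernelFlow g (Measure.dirac x) t))) (𝓝[>] 0)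
        (𝓝 (ENNReal.ofReal c * ENNReal.ofReal (f x))) :=
      ENNReal.Tendsto.const_mul (ENNReal.tendsto_ofReal htend) (Or.inr ENNReal.ofReal_ne_top)
    have hfx : f x = 1 := f.one_of_mem_closedBall (Metric.mem_closedBall_self (by positivity))
    rw [hfx, ENNReal.ofReal_one, mul_one] at htend2
    refine le_of_tendsto htend2 ?_
    filter_upwards [hR, Ioo_mem_nhdsGT ha] with r hrR hr
    have hrT : r ∈ Ioc 0 T := ⟨hr.1, by linarith [hr.2]⟩
    have hrT' : a + b - r ∈ Ioc 0 T := ⟨by linarith [hr.2], by linarith [hr.1]⟩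
    have := (H.green.forward x).locallyFinite r ⟨hrT.1.le, hrT.2⟩
    have hfm : Measurable fun z => ENNReal.ofReal (f z) := f.continuous.measurable.ennreal_ofReal
    rw [ofReal_integral_eq_lintegral_ofReal (integrable_of_isLocallyFinite hfs f.hasCompactSupport)
      (ae_of_all _ fun z => f.nonneg), H.kernelFlow_dirac hrT, H.lintegral_greenKernel r x hfm,
      ← hconst r hr, ← lintegral_const_mul' _ _ ENNReal.ofReal_ne_top]
    refine lintegral_mono fun z => ?_
    by_cases hz : z ∈ Metric.ball x ε
    · have h1 : c < g z (a + b - r) y := hUR (hball z hz) hrR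
      rw [H.green_symm r z x, green_of_mem hrT' z y]
      calc ENNReal.ofReal c * (greenDensity g T r x z * ENNReal.ofReal (f z))
          ≤ ENNReal.ofReal (g z (a + b - r) y) * (greenDensity g T r x z * 1) := by
            gcongr
            exact ENNReal.ofReal_le_one.2 f.le_one
        _ = _ := by rw [mul_one, mul_comm]
    · have : f z = 0 := f.zero_of_le_dist (by simpa using hz)
      simp [this]
  rw [green_of_mem habT]
  have hpos := H.pos x _ habT y
  refine le_of_tendsto (f := fun c => ENNReal.ofReal c) (x := 𝓝[<] (g x (a + b) y))
    (ENNReal.continuous_ofReal.tendsto' _ _ rfl |>.mono_left nhdsWithin_le_nhds) ?_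
  filter_upwards [Ioo_mem_nhdsLT hpos] with c hc
  exact key c hc.1.le hc.2

/-- Fatou's lemma along a sequence of points where the almost everywhere identity holds, converging
to `x`. -/
lemma lintegral_green_mul_le_green (H : PotentialHypothesis V T g) {a b : ℝ}
    (ha : 0 < a) (hb : 0 < b) (hab : a + b ≤ T) (x y : Space N) :
    ∫⁻ z, greenDensity g T a x z * greenDensity g T b z y ≤ greenDensity g T (a + b) x y := by
  have haT : a ∈ Ioc 0 T := ⟨ha, by linarith⟩
  have habT : a + b ∈ Ioc 0 T := ⟨by linarith, hab⟩
  have hae := H.ae_lintegral_green_mul_eq hb ha (by linarith) y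
  obtain ⟨u, hu, hux⟩ := mem_closure_iff_seq_limit.1
    ((Measure.dense_of_ae hae).closure_eq ▸ mem_univ x)
  have hcont : ∀ (t : ℝ) (z : Space N), t ∈ Ioc 0 T →
      Continuous fun x => greenDensity g T t x z := by
    intro t z ht
    simp only [green_of_mem ht]
    exact ENNReal.continuous_ofReal.comp
      ((H.continuous_prod ht).comp (continuous_id.prodMk continuous_const))
  calc ∫⁻ z, greenDensity g T a x z * greenDensity g T b z y
      = ∫⁻ z, liminf (fun n => greenDensity g T a (u n) z * greenDensity g T b z y) atTop := by
        refine lintegral_congr fun z => (Tendsto.liminf_eq ?_).symm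
        exact ENNReal.Tendsto.mul_const (((hcont a z haT).tendsto x).comp hux)
          (Or.inr (green_ne_top _ _ _))
    _ ≤ liminf (fun n => ∫⁻ z, greenDensity g T a (u n) z * greenDensity g T b z y) atTop :=
        lintegral_liminf_le fun n =>
          (H.measurable_green_right a (u n)).mul (H.measurable_green_left b y)
    _ = liminf (fun n => greenDensity g T (a + b) (u n) y) atTop := by
        congr 1 with n
        rw [add_comm a b]
        exact hu n
    _ = greenDensity g T (a + b) x y := (((hcont _ y habT).tendsto x).comp hux).liminf_eq

/-- The Chapman-Kolmogorov equation for the Green function, at every pair of points. -/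
theorem lintegral_green_mul (H : PotentialHypothesis V T g) {a b : ℝ}
    (ha : 0 < a) (hb : 0 < b) (hab : a + b ≤ T) (x y : Space N) :
    ∫⁻ z, greenDensity g T a x z * greenDensity g T b z y = greenDensity g T (a + b) x y :=
  le_antisymm (H.lintegral_green_mul_le_green ha hb hab x y)
    (H.green_le_lintegral_green_mul ha hb hab x y)

end PotentialHypothesis

end Bernstein
end

/-! ### Kolmogorov extension over an arbitrary index set. -/

noncomputable section

namespace KolmogorovExtension

variable {ι E : Type*} [TopologicalSpace E] [PolishSpace E]

/-- A sequence of cylinders with compact bases whose finite intersections are nonempty has a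
nonempty intersection. -/
lemma nonempty_iInter_cylinder_of_isCompact [Nonempty E] (I : ℕ → Finset ι)
    (K : ∀ n, Set (I n → E)) (hK : ∀ n, IsCompact (K n))
    (hne : ∀ n, (⋂ k ∈ Finset.range (n + 1), cylinder (α := fun _ : ι => E) (I k) (K k)).Nonempty) :
    (⋂ n, cylinder (α := fun _ : ι => E) (I n) (K n)).Nonempty := by
  choose x hx using hne
  have hxk : ∀ k n, k ≤ n → (I k).restrict (x n) ∈ K k := by
    intro k n hkn
    have := hx n
    simp only [mem_iInter] at this
    exact this k (by simpa using Nat.lt_succ_of_le hkn)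
  -- Limits are taken along one fixed ultrafilter, so all coordinates converge simultaneously and no
  -- diagonal subsequence is needed.
  have hev : ∀ k, ∀ᶠ n in (hyperfilter ℕ : Filter ℕ), (I k).restrict (x n) ∈ K k := by
    intro k
    have h1 : ∀ᶠ n in (hyperfilter ℕ : Filter ℕ), k ≤ n :=
      Nat.hyperfilter_le_atTop (eventually_ge_atTop k)
    exact h1.mono fun n hn => hxk k n hn
  have hlim : ∀ k, ∃ z ∈ K k,
      Tendsto (fun n => (I k).restrict (x n)) (hyperfilter ℕ : Filter ℕ) (𝓝 z) := by
    intro k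
    have := (hK k).ultrafilter_le_nhds ((hyperfilter ℕ).map fun n => (I k).restrict (x n))
      (le_principal_iff.2 (hev k))
    exact this
  choose z hz hzlim using hlim
  -- Limits of the same coordinate seen in different `I k` agree by uniqueness of limits; a
  -- coordinate in no `I k` is unconstrained.
  have hex : ∀ i, ∃ e : E, ∀ k, i ∈ I k →
      Tendsto (fun n => x n i) (hyperfilter ℕ : Filter ℕ) (𝓝 e) := by
    intro i
    by_cases h : ∃ k, i ∈ I k
    · obtain ⟨k, hk⟩ := h
      exact ⟨z k ⟨i, hk⟩, fun _ _ => (tendsto_pi_nhds.1 (hzlim k)) ⟨i, hk⟩⟩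
    · exact ⟨Classical.arbitrary E, fun k hk => (h ⟨k, hk⟩).elim⟩
  choose y hy using hex
  refine ⟨y, mem_iInter.2 fun k => ?_⟩
  have : (I k).restrict y = z k := by
    funext i
    exact tendsto_nhds_unique (hy i k i.2) ((tendsto_pi_nhds.1 (hzlim k)) i)
  rw [mem_cylinder, this]
  exact hz k

variable [MeasurableSpace E] [BorelSpace E] {P : ∀ J : Finset ι, Measure (J → E)} [∀ J,
    IsFiniteMeasure (P J)]

/-- If the contents stayed above some `ε > 0`, inner regularity would give compact bases `K n ⊆ S n`
losing less than `ε` in total. Their finite intersections could not be empty, so compactness would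
produce a point of `⋂ A n`. -/
lemma tendsto_projectiveFamilyContent_zero [Nonempty E] (hP : IsProjectiveMeasureFamily (α :=
    fun _ : ι => E) P)
    {A : ℕ → Set (ι → E)} (hA : ∀ n, A n ∈ measurableCylinders fun _ : ι => E)
    (hanti : Antitone A) (hempty : ⋂ n, A n = ∅) :
    Tendsto (fun n => projectiveFamilyContent hP (A n)) atTop (𝓝 0) := by
  have hmono : Antitone fun n => projectiveFamilyContent hP (A n) := fun m n h =>
    projectiveFamilyContent_mono hP (hA n) (hA m) (hanti h)
  have htend := tendsto_atTop_iInf hmono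
  set ε := ⨅ n, projectiveFamilyContent hP (A n) with hε
  suffices h0 : ε = 0 by rwa [h0] at htend
  by_contra hpos
  have hle : ∀ n, ε ≤ projectiveFamilyContent hP (A n) := fun n => iInf_le _ n
  have hAc : ∀ n, ∃ (I : Finset ι) (S : Set (I → E)), MeasurableSet S ∧ A n = cylinder (α :=
      fun _ : ι => E) I S := by
    intro n
    obtain ⟨I, S, hS, h⟩ := (mem_measurableCylinders _).1 (hA n)
    exact ⟨I, S, hS, h⟩
  choose I S hS hAS using hAc
  obtain ⟨δ, hδpos, hδsum⟩ := ENNReal.exists_pos_sum_of_countable hpos ℕ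
  have hcomp : ∀ n, ∃ K ⊆ S n, IsCompact K ∧ P (I n) (S n \ K) < δ n := by
    intro n
    exact (hS n).exists_isCompact_sdiff_lt (measure_ne_top _ _) (by simpa using (hδpos n).ne')
  choose K hKS hKc hKδ using hcomp
  have hKm : ∀ n, MeasurableSet (K n) := fun n => (hKc n).measurableSet
  have hne : ∀ n, (⋂ k ∈ Finset.range (n + 1), cylinder (α := fun _ : ι => E) (I k)
      (K k)).Nonempty := by
    intro n
    by_contra hcon
    rw [not_nonempty_iff_eq_empty] at hcon
    have hsub : A n ⊆ ⋃ k ∈ Finset.range (n + 1), cylinder (α := fun _ : ι => E) (I k) (S k \ K k)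
        := by
      intro ω hω
      by_contra hω'
      have : ω ∈ ⋂ k ∈ Finset.range (n + 1), cylinder (α := fun _ : ι => E) (I k) (K k) := by
        simp only [mem_iUnion, not_exists, mem_iInter] at hω' ⊢
        intro k hk
        have h1 : ω ∈ A k := hanti (Nat.lt_succ_iff.1 (Finset.mem_range.1 hk)) hω
        rw [hAS k, mem_cylinder] at h1
        have h2 := hω' k hk
        rw [mem_cylinder, Set.mem_sdiff] at h2
        rw [mem_cylinder]
        by_contra h3
        exact h2 ⟨h1, h3⟩
      rw [hcon] at this
      exact this
    have hmem : ∀ k ∈ Finset.range (n + 1),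
        cylinder (α := fun _ : ι => E) (I k) (S k \ K k) ∈ measurableCylinders fun _ : ι => E :=
            fun k _ =>
      cylinder_mem_measurableCylinders _ _ ((hS k).diff (hKm k))
    have h1 : projectiveFamilyContent hP (A n)
        ≤ ∑ k ∈ Finset.range (n + 1), (δ k : ℝ≥0∞) := by
      calc projectiveFamilyContent hP (A n)
          ≤ projectiveFamilyContent hP (⋃ k ∈ Finset.range (n + 1),
              cylinder (α := fun _ : ι => E) (I k) (S k \ K k)) :=
            projectiveFamilyContent_mono hP (hA n)
              (isSetRing_measurableCylinders.biUnion_mem _ hmem) hsub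
        _ ≤ ∑ k ∈ Finset.range (n + 1),
              projectiveFamilyContent hP (cylinder (α := fun _ : ι => E) (I k) (S k \ K k)) :=
            addContent_biUnion_le isSetRing_measurableCylinders hmem
        _ ≤ _ := by
            refine Finset.sum_le_sum fun k _ => ?_
            rw [projectiveFamilyContent_cylinder hP ((hS k).diff (hKm k))]
            exact (hKδ k).le
    have h2 := (ENNReal.sum_le_tsum (f := fun k => (δ k : ℝ≥0∞)) (Finset.range (n + 1))).trans_lt
      hδsum
    exact (((hle n).trans h1).trans_lt h2).false
  obtain ⟨ω, hω⟩ := nonempty_iInter_cylinder_of_isCompact I K hKc hne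
  have : ω ∈ ⋂ n, A n := by
    refine mem_iInter.2 fun n => ?_
    rw [hAS n, mem_cylinder]
    exact hKS n (mem_iInter.1 hω n)
  rw [hempty] at this
  exact this

/-- **Kolmogorov extension theorem** for finite measures on powers of a Polish space. -/
theorem exists_isProjectiveLimit [Nonempty E] (hP : IsProjectiveMeasureFamily (α := fun _ : ι =>
    E) P) :
    ∃ μ : Measure (ι → E), IsProjectiveLimit (α := fun _ : ι => E) μ P := by
  have hsub : (projectiveFamilyContent hP).IsSigmaSubadditive := by
    refine isSigmaSubadditive_of_addContent_iUnion_eq_tsum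
      isSetRing_measurableCylinders (fun f hf hf_Union hf' ↦ ?_)
    refine addContent_iUnion_eq_sum_of_tendsto_zero isSetRing_measurableCylinders
      (projectiveFamilyContent hP) (fun _ _ ↦ projectiveFamilyContent_ne_top hP) ?_ hf hf_Union hf'
    exact fun s hs anti_s inter_s ↦ tendsto_projectiveFamilyContent_zero hP hs anti_s inter_s
  refine ⟨(projectiveFamilyContent hP).measure isSetSemiring_measurableCylinders
    generateFrom_measurableCylinders.ge hsub, fun J => ?_⟩
  ext s hs
  rw [Measure.map_apply (Finset.measurable_restrict J) hs, AddContent.measure_eq,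
    projectiveFamilyContent_congr hP (J.restrict ⁻¹' s) rfl hs]
  · exact generateFrom_measurableCylinders.symm
  · exact cylinder_mem_measurableCylinders _ _ hs

end KolmogorovExtension
end

/-! ### Markov processes with prescribed transition kernels. -/

noncomputable section

namespace MarkovProcess
open ProbabilityTheory

variable {ι Ω E S : Type*} [MeasurableSpace E] [MeasurableSpace S]

/-! ### Cylinder events of a process -/

/-- The events `⋂ j ∈ F, {Z j ∈ B j}` for a finite set `F ⊆ J` of times. -/
def cylinders (Z : ι → Ω → E) (J : Set ι) : Set (Set Ω) :=
  piiUnionInter (fun i => {s | MeasurableSet[MeasurableSpace.comap (Z i) inferInstance] s}) J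

section cylinders
variable {Z : ι → Ω → E} {J K : Set ι} {A B : Set Ω}

lemma mem_cylinders_iff :
    A ∈ cylinders Z J ↔ ∃ (F : Finset ι) (B : ι → Set E), ↑F ⊆ J ∧ (∀ i, MeasurableSet (B i)) ∧
      A = ⋂ j ∈ F, Z j ⁻¹' B j := by
  classical
  constructor
  · rintro ⟨F, hF, f, hf, rfl⟩
    have h : ∀ i, ∃ C, MeasurableSet C ∧ (i ∈ F → Z i ⁻¹' C = f i) := by
      intro i
      by_cases hi : i ∈ F
      · obtain ⟨C, hC, h⟩ := hf i hi
        exact ⟨C, hC, fun _ => h⟩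
      -- Off `F` the base is set to `univ`, so that the family of bases is total and measurable.
      · exact ⟨univ, MeasurableSet.univ, fun h => (hi h).elim⟩
    choose B hB hBf using h
    exact ⟨F, B, hF, hB, (iInter₂_congr fun i hi => hBf i hi).symm⟩
  · rintro ⟨F, B, hF, hB, rfl⟩
    exact ⟨F, hF, fun i => Z i ⁻¹' B i, fun i _ => ⟨B i, hB i, rfl⟩, rfl⟩

lemma univ_mem_cylinders : univ ∈ cylinders Z J :=
  mem_cylinders_iff.2 ⟨∅, fun _ => univ, by simp, fun _ => MeasurableSet.univ, by simp⟩

lemma preimage_mem_cylinders {i : ι} (hi : i ∈ J) {C : Set E} (hC : MeasurableSet C) :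
    Z i ⁻¹' C ∈ cylinders Z J :=
  mem_cylinders_iff.2 ⟨{i}, fun _ => C, by simpa using hi, fun _ => hC, by simp⟩

lemma cylinders_mono (h : J ⊆ K) : cylinders Z J ⊆ cylinders Z K :=
  piiUnionInter_mono_right h

lemma inter_mem_cylinders (hA : A ∈ cylinders Z J) (hB : B ∈ cylinders Z J) :
    A ∩ B ∈ cylinders Z J := by
  classical
  obtain ⟨F, f, hF, hf, rfl⟩ := mem_cylinders_iff.1 hA
  obtain ⟨G, g, hG, hg, rfl⟩ := mem_cylinders_iff.1 hB
  refine mem_cylinders_iff.2 ⟨F ∪ G,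
    fun i => (if i ∈ F then f i else univ) ∩ (if i ∈ G then g i else univ), by simp [hF, hG],
    fun i => ?_, ?_⟩
  · refine MeasurableSet.inter ?_ ?_
    · split_ifs; exacts [hf i, MeasurableSet.univ]
    · split_ifs; exacts [hg i, MeasurableSet.univ]
  · ext ω
    simp only [Set.mem_inter_iff, mem_iInter, mem_preimage, Finset.mem_union]
    constructor
    · rintro ⟨h1, h2⟩ i -
      constructor
      · split_ifs with h; exacts [h1 i h, mem_univ _]
      · split_ifs with h; exacts [h2 i h, mem_univ _]
    · intro h
      refine ⟨fun i hi => ?_, fun i hi => ?_⟩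
      · simpa [hi] using (h i (Or.inl hi)).1
      · simpa [hi] using (h i (Or.inr hi)).2

lemma measurableSet_of_mem_cylinders [MeasurableSpace Ω] (hZ : ∀ i ∈ J, Measurable (Z i)) (hA :
    A ∈ cylinders Z J) :
    MeasurableSet A := by
  obtain ⟨F, f, hF, hf, rfl⟩ := mem_cylinders_iff.1 hA
  exact F.measurableSet_biInter fun i hi => hZ i (hF hi) (hf i)

lemma isPiSystem_cylinders : IsPiSystem (cylinders Z J) :=
  fun _ hA _ hB _ => inter_mem_cylinders hA hB

lemma generateFrom_cylinders : MeasurableSpace.generateFrom (cylinders Z J)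
    = ⨆ i ∈ J, MeasurableSpace.comap (Z i) inferInstance :=
  generateFrom_piiUnionInter_measurableSet _ _

end cylinders

/-! ### The Markov property with given transition kernels -/

variable [MeasurableSpace Ω]

/-- The hypothesis says that the law of `X` is the mixture of the `κ (Y ω)`. The measure `m` is left
general so that `P.restrict A` may be used. -/
lemma lintegral_comp_of_forall_preimage {m : Measure Ω} {X : Ω → E} {Y : Ω → S}
    {κ : Kernel S E} (hX : Measurable X) (hY : Measurable Y)
    (h : ∀ C, MeasurableSet C → m (X ⁻¹' C) = ∫⁻ ω, κ (Y ω) C ∂m) {f : E → ℝ≥0∞}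
    (hf : Measurable f) : ∫⁻ ω, f (X ω) ∂m = ∫⁻ ω, ∫⁻ y, f y ∂(κ (Y ω)) ∂m := by
  have hκ : AEMeasurable (fun ω => κ (Y ω)) m := (κ.measurable.comp hY).aemeasurable
  have hmap : m.map X = m.bind fun ω => κ (Y ω) := by
    ext C hC
    rw [Measure.map_apply hX hC, Measure.bind_apply hC hκ, h C hC]
  rw [← lintegral_map hf hX, hmap, Measure.lintegral_bind hκ hf.aemeasurable]

variable [LinearOrder ι]

/-- Conditionally on the values at the times `≤ s` of `J`, the law of `Z t` is `Q s t (Z s)`. -/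
def IsMarkovOn (Q : ι → ι → Kernel E E) (J : Set ι) (P : Measure Ω) (Z : ι → Ω → E) : Prop :=
  ∀ s ∈ J, ∀ t ∈ J, s < t → ∀ A ∈ cylinders Z (J ∩ Iic s), ∀ C, MeasurableSet C →
    P (A ∩ Z t ⁻¹' C) = ∫⁻ ω in A, Q s t (Z s ω) C ∂P

variable {Q : ι → ι → Kernel E E} {J K : Set ι} {P : Measure Ω} {Z : ι → Ω → E}

lemma IsMarkovOn.mono (h : IsMarkovOn Q J P Z) (hKJ : K ⊆ J) : IsMarkovOn Q K P Z :=
  fun s hs t ht hst A hA C hC => h s (hKJ hs) t (hKJ ht) hst A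
    (cylinders_mono (inter_subset_inter_left _ hKJ) hA) C hC

lemma IsMarkovOn.setLIntegral (h : IsMarkovOn Q J P Z) (hZ : ∀ i ∈ J, Measurable (Z i)) {s t : ι}
    (hs : s ∈ J) (ht : t ∈ J) (hst : s < t) {A : Set Ω} (hA : A ∈ cylinders Z (J ∩ Iic s))
    {f : E → ℝ≥0∞} (hf : Measurable f) :
    ∫⁻ ω in A, f (Z t ω) ∂P = ∫⁻ ω in A, ∫⁻ y, f y ∂(Q s t (Z s ω)) ∂P := by
  refine lintegral_comp_of_forall_preimage (hZ t ht) (hZ s hs) (fun C hC => ?_) hf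
  rw [Measure.restrict_apply (hZ t ht hC), inter_comm, h s hs t ht hst A hA C hC]

variable [OrderBot ι]

section Existence

lemma exists_isGreatest_insert_bot (J : Finset ι) :
    ∃ m ∈ insert ⊥ (J : Set ι), ∀ j ∈ insert ⊥ (J : Set ι), j ≤ m := by
  classical
  have hne : (insert ⊥ J).Nonempty := Finset.insert_nonempty _ _
  refine ⟨(insert ⊥ J).max' hne, by simpa using Finset.max'_mem _ hne, fun j hj => ?_⟩
  exact Finset.le_max' _ _ (by simpa using hj)

/-- Times are added in increasing order: the coordinate at the new time `a` is overwritten by a draw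
from `Q m a (ω m)`, with `m` the largest earlier time. Working on all of `ι → E` avoids identifying
different finite products. -/
lemma exists_isMarkovOn_finset (hQ : ∀ s t, s < t → IsMarkovKernel (Q s t))
    (hCK : ∀ r s t, r < s → s < t → ∀ x C, MeasurableSet C →
      ∫⁻ y, Q s t y C ∂(Q r s x) = Q r t x C)
    (ν : Measure E) [IsProbabilityMeasure ν] (J : Finset ι) :
    ∃ P : Measure (ι → E), IsProbabilityMeasure P ∧ P.map (fun ω => ω ⊥) = ν ∧
      IsMarkovOn Q (insert ⊥ ↑J) P fun i ω => ω i := by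
  classical
  induction J using Finset.induction_on_max with
  | empty =>
    have hm : Measurable fun (x : E) (_ : ι) => x := measurable_pi_lambda _ fun _ => measurable_id
    -- Constant paths with value distributed as `ν`; with the single time `⊥` the Markov condition
    -- is vacuous.
    refine ⟨ν.map fun x _ => x, Measure.isProbabilityMeasure_map hm.aemeasurable, ?_, ?_⟩
    · rw [Measure.map_map (measurable_pi_apply _) hm]
      exact Measure.map_id
    · intro s hs t ht hst
      simp only [Finset.coe_empty, insert_empty_eq, mem_singleton_iff] at hs ht
      exact (hst.ne (hs.trans ht.symm)).elim
  | insert a J hJ ih =>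
    obtain ⟨P, hP, hν, hM⟩ := ih
    by_cases ha : a = ⊥
    · refine ⟨P, hP, hν, ?_⟩
      subst ha
      simpa using hM
    obtain ⟨m, hm, hmax⟩ := exists_isGreatest_insert_bot J
    have hma : m < a := by
      rcases hm with rfl | hm
      · exact bot_lt_iff_ne_bot.2 ha
      · exact hJ m hm
    have := hQ m a hma
    let κ : Kernel (ι → E) E := (Q m a).comap (fun ω => ω m) (measurable_pi_apply m)
    have hu : Measurable fun p : (ι → E) × E => Function.update p.1 a p.2 := measurable_update'
    let P' : Measure (ι → E) := (P ⊗ₘ κ).map fun p => Function.update p.1 a p.2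
    have hP'0 : ∀ h : (ι → E) → ℝ≥0∞, Measurable h →
        ∫⁻ ω, h ω ∂P' = ∫⁻ ω, ∫⁻ x, h (Function.update ω a x) ∂(Q m a (ω m)) ∂P := by
      intro h hh
      rw [lintegral_map hh hu, Measure.lintegral_compProd
        (f := fun p : (ι → E) × E => h (Function.update p.1 a p.2)) (hh.comp hu)]
      rfl
    -- Events that do not involve the time `a` are unaffected by overwriting that coordinate.
    have hinv : ∀ A ∈ cylinders (fun i (ω : ι → E) => ω i) {a}ᶜ, ∀ ω x,
        Function.update ω a x ∈ A ↔ ω ∈ A := by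
      intro A hA ω x
      obtain ⟨F, B, hF, hB, rfl⟩ := mem_cylinders_iff.1 hA
      simp only [mem_iInter, mem_preimage]
      refine forall₂_congr fun i hi => ?_
      rw [Function.update_of_ne (hF hi)]
    have hcm : ∀ {K : Set ι} {A}, A ∈ cylinders (fun i (ω : ι → E) => ω i) K → MeasurableSet A :=
      fun hA => measurableSet_of_mem_cylinders (fun i _ => measurable_pi_apply i) hA
    have hP'1 : ∀ A ∈ cylinders (fun i (ω : ι → E) => ω i) {a}ᶜ, ∀ C, MeasurableSet C →
        P' (A ∩ (fun ω => ω a) ⁻¹' C) = ∫⁻ ω in A, Q m a (ω m) C ∂P := by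
      intro A hA C hC
      have hms : MeasurableSet (A ∩ (fun ω : ι → E => ω a) ⁻¹' C) :=
        (hcm hA).inter (measurable_pi_apply a hC)
      rw [← lintegral_indicator_one hms, hP'0 _ (measurable_one.indicator hms),
        ← lintegral_indicator (hcm hA)]
      refine lintegral_congr fun ω => ?_
      by_cases hω : ω ∈ A
      · rw [indicator_of_mem hω, ← lintegral_indicator_one hC]
        refine lintegral_congr fun x => ?_
        simp [indicator_apply, hinv A hA, hω]
      · rw [indicator_of_notMem hω, ← lintegral_zero (μ := Q m a (ω m))]
        refine lintegral_congr fun x => ?_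
        simp [hinv A hA, hω]
    have hP'2 : ∀ A ∈ cylinders (fun i (ω : ι → E) => ω i) {a}ᶜ, ∀ i ≠ a, ∀ f : E → ℝ≥0∞,
        Measurable f → ∫⁻ ω in A, f (ω i) ∂P' = ∫⁻ ω in A, f (ω i) ∂P := by
      intro A hA i hi f hf
      have hfi : Measurable fun ω : ι → E => f (ω i) := hf.comp (measurable_pi_apply i)
      rw [← lintegral_indicator (hcm hA), ← lintegral_indicator (hcm hA),
        hP'0 _ (hfi.indicator (hcm hA))]
      refine lintegral_congr fun ω => ?_
      simp [indicator_apply, hinv A hA, Function.update_of_ne hi]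
    have hP'3 : ∀ A ∈ cylinders (fun i (ω : ι → E) => ω i) {a}ᶜ, P' A = P A := by
      intro A hA
      have := hP'1 A hA univ MeasurableSet.univ
      simpa using this
    refine ⟨P', ⟨?_⟩, ?_, ?_⟩
    · rw [hP'3 univ univ_mem_cylinders, measure_univ]
    · ext C hC
      rw [← hν, Measure.map_apply (measurable_pi_apply _) hC,
        Measure.map_apply (measurable_pi_apply _) hC]
      exact hP'3 _ (preimage_mem_cylinders (Z := fun i (ω : ι → E) => ω i) (i := ⊥)
        (Ne.symm ha) hC)
    · intro s hs t ht hst A hA C hC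
      have hmem : ∀ i ∈ insert ⊥ (↑(insert a J) : Set ι), i ≠ a → i ∈ insert ⊥ (J : Set ι) := by
        intro i hi hia
        rcases hi with h | h
        · exact Or.inl h
        · right
          simpa [hia] using h
      have hle : ∀ i ∈ insert ⊥ (↑(insert a J) : Set ι), i ≤ a := by
        intro i hi
        by_cases hia : i = a
        · exact hia.le
        · exact (hmax i (hmem i hi hia)).trans hma.le
      have hsa : s < a := hst.trans_le (hle t ht)
      have hsub : insert ⊥ (↑(insert a J) : Set ι) ∩ Iic s ⊆ insert ⊥ (J : Set ι) ∩ Iic s :=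
        fun i hi => ⟨hmem i hi.1 (hi.2.trans_lt hsa).ne, hi.2⟩
      have hA1 := cylinders_mono hsub hA
      have hA2 : A ∈ cylinders (fun i (ω : ι → E) => ω i) {a}ᶜ :=
        cylinders_mono (fun i hi => (hi.2.trans_lt hsa).ne) hA
      have hsJ := hmem s hs hsa.ne
      rw [hP'2 A hA2 s hsa.ne _ ((Q s t).measurable_coe hC)]
      by_cases hta : t = a
      · subst hta
        rw [hP'1 A hA2 C hC]
        -- For `s = m` this is the construction itself; for `s < m` the law passes through `m` and
        -- the Chapman-Kolmogorov equation composes the two kernels.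
        rcases (hmax s hsJ).eq_or_lt with rfl | hsm
        · rfl
        · rw [hM.setLIntegral (fun i _ => measurable_pi_apply i) hsJ hm hsm hA1
            ((Q m t).measurable_coe hC)]
          simp only [hCK s m t hsm hma _ C hC]
      · rw [hP'3 _ (inter_mem_cylinders hA2 (preimage_mem_cylinders
          (Z := fun i (ω : ι → E) => ω i) (i := t) hta hC))]
        exact hM s hsJ t (hmem t ht hta) hst A hA1 C hC

/-- The function `f` of the last coordinate makes the induction work: it absorbs the indicator of
the last event and is then integrated against the kernel, giving a function at the previous time. -/
lemma IsMarkovOn.setLIntegral_eq {P P' : Measure (ι → E)}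
    (h0 : P.map (fun ω => ω ⊥) = P'.map fun ω => ω ⊥) {B : ι → Set E}
    (hB : ∀ i, MeasurableSet (B i)) (J : Finset ι)
    (hP : IsMarkovOn Q (insert ⊥ ↑J) P fun i ω => ω i)
    (hP' : IsMarkovOn Q (insert ⊥ ↑J) P' fun i ω => ω i) {m : ι} (hm : m ∈ insert ⊥ (J : Set ι))
    (hmax : ∀ j ∈ J, j ≤ m) {f : E → ℝ≥0∞} (hf : Measurable f) :
    ∫⁻ ω in ⋂ j ∈ J, (fun ω : ι → E => ω j) ⁻¹' B j, f (ω m) ∂P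
      = ∫⁻ ω in ⋂ j ∈ J, (fun ω : ι → E => ω j) ⁻¹' B j, f (ω m) ∂P' := by
  classical
  have hbot : ∀ f : E → ℝ≥0∞, Measurable f → ∫⁻ ω, f (ω ⊥) ∂P = ∫⁻ ω, f (ω ⊥) ∂P' := by
    intro f hf
    rw [← lintegral_map hf (measurable_pi_apply ⊥), h0, lintegral_map hf (measurable_pi_apply ⊥)]
  have hev : ∀ i, MeasurableSet ((fun ω : ι → E => ω i) ⁻¹' B i) :=
    fun i => measurable_pi_apply i (hB i)
  induction J using Finset.induction_on_max generalizing m f with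
  | empty =>
    have : m = ⊥ := by simpa using hm
    subst this
    simpa using hbot f hf
  | insert a J hJ ih =>
    have hma : m = a := by
      refine le_antisymm ?_ (hmax a (Finset.mem_insert_self _ _))
      rcases hm with rfl | hm
      · exact bot_le
      · rcases Finset.mem_insert.1 hm with rfl | hm
        · exact le_rfl
        · exact (hJ m hm).le
    subst hma
    have hmeas : MeasurableSet (⋂ j ∈ J, (fun ω : ι → E => ω j) ⁻¹' B j) :=
      J.measurableSet_biInter fun i _ => hev i
    have hsplit : ∀ ρ : Measure (ι → E),
        ∫⁻ ω in ⋂ j ∈ insert m J, (fun ω : ι → E => ω j) ⁻¹' B j, f (ω m) ∂ρ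
          = ∫⁻ ω in ⋂ j ∈ J, (fun ω : ι → E => ω j) ⁻¹' B j, (B m).indicator f (ω m) ∂ρ := by
      intro ρ
      rw [Finset.set_biInter_insert, ← Measure.restrict_restrict (hev m),
        ← lintegral_indicator (hev m)]
      rfl
    rw [hsplit, hsplit]
    have hfm : Measurable ((B m).indicator f) := hf.indicator (hB m)
    by_cases hmb : m = ⊥
    · subst hmb
      have hJe : J = ∅ := Finset.eq_empty_of_forall_notMem fun x hx => not_lt_bot (hJ x hx)
      subst hJe
      simpa using hbot _ hfm
    · obtain ⟨m', hm', hmax'⟩ := exists_isGreatest_insert_bot J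
      have hlt : m' < m := by
        rcases hm' with rfl | h
        · exact bot_lt_iff_ne_bot.2 hmb
        · exact hJ m' h
      have hsub : insert ⊥ (J : Set ι) ⊆ insert ⊥ (↑(insert m J) : Set ι) := by
        refine insert_subset_insert ?_
        simp
      have hcyl : (⋂ j ∈ J, (fun ω : ι → E => ω j) ⁻¹' B j) ∈
          cylinders (fun i (ω : ι → E) => ω i) (insert ⊥ (↑(insert m J) : Set ι) ∩ Iic m') :=
        mem_cylinders_iff.2 ⟨J, B, fun j hj => ⟨hsub (Or.inr hj), hmax' j (Or.inr hj)⟩, hB, rfl⟩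
      have hmm : m ∈ insert ⊥ (↑(insert m J) : Set ι) := by simp
      rw [hP.setLIntegral (fun i _ => measurable_pi_apply i) (hsub hm') hmm hlt hcyl hfm,
        hP'.setLIntegral (fun i _ => measurable_pi_apply i) (hsub hm') hmm hlt hcyl hfm]
      exact ih (hP.mono hsub) (hP'.mono hsub) hm' (fun j hj => hmax' j (Or.inr hj))
        (hfm.lintegral_kernel)

lemma IsMarkovOn.map_restrict_eq {P P' : Measure (ι → E)} [IsFiniteMeasure P]
    (h0 : P.map (fun ω => ω ⊥) = P'.map fun ω => ω ⊥) (J : Finset ι)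
    (hP : IsMarkovOn Q (insert ⊥ ↑J) P fun i ω => ω i)
    (hP' : IsMarkovOn Q (insert ⊥ ↑J) P' fun i ω => ω i) :
    P.map J.restrict = P'.map J.restrict := by
  classical
  have hm := Finset.measurable_restrict (X := fun _ : ι => E) J
  obtain ⟨m, hm', hmax⟩ := exists_isGreatest_insert_bot J
  have hrect : ∀ B : ι → Set E, (∀ i, MeasurableSet (B i)) →
      P (⋂ j ∈ J, (fun ω : ι → E => ω j) ⁻¹' B j)
        = P' (⋂ j ∈ J, (fun ω : ι → E => ω j) ⁻¹' B j) := by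
    intro B hB
    simpa using hP.setLIntegral_eq h0 hB J hP' hm' (fun j hj => hmax j (Or.inr hj))
      (measurable_const (a := (1 : ℝ≥0∞)))
  refine ext_of_generate_finite _ generateFrom_pi.symm isPiSystem_pi ?_ ?_
  · rintro _ ⟨C, hC, rfl⟩
    have hC' : ∀ i, MeasurableSet (C i) := fun i => hC i (mem_univ i)
    let B : ι → Set E := fun i => if hi : i ∈ J then C ⟨i, hi⟩ else univ
    have hB : ∀ i, MeasurableSet (B i) := by
      intro i
      by_cases hi : i ∈ J
      · simpa [B, hi] using hC' ⟨i, hi⟩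
      · simp [B, hi]
    have hpre : J.restrict ⁻¹' (univ.pi C) = ⋂ j ∈ J, (fun ω : ι → E => ω j) ⁻¹' B j := by
      ext ω
      simp only [mem_preimage, mem_univ_pi, mem_iInter, Finset.restrict, Subtype.forall]
      refine forall₂_congr fun i hi => ?_
      simp [B, hi]
    rw [Measure.map_apply hm (MeasurableSet.univ_pi hC'),
      Measure.map_apply hm (MeasurableSet.univ_pi hC'), hpre]
    exact hrect B hB
  · rw [Measure.map_apply hm MeasurableSet.univ, Measure.map_apply hm MeasurableSet.univ]
    simpa using hrect (fun _ => univ) fun _ => MeasurableSet.univ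

/-- Existence of a Markov process with given initial law and transition kernels. -/
theorem exists_isMarkovOn_univ [TopologicalSpace E] [PolishSpace E] [BorelSpace E]
    (hQ : ∀ s t, s < t → IsMarkovKernel (Q s t))
    (hCK : ∀ r s t, r < s → s < t → ∀ x C, MeasurableSet C →
      ∫⁻ y, Q s t y C ∂(Q r s x) = Q r t x C)
    (ν : Measure E) [IsProbabilityMeasure ν] :
    ∃ P : Measure (ι → E), IsProbabilityMeasure P ∧ P.map (fun ω => ω ⊥) = ν ∧
      IsMarkovOn Q univ P fun i ω => ω i := by
  classical
  have hne : Nonempty E := nonempty_of_isProbabilityMeasure ν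
  choose μ hμ hμν hμM using exists_isMarkovOn_finset hQ hCK ν
  have hr : ∀ J : Finset ι, Measurable (J.restrict (π := fun _ => E)) :=
    fun J => Finset.measurable_restrict J
  let R : ∀ J : Finset ι, Measure (J → E) := fun J => (μ J).map J.restrict
  have hRp : ∀ J, IsProbabilityMeasure (R J) := fun J =>
    Measure.isProbabilityMeasure_map (hr J).aemeasurable
  -- Consistency follows from uniqueness: the measure built for `I` is also Markov on the smaller
  -- set `J`, with the same initial law.
  have hR : IsProjectiveMeasureFamily (α := fun _ : ι => E) R := by
    intro I J hJI
    have hsub : insert ⊥ (J : Set ι) ⊆ insert ⊥ (I : Set ι) :=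
      insert_subset_insert (by exact_mod_cast hJI)
    have h := IsMarkovOn.map_restrict_eq ((hμν J).trans (hμν I).symm) J (hμM J)
      ((hμM I).mono hsub)
    change (μ J).map J.restrict = ((μ I).map I.restrict).map (Finset.restrict₂ (π := fun _ : ι =>
        E) hJI)
    rw [h, Measure.map_map (Finset.measurable_restrict₂ (X := fun _ : ι => E) hJI) (hr I)]
    rfl
  obtain ⟨P, hP⟩ := KolmogorovExtension.exists_isProjectiveLimit hR
  have hPp : IsProbabilityMeasure P := hP.isProbabilityMeasure
  have heq : ∀ J : Finset ι, P.map J.restrict = (μ J).map J.restrict := hP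
  refine ⟨P, hPp, ?_, ?_⟩
  · have h1 := congrArg (fun m => m.map fun x : (({⊥} : Finset ι) → E) => x ⟨⊥, by simp⟩)
      (heq {⊥})
    simp only [Measure.map_map (measurable_pi_apply _) (hr _)] at h1
    exact h1.trans (hμν {⊥})
  · intro s _ t _ hst A hA C hC
    obtain ⟨F, B, hF, hB, rfl⟩ := mem_cylinders_iff.1 hA
    -- All times occurring in the Markov identity lie in this finite set, so the identity concerns
    -- one finite marginal only.
    let J : Finset ι := insert s (insert t F)
    let A' : Set (J → E) := ⋂ j : J, {x | (j : ι) ∈ F → x j ∈ B j}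
    have hA' : MeasurableSet A' := by
      refine MeasurableSet.iInter fun j => ?_
      by_cases hj : (j : ι) ∈ F
      · have : MeasurableSet {x : J → E | x j ∈ B j} := measurable_pi_apply j (hB j)
        simpa [hj] using this
      · simp [hj]
    have hpre : (⋂ j ∈ F, (fun ω : ι → E => ω j) ⁻¹' B j) = J.restrict ⁻¹' A' := by
      ext ω
      simp only [mem_iInter, mem_preimage, A', Subtype.forall]
      exact ⟨fun h i _ hi => h i hi, fun h i hi => h i (by simp [J, hi]) hi⟩
    have hs : s ∈ J := by simp [J]
    have ht : t ∈ J := by simp [J]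
    have hleft : ∀ m : Measure (ι → E), m (J.restrict ⁻¹' A' ∩ (fun ω : ι → E => ω t) ⁻¹' C)
        = m.map J.restrict (A' ∩ (fun x => x ⟨t, ht⟩) ⁻¹' C) := by
      intro m
      rw [Measure.map_apply (hr J) (hA'.inter (measurable_pi_apply _ hC))]
      rfl
    have hright : ∀ m : Measure (ι → E), ∫⁻ ω in J.restrict ⁻¹' A', Q s t (ω s) C ∂m
        = ∫⁻ x in A', Q s t (x ⟨s, hs⟩) C ∂(m.map J.restrict) := by
      intro m
      have hms : Measurable fun x : J → E => x ⟨s, hs⟩ := measurable_pi_apply _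
      have hms' : Measurable fun x : J → E => Q s t (x ⟨s, hs⟩) C :=
        ((Q s t).measurable_coe hC).comp hms
      rw [setLIntegral_map hA' hms' (hr J)]
      rfl
    have h := hμM J s (Or.inr hs) t (Or.inr ht) hst (J.restrict ⁻¹' A') ?_ C hC
    · rw [hpre, hleft, hright, heq, ← hleft, ← hright]
      exact h
    · rw [← hpre]
      exact mem_cylinders_iff.2 ⟨F, B, fun j hj => ⟨Or.inr (by simp [J, Finset.mem_coe.1 hj]),
        (hF hj).2⟩, hB, rfl⟩

end Existence

end MarkovProcess
end

/-! ### Conditional laws, bridges, and Markov processes characterised by their bridges. -/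

noncomputable section

namespace MarkovProcess
open ProbabilityTheory

variable {ι Ω E S : Type*} [MeasurableSpace E] [MeasurableSpace S]

/-! ### Conditional expectations -/

/-- A kernel which computes the conditional law of `X` on a generating `π`-system computes the
conditional expectations of bounded functions of `X`. -/
theorem condExp_comp_ae_eq_integral {m m0 : MeasurableSpace Ω} {P : Measure[m0] Ω}
    [IsFiniteMeasure P] (hm : m ≤ m0) {π : Set (Set Ω)} (hπ : IsPiSystem π)
    (hgen : m = MeasurableSpace.generateFrom π) (huniv : univ ∈ π) {X : Ω → E} {Y : Ω → S}
    (hX : Measurable[m0] X) (hY : Measurable[m] Y) {κ : Kernel S E} [IsMarkovKernel κ]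
    (h : ∀ A ∈ π, ∀ C, MeasurableSet C → P (A ∩ X ⁻¹' C) = ∫⁻ ω in A, κ (Y ω) C ∂P)
    {f : E → ℝ} (hf : Measurable f) (hbdd : ∃ C, ∀ x, |f x| ≤ C) :
    P[fun ω => f (X ω) | m] =ᵐ[P] fun ω => ∫ y, f y ∂(κ (Y ω)) := by
  obtain ⟨c, hc⟩ := hbdd
  have hY0 : Measurable[m0] Y := hY.mono hm le_rfl
  have hext : ∀ A, MeasurableSet[m] A → ∀ C, MeasurableSet C →
      P (A ∩ X ⁻¹' C) = ∫⁻ ω in A, κ (Y ω) C ∂P := by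
    intro A hA C hC
    have hmem : ∀ A ∈ π, MeasurableSet[m] A := fun A hA => by
      rw [hgen]; exact MeasurableSpace.measurableSet_generateFrom hA
    -- For fixed `C` both sides are finite measures of `A` which agree on the `π`-system.
    have key := ext_on_measurableSpace_of_generate_finite m0 (μ := P.restrict (X ⁻¹' C))
      (ν := P.withDensity fun ω => κ (Y ω) C) π (fun A hA => ?_) hm hgen hπ ?_ hA
    · rw [Measure.restrict_apply (hm A hA), withDensity_apply _ (hm A hA)] at key
      exact key
    · have hA' := hm A (hmem A hA)
      rw [Measure.restrict_apply hA', withDensity_apply _ hA']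
      exact h A hA C hC
    · rw [Measure.restrict_apply MeasurableSet.univ, withDensity_apply _ MeasurableSet.univ]
      exact h univ huniv C hC
  have hfX : Integrable (fun ω => f (X ω)) P :=
    Integrable.of_bound (hf.comp hX).aestronglyMeasurable c (ae_of_all _ fun ω => hc _)
  have hsm : StronglyMeasurable fun x => ∫ y, f y ∂(κ x) := hf.stronglyMeasurable.integral_kernel
  have hbound : ∀ ω, ‖∫ y, f y ∂(κ (Y ω))‖ ≤ c := fun ω => by
    have := norm_integral_le_of_norm_le_const (μ := κ (Y ω)) (ae_of_all _ fun y =>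
        (Real.norm_eq_abs (f y)).le.trans (hc y))
    simpa using this
  have hg : Integrable (fun ω => ∫ y, f y ∂(κ (Y ω))) P :=
    Integrable.of_bound (hsm.comp_measurable hY0).aestronglyMeasurable c (ae_of_all _ hbound)
  symm
  refine ae_eq_condExp_of_forall_setIntegral_eq hm hfX (fun _ _ _ => hg.integrableOn)
    (fun A hA _ => ?_) (hsm.comp_measurable hY).aestronglyMeasurable
  let κ' : Kernel Ω E := κ.comap Y hY0
  have hmap : (P.restrict A).map X = κ' ∘ₘ (P.restrict A) := by
    ext C hC
    rw [Measure.map_apply hX hC, Measure.bind_apply hC (Kernel.aemeasurable _),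
      Measure.restrict_apply (hX hC), inter_comm, hext A hA C hC]
    rfl
  have hint : Integrable f ((P.restrict A).map X) := by
    rw [integrable_map_measure hf.aestronglyMeasurable hX.aemeasurable]
    exact hfX.restrict
  rw [← integral_map (f := f) hX.aemeasurable hf.aestronglyMeasurable, hmap,
    Measure.comp_eq_comp_const_apply, Kernel.integral_comp, Kernel.const_apply]
  · rfl
  · rw [← Measure.comp_eq_comp_const_apply, ← hmap]
    exact hint

/-! ### Two times of a process -/

section cylinders
variable {Z : ι → Ω → E} {J : Set ι} {A : Set Ω}

lemma exists_eq_inter_preimage_of_mem_cylinders_insert {a : ι}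
    (hA : A ∈ cylinders Z (insert a J)) :
    ∃ A' ∈ cylinders Z J, ∃ C, MeasurableSet C ∧ A = A' ∩ Z a ⁻¹' C := by
  classical
  obtain ⟨F, B, hF, hB, rfl⟩ := mem_cylinders_iff.1 hA
  refine ⟨⋂ j ∈ F.erase a, Z j ⁻¹' B j, mem_cylinders_iff.2 ⟨F.erase a, B, fun j hj => ?_, hB, rfl⟩,
    if a ∈ F then B a else univ, ?_, ?_⟩
  · simp only [Finset.coe_erase, Set.mem_sdiff, mem_singleton_iff] at hj
    exact (hF hj.1).resolve_left hj.2
  · split_ifs; exacts [hB a, MeasurableSet.univ]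
  · ext ω
    simp only [Set.mem_inter_iff, mem_iInter, mem_preimage, Finset.mem_erase]
    constructor
    · intro h
      refine ⟨fun i hi => h i hi.2, ?_⟩
      split_ifs with ha
      exacts [h a ha, mem_univ _]
    · rintro ⟨h1, h2⟩ i hi
      by_cases hia : i = a
      · subst hia
        simpa [hi] using h2
      · exact h1 i ⟨hia, hi⟩

lemma eq_univ_of_mem_cylinders_empty (hA : A ∈ cylinders Z ∅) : A = univ := by
  obtain ⟨F, B, hF, hB, rfl⟩ := mem_cylinders_iff.1 hA
  have : F = ∅ := by simpa [subset_empty_iff] using hF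
  simp [this]

end cylinders

variable [MeasurableSpace Ω]

/-- Agreement on rectangles identifies the joint law of `(Y, X)` as the composition of the law of
`Y` with `κ`. -/
lemma lintegral_pair_eq {m : Measure Ω} [IsFiniteMeasure m] {X : Ω → E} {Y : Ω → S}
    {κ : Kernel S E} [IsSFiniteKernel κ] (hX : Measurable X) (hY : Measurable Y)
    (h : ∀ D C, MeasurableSet D → MeasurableSet C →
      m (Y ⁻¹' D ∩ X ⁻¹' C) = ∫⁻ ω in Y ⁻¹' D, κ (Y ω) C ∂m) {f : S × E → ℝ≥0∞}
    (hf : Measurable f) :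
    ∫⁻ ω, f (Y ω, X ω) ∂m = ∫⁻ ω, ∫⁻ y, f (Y ω, y) ∂(κ (Y ω)) ∂m := by
  have heq : m.map (fun ω => (Y ω, X ω)) = (m.map Y) ⊗ₘ κ := by
    refine Measure.ext_prod fun {D C} hD hC => ?_
    rw [Measure.map_apply (hY.prodMk hX) (hD.prod hC), Measure.compProd_apply_prod hD hC,
      setLIntegral_map hD (κ.measurable_coe hC) hY]
    exact h D C hD hC
  rw [← lintegral_map hf (hY.prodMk hX), heq, Measure.lintegral_compProd hf,
    lintegral_map (hf.lintegral_kernel_prod_right') hY]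

lemma lintegral_pair_eq_of_forall_preimage {m m' : Measure Ω} [IsFiniteMeasure m] {X : Ω → E}
    {Y : Ω → S} (hX : Measurable X) (hY : Measurable Y)
    (h : ∀ D C, MeasurableSet D → MeasurableSet C →
      m (Y ⁻¹' D ∩ X ⁻¹' C) = m' (Y ⁻¹' D ∩ X ⁻¹' C)) {f : S × E → ℝ≥0∞} (hf : Measurable f) :
    ∫⁻ ω, f (Y ω, X ω) ∂m = ∫⁻ ω, f (Y ω, X ω) ∂m' := by
  have heq : m.map (fun ω => (Y ω, X ω)) = m'.map fun ω => (Y ω, X ω) := by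
    refine Measure.ext_prod fun {D C} hD hC => ?_
    rw [Measure.map_apply (hY.prodMk hX) (hD.prod hC),
      Measure.map_apply (hY.prodMk hX) (hD.prod hC)]
    exact h D C hD hC
  rw [← lintegral_map hf (hY.prodMk hX), heq, lintegral_map hf (hY.prodMk hX)]

section cylinders
variable {Z : ι → Ω → E} {J K : Set ι} {P : Measure Ω} [IsFiniteMeasure P]

/-- If `κ (Z s)` is the conditional law of `X` on the cylinder events over `K ∋ s`, then the same
kernel computes the integrals of functions of `Z s` and `X`. -/
lemma setLIntegral_pair_eq {X : Ω → E} {κ : Kernel E E} [IsSFiniteKernel κ]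
    (hZ : ∀ i ∈ K, Measurable (Z i)) (hX : Measurable X) {s : ι} (hs : s ∈ K)
    (h : ∀ A ∈ cylinders Z K, ∀ C, MeasurableSet C →
      P (A ∩ X ⁻¹' C) = ∫⁻ ω in A, κ (Z s ω) C ∂P) {A : Set Ω} (hA : A ∈ cylinders Z K)
    {f : E × E → ℝ≥0∞} (hf : Measurable f) :
    ∫⁻ ω in A, f (Z s ω, X ω) ∂P = ∫⁻ ω in A, ∫⁻ y, f (Z s ω, y) ∂(κ (Z s ω)) ∂P := by
  refine lintegral_pair_eq hX (hZ s hs) (fun D C hD hC => ?_) hf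
  have hD' := hZ s hs hD
  rw [Measure.restrict_apply (hD'.inter (hX hC)), Measure.restrict_restrict hD',
    inter_comm, ← inter_assoc, inter_comm (Z s ⁻¹' D) A,
    h _ (inter_mem_cylinders hA (preimage_mem_cylinders hs hD)) C hC]

end cylinders

/-! ### Markov property and bridges -/

section OfBridge

variable {Q : ι → ι → Kernel E E} {K : Set ι} {P : Measure Ω} {Z : ι → Ω → E}
  {e : ι} {b : Kernel (E × E) E} {s r : ι}

/-- If the law of `Z e` given the times `K ∋ s` is `Q s e (Z s)` and the bridges are those of `b`,
then the laws of `Z r` given `K` and of `Z e` given `K ∪ {r}` are `Q s r (Z s)` and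
`Q r e (Z r)`. -/
lemma measure_inter_preimage_of_bridge [IsFiniteMeasure P] [IsSFiniteKernel (Q s e)]
    [IsMarkovKernel (Q r e)]
    (hZ : ∀ i ∈ K, Measurable (Z i)) (hZr : Measurable (Z r)) (hZe : Measurable (Z e))
    (hs : s ∈ K)
    (hK : ∀ A ∈ cylinders Z K, ∀ D, MeasurableSet D →
      P (A ∩ Z e ⁻¹' D) = ∫⁻ ω in A, Q s e (Z s ω) D ∂P)
    (hbr : ∀ A ∈ cylinders Z K, ∀ D, MeasurableSet D → ∀ C, MeasurableSet C →
      P (A ∩ Z e ⁻¹' D ∩ Z r ⁻¹' C) = ∫⁻ ω in A ∩ Z e ⁻¹' D, b (Z e ω, Z s ω) C ∂P)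
    (hb : ∀ x (f β : E → ℝ≥0∞), Measurable f → Measurable β →
      ∫⁻ y, β y * ∫⁻ z, f z ∂(b (y, x)) ∂(Q s e x)
        = ∫⁻ z, f z * ∫⁻ y, β y ∂(Q r e z) ∂(Q s r x))
    {A : Set Ω} (hA : A ∈ cylinders Z K) {C : Set E} (hC : MeasurableSet C) :
    P (A ∩ Z r ⁻¹' C) = ∫⁻ ω in A, Q s r (Z s ω) C ∂P ∧
      ∀ D, MeasurableSet D → P (A ∩ Z r ⁻¹' C ∩ Z e ⁻¹' D)
        = ∫⁻ ω in A ∩ Z r ⁻¹' C, Q r e (Z r ω) D ∂P := by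
  have hA0 : MeasurableSet A := measurableSet_of_mem_cylinders hZ hA
  -- The joint law of `Z r` and `Z e` on `A`: condition first on `Z e`, then on the bridge, and
  -- reverse the order with `hb`. Taking `D = univ` gives the law of `Z r`, and the remaining factor
  -- is the law of `Z e` given `Z r`.
  have h1 : ∀ C, MeasurableSet C → ∀ D, MeasurableSet D → P (A ∩ Z e ⁻¹' D ∩ Z r ⁻¹' C)
      = ∫⁻ ω in A, ∫⁻ z, C.indicator 1 z * Q r e z D ∂(Q s r (Z s ω)) ∂P := by
    intro C hC D hD
    have hbC : Measurable fun p : E × E => b (p.2, p.1) C :=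
      (b.measurable_coe hC).comp measurable_swap
    have hD1 : Measurable fun y => D.indicator (1 : E → ℝ≥0∞) y := measurable_one.indicator hD
    have h2 := setLIntegral_pair_eq (K := K) (X := Z e) hZ hZe hs hK hA
      (f := fun p => D.indicator 1 p.2 * b (p.2, p.1) C) ((hD1.comp measurable_snd).mul hbC)
    have h3 : ∫⁻ ω in A ∩ Z e ⁻¹' D, b (Z e ω, Z s ω) C ∂P
        = ∫⁻ ω in A, D.indicator 1 (Z e ω) * b (Z e ω, Z s ω) C ∂P := by
      rw [inter_comm, ← Measure.restrict_restrict (hZe hD), ← lintegral_indicator (hZe hD)]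
      refine lintegral_congr fun ω => ?_
      by_cases hω : Z e ω ∈ D
      · simp [hω]
      · simp [hω]
    rw [hbr A hA D hD C hC, h3, h2]
    refine lintegral_congr fun ω => ?_
    have h4 := hb (Z s ω) _ _ (measurable_one.indicator hC) hD1
    simp only [lintegral_indicator_one hC, lintegral_indicator_one hD] at h4
    exact h4
  have h5 : ∀ C, MeasurableSet C → P (A ∩ Z r ⁻¹' C) = ∫⁻ ω in A, Q s r (Z s ω) C ∂P := by
    intro C hC
    have := h1 C hC univ MeasurableSet.univ
    simpa [lintegral_indicator_one hC] using this
  refine ⟨h5 C hC, fun D hD => ?_⟩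
  have hm : Measurable fun z => C.indicator 1 z * Q r e z D :=
    (measurable_one.indicator hC).mul ((Q r e).measurable_coe hD)
  rw [inter_right_comm, h1 C hC D hD, inter_comm A, ← Measure.restrict_restrict (hZr hC),
    ← lintegral_indicator (hZr hC), ← lintegral_comp_of_forall_preimage hZr (hZ s hs)
    (fun C hC => ?_) hm]
  · refine lintegral_congr fun ω => ?_
    by_cases hω : Z r ω ∈ C
    · simp [hω]
    · simp [hω]
  · rw [Measure.restrict_apply (hZr hC), inter_comm, h5 C hC]

end OfBridge

variable [LinearOrder ι] {Q : ι → ι → Kernel E E} {J K : Set ι} {P : Measure Ω} {Z : ι → Ω → E}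

/-- The function `β` is the conditional probability of the future event given the value at `t`. It
is built by integrating out the times from the latest to the earliest, whence the induction on the
minimum. -/
lemma IsMarkovOn.exists_future (hM : IsMarkovOn Q J P Z) (hZ : ∀ i ∈ J, Measurable (Z i)) {t : ι}
    (ht : t ∈ J) {B : Set Ω} (hB : B ∈ cylinders Z (J ∩ Ici t)) :
    ∃ β : E → ℝ≥0∞, Measurable β ∧ ∀ A ∈ cylinders Z (J ∩ Iic t),
      P (A ∩ B) = ∫⁻ ω in A, β (Z t ω) ∂P := by
  classical
  obtain ⟨F, f, hF, hf, rfl⟩ := mem_cylinders_iff.1 hB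
  clear hB
  induction F using Finset.induction_on_min generalizing t with
  | empty => exact ⟨fun _ => 1, measurable_const, fun A _ => by simp⟩
  | insert a F ha ih =>
    have haJ : a ∈ J ∩ Ici t := hF (Finset.mem_coe.2 (Finset.mem_insert_self _ _))
    have hFJ : ↑F ⊆ J ∩ Ici a := fun j hj =>
      ⟨(hF (Finset.mem_coe.2 (Finset.mem_insert_of_mem (Finset.mem_coe.1 hj)))).1, (ha j hj).le⟩
    obtain ⟨β, hβ, h⟩ := ih haJ.1 hFJ
    have hβi : Measurable ((f a).indicator β) := hβ.indicator (hf a)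
    have key : ∀ A ∈ cylinders Z (J ∩ Iic t),
        P (A ∩ ⋂ j ∈ insert a F, Z j ⁻¹' f j) = ∫⁻ ω in A, (f a).indicator β (Z a ω) ∂P := by
      intro A hA
      have hA' : A ∩ Z a ⁻¹' f a ∈ cylinders Z (J ∩ Iic a) :=
        inter_mem_cylinders (cylinders_mono (inter_subset_inter_right _ (Iic_subset_Iic.2 haJ.2))
            hA)
          (preimage_mem_cylinders (J := J ∩ Iic a) ⟨haJ.1, le_rfl⟩ (hf a))
      rw [Finset.set_biInter_insert, ← inter_assoc, h _ hA', inter_comm,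
        ← Measure.restrict_restrict (hZ a haJ.1 (hf a)), ← lintegral_indicator (hZ a haJ.1 (hf a))]
      rfl
    -- If the earliest future time is `t` itself, no transition is needed.
    rcases (show t ≤ a from haJ.2).eq_or_lt with rfl | hta
    · exact ⟨_, hβi, key⟩
    · refine ⟨fun x => ∫⁻ y, (f a).indicator β y ∂(Q t a x), hβi.lintegral_kernel, fun A hA => ?_⟩
      rw [key A hA, hM.setLIntegral hZ ht haJ.1 hta hA hβi]

/-- A Markov process has the bridges `b` if `b` is compatible with its transition kernels. -/
lemma IsMarkovOn.measure_inter_inter_preimage [IsFiniteMeasure P] (hM : IsMarkovOn Q J P Z)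
    (hZ : ∀ i ∈ J, Measurable (Z i)) {s r t : ι} (hs : s ∈ J) (hr : r ∈ J) (ht : t ∈ J)
    (hsr : s < r) (hrt : r < t) [IsSFiniteKernel (Q s t)] {b : Kernel (E × E) E}
    (hb : ∀ x (f β : E → ℝ≥0∞), Measurable f → Measurable β →
      ∫⁻ y, β y * ∫⁻ z, f z ∂(b (y, x)) ∂(Q s t x)
        = ∫⁻ z, f z * ∫⁻ y, β y ∂(Q r t z) ∂(Q s r x))
    {A B : Set Ω} (hA : A ∈ cylinders Z (J ∩ Iic s)) (hB : B ∈ cylinders Z (J ∩ Ici t))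
    {C : Set E} (hC : MeasurableSet C) :
    P (A ∩ B ∩ Z r ⁻¹' C) = ∫⁻ ω in A ∩ B, b (Z t ω, Z s ω) C ∂P := by
  obtain ⟨β, hβ, h⟩ := hM.exists_future hZ ht hB
  have hst := hsr.trans hrt
  have hAt : A ∈ cylinders Z (J ∩ Iic t) :=
    cylinders_mono (inter_subset_inter_right _ (Iic_subset_Iic.2 hst.le)) hA
  have hAr : A ∈ cylinders Z (J ∩ Iic r) :=
    cylinders_mono (inter_subset_inter_right _ (Iic_subset_Iic.2 hsr.le)) hA
  have hArC : A ∩ Z r ⁻¹' C ∈ cylinders Z (J ∩ Iic r) :=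
    inter_mem_cylinders hAr (preimage_mem_cylinders (J := J ∩ Iic r) ⟨hr, le_rfl⟩ hC)
  have hArC' : A ∩ Z r ⁻¹' C ∈ cylinders Z (J ∩ Iic t) :=
    cylinders_mono (inter_subset_inter_right _ (Iic_subset_Iic.2 hrt.le)) hArC
  have hA0 : MeasurableSet A := measurableSet_of_mem_cylinders (fun i hi => hZ i hi.1) hA
  have hQβ : Measurable fun z => ∫⁻ y, β y ∂(Q r t z) := hβ.lintegral_kernel
  have hbC : Measurable fun p : E × E => b (p.2, p.1) C :=
    (b.measurable_coe hC).comp measurable_swap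
  have hCβ : Measurable fun z => C.indicator (1 : E → ℝ≥0∞) z * ∫⁻ y, β y ∂(Q r t z) :=
    (measurable_one.indicator hC).mul hQβ
  have hbω : Measurable fun ω => b (Z t ω, Z s ω) C :=
    (b.measurable_coe hC).comp ((hZ t ht).prodMk (hZ s hs))
  have h1 : P (A ∩ B ∩ Z r ⁻¹' C)
      = ∫⁻ ω in A, ∫⁻ z, C.indicator 1 z * ∫⁻ y, β y ∂(Q r t z) ∂(Q s r (Z s ω)) ∂P := by
    rw [inter_right_comm, h _ hArC', hM.setLIntegral hZ hr ht hrt hArC hβ, inter_comm,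
      ← Measure.restrict_restrict (hZ r hr hC), ← lintegral_indicator (hZ r hr hC),
      ← hM.setLIntegral hZ hs hr hsr hA hCβ]
    refine lintegral_congr fun ω => ?_
    by_cases hω : Z r ω ∈ C
    · simp [hω]
    · simp [hω]
  -- On events up to time `t`, the future event `B` acts as the weight `β (Z t)`.
  have h2 : ∫⁻ ω in A ∩ B, b (Z t ω, Z s ω) C ∂P
      = ∫⁻ ω in A, β (Z t ω) * b (Z t ω, Z s ω) C ∂P := by
    have hAβ : Measurable fun ω => β (Z t ω) := hβ.comp (hZ t ht)
    have := lintegral_pair_eq_of_forall_preimage (m := P.restrict (A ∩ B))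
      (m' := (P.restrict A).withDensity fun ω => β (Z t ω)) (hZ t ht) (hZ s hs)
      (fun D C' hD hC' => ?_) hbC
    · rw [this, lintegral_withDensity_eq_lintegral_mul _ hAβ hbω]
      rfl
    · have hm : MeasurableSet (Z s ⁻¹' D ∩ Z t ⁻¹' C') := (hZ s hs hD).inter (hZ t ht hC')
      have hcyl : Z s ⁻¹' D ∩ Z t ⁻¹' C' ∩ A ∈ cylinders Z (J ∩ Iic t) :=
        inter_mem_cylinders (inter_mem_cylinders
          (preimage_mem_cylinders (J := J ∩ Iic t) ⟨hs, hst.le⟩ hD)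
          (preimage_mem_cylinders (J := J ∩ Iic t) ⟨ht, le_rfl⟩ hC')) hAt
      rw [Measure.restrict_apply hm, withDensity_apply _ hm, Measure.restrict_restrict hm,
        ← inter_assoc, h _ hcyl]
  have h3 := setLIntegral_pair_eq (K := J ∩ Iic s) (X := Z t) (fun i hi => hZ i hi.1) (hZ t ht)
    ⟨hs, le_rfl⟩ (fun A hA C hC => hM s hs t ht hst A hA C hC) hA
    (f := fun p => β p.2 * b (p.2, p.1) C) ((hβ.comp measurable_snd).mul hbC)
  rw [h1, h2, h3]
  refine lintegral_congr fun ω => ?_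
  rw [← hb _ _ _ (measurable_one.indicator hC) hβ]
  refine lintegral_congr fun y => ?_
  rw [lintegral_indicator_one hC]


/-- A process whose bridges towards the final time `e` are given by `b`, and for which the law of
`(Z o, Z e)` is the one of the Markov process, is Markov. -/
theorem isMarkovOn_of_bridge [IsFiniteMeasure P] {o e : ι} (ho : o ∈ J) (he : e ∈ J)
    (hoJ : ∀ j ∈ J, o ≤ j) (heJ : ∀ j ∈ J, j ≤ e) (hoe : o < e)
    (hQ : ∀ s ∈ J, ∀ t ∈ J, s < t → IsMarkovKernel (Q s t))
    (hZ : ∀ i ∈ J, Measurable (Z i)) {b : ι → ι → Kernel (E × E) E}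
    (h0 : ∀ C, MeasurableSet C → ∀ D, MeasurableSet D →
      P (Z o ⁻¹' C ∩ Z e ⁻¹' D) = ∫⁻ ω in Z o ⁻¹' C, Q o e (Z o ω) D ∂P)
    (hbr : ∀ s ∈ J, ∀ r ∈ J, s < r → r < e → ∀ A ∈ cylinders Z (J ∩ Iic s), ∀ D, MeasurableSet D →
      ∀ C, MeasurableSet C →
        P (A ∩ Z e ⁻¹' D ∩ Z r ⁻¹' C) = ∫⁻ ω in A ∩ Z e ⁻¹' D, b s r (Z e ω, Z s ω) C ∂P)
    (hb : ∀ s ∈ J, ∀ r ∈ J, s < r → r < e → ∀ x (f β : E → ℝ≥0∞), Measurable f → Measurable β →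
      ∫⁻ y, β y * ∫⁻ z, f z ∂(b s r (y, x)) ∂(Q s e x)
        = ∫⁻ z, f z * ∫⁻ y, β y ∂(Q r e z) ∂(Q s r x)) :
    IsMarkovOn Q J P Z := by
  classical
  -- The law of `Z e` given finitely many times before `e` depends only on the latest one. The
  -- induction starts from the endpoint law at `o` and inserts the times in increasing order, each
  -- by its bridge towards `e`.
  have hfinal : ∀ F : Finset ι, ↑F ⊆ J \ {e} → ∀ m ∈ insert o (F : Set ι), (∀ j ∈ F, j ≤ m) →
      ∀ A ∈ cylinders Z (insert o ↑F), ∀ D, MeasurableSet D →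
        P (A ∩ Z e ⁻¹' D) = ∫⁻ ω in A, Q m e (Z m ω) D ∂P := by
    intro F
    induction F using Finset.induction_on_max with
    | empty =>
      intro _ m hm _ A hA D hD
      have : m = o := by simpa using hm
      subst this
      rw [Finset.coe_empty] at hA
      obtain ⟨A', hA', C, hC, rfl⟩ := exists_eq_inter_preimage_of_mem_cylinders_insert hA
      rw [eq_univ_of_mem_cylinders_empty hA', univ_inter]
      exact h0 C hC D hD
    | insert a F ha ih =>
      intro hF m hm hmax A hA D hD
      have haJ : a ∈ J \ {e} := hF (Finset.mem_coe.2 (Finset.mem_insert_self _ _))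
      have hFJ : ↑F ⊆ J \ {e} := fun j hj =>
        hF (Finset.mem_coe.2 (Finset.mem_insert_of_mem (Finset.mem_coe.1 hj)))
      have hma : m = a := by
        refine le_antisymm ?_ (hmax a (Finset.mem_insert_self _ _))
        rcases hm with rfl | hm
        · exact hoJ a haJ.1
        · rcases Finset.mem_insert.1 hm with rfl | hm
          · exact le_rfl
          · exact (ha m hm).le
      subst hma
      by_cases hmo : m = o
      · subst hmo
        have hins : insert m (↑(insert m F) : Set ι) = insert m (F : Set ι) := by simp
        rw [hins] at hA
        exact ih hFJ m (Or.inl rfl) (fun j hj => (ha j hj).le) A hA D hD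
      have hins : insert o (↑(insert m F) : Set ι) = insert m (insert o (F : Set ι)) := by
        rw [Finset.coe_insert, insert_comm]
      rw [hins] at hA
      obtain ⟨A', hA', C, hC, rfl⟩ := exists_eq_inter_preimage_of_mem_cylinders_insert hA
      have hne : (insert o F).Nonempty := Finset.insert_nonempty _ _
      set m' := (insert o F).max' hne with hm'
      have hm'1 : m' ∈ insert o (F : Set ι) := by simpa using Finset.max'_mem _ hne
      have hm'2 : ∀ j ∈ insert o (F : Set ι), j ≤ m' := fun j hj =>
        Finset.le_max' _ _ (by simpa using hj)
      have hsubJ : insert o (F : Set ι) ⊆ J := insert_subset ho fun j hj => (hFJ hj).1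
      have hm'J : m' ∈ J := hsubJ hm'1
      have hlt : m' < m := by
        rcases hm'1 with h | h
        · rw [h]; exact lt_of_le_of_ne (hoJ m haJ.1) (Ne.symm hmo)
        · exact ha m' h
      have hme : m < e := lt_of_le_of_ne (heJ m haJ.1) haJ.2
      have := hQ m' hm'J e he (hlt.trans hme)
      have := hQ m haJ.1 e he hme
      exact (measure_inter_preimage_of_bridge (b := b m' m) (fun i hi => hZ i (hsubJ hi))
        (hZ m haJ.1) (hZ e he) hm'1
        (ih hFJ m' hm'1 fun j hj => hm'2 j (Or.inr hj))
        (fun A hA D hD C hC => hbr m' hm'J m haJ.1 hlt hme A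
          (cylinders_mono (K := J ∩ Iic m') (fun j hj => ⟨hsubJ hj, hm'2 j hj⟩) hA) D hD C hC)
        (hb m' hm'J m haJ.1 hlt hme) hA' hC).2 D hD
  intro s hs t ht hst A hA C hC
  have hse : s < e := hst.trans_le (heJ t ht)
  obtain ⟨F, B, hF, hB, rfl⟩ := mem_cylinders_iff.1 hA
  have hG : ↑(insert s F) ⊆ J \ {e} := by
    intro j hj
    rcases Finset.mem_insert.1 (Finset.mem_coe.1 hj) with rfl | hj
    · exact ⟨hs, hse.ne⟩
    · exact ⟨(hF hj).1, ((hF hj).2.trans_lt hse).ne⟩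
  have hsG : s ∈ insert o (↑(insert s F) : Set ι) := by simp
  have hmax : ∀ j ∈ insert o (↑(insert s F) : Set ι), j ≤ s := by
    intro j hj
    rcases hj with rfl | hj
    · exact hoJ s hs
    · rcases Finset.mem_insert.1 (Finset.mem_coe.1 hj) with rfl | hj
      · exact le_rfl
      · exact (hF hj).2
  -- The conditioning times are enlarged by `s`, which becomes the latest. If `t = e` the claim is
  -- `hfinal`; otherwise a bridge from `s` to `e` gives the law at `t`.
  have hK := hfinal _ hG s hsG fun j hj => hmax j (Or.inr hj)
  have hA' : (⋂ j ∈ F, Z j ⁻¹' B j) ∈ cylinders Z (insert o (↑(insert s F) : Set ι)) :=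
    mem_cylinders_iff.2 ⟨F, B, fun j hj => Or.inr (by simp [Finset.mem_coe.1 hj]), hB, rfl⟩
  rcases (heJ t ht).eq_or_lt with rfl | hte
  · exact hK _ hA' C hC
  · have := hQ s hs e he hse
    have := hQ t ht e he hte
    have hsubJ : insert o (↑(insert s F) : Set ι) ⊆ J := insert_subset ho fun j hj => (hG hj).1
    exact (measure_inter_preimage_of_bridge (b := b s t) (fun i hi => hZ i (hsubJ hi))
      (hZ t ht) (hZ e he) hsG hK
      (fun A hA D hD C hC => hbr s hs t ht hst hte A
        (cylinders_mono (K := J ∩ Iic s) (fun j hj => ⟨hsubJ hj, hmax j hj⟩) hA) D hD C hC)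
      (hb s hs t ht hst hte) hA' hC).1

end MarkovProcess
end

/-! ### The `h`-transform of the Green function and its bridges. -/

noncomputable section

namespace Bernstein
open ProbabilityTheory

variable {N : ℕ} {V : Space N → ℝ} {T : ℝ} {g : Space N → ℝ → Space N → ℝ}
  {φ ψ : Measure (Space N)}

/-! ### The transition kernels -/

/-- The solution `v_ψ` of the backward problem, extended by `1` to the time `T`, where `ψ` itself
serves as reference measure. -/
def harmonic (g : Space N → ℝ → Space N → ℝ) (T : ℝ) (ψ : Measure (Space N)) (t : ℝ)
    (x : Space N) : ℝ≥0∞ :=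
  if t < T then ∫⁻ y, greenDensity g T (T - t) x y ∂ψ else 1

/-- Lebesgue measure before the time `T`, and `ψ` at the time `T`. -/
def refMeasure (T : ℝ) (ψ : Measure (Space N)) (t : ℝ) : Measure (Space N) :=
  if t < T then volume else ψ

instance [SFinite ψ] (t : ℝ) : SFinite (refMeasure T ψ t) := by
  unfold refMeasure; split_ifs <;> infer_instance

/-- The transition kernels of the Green function, transformed by the harmonic function `v_ψ`. -/
def markovKernel (g : Space N → ℝ → Space N → ℝ) (T : ℝ) (ψ : Measure (Space N))
    [SFinite ψ] (s t : ℝ) : Kernel (Space N) (Space N) :=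
  Kernel.withDensity (Kernel.const _ (refMeasure T ψ t)) fun x y =>
    greenDensity g T (t - s) x y * harmonic g T ψ t y / harmonic g T ψ s x

/-- The kernel with density `bernsteinDensity`: the law at time `r` given the values at the times
`t` and `s`. -/
def bridgeKernel (g : Space N → ℝ → Space N → ℝ) (T s r t : ℝ) :
    Kernel (Space N × Space N) (Space N) :=
  Kernel.withDensity (Kernel.const _ volume) fun p z =>
    greenDensity g T (t - r) p.1 z * greenDensity g T (r - s) z p.2
      / greenDensity g T (t - s) p.1 p.2

lemma measurable_harmonic (H1 : PotentialHypothesis V T g) [SFinite ψ] (t : ℝ) :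
    Measurable (harmonic g T ψ t) := by
  unfold harmonic
  split_ifs
  · exact (H1.measurable_green_prod (T - t)).lintegral_prod_right'
  · exact measurable_const

lemma DataHypothesis.lintegral_forward (H1 : PotentialHypothesis V T g)
    (H2 : DataHypothesis V T g φ ψ) {t : ℝ} (ht : t ∈ Ioc 0 T) (x : Space N) :
    ∫⁻ y, greenDensity g T t x y ∂φ = ENNReal.ofReal (forwardSol g φ x t) := by
  rw [forwardSol, ofReal_integral_eq_lintegral_ofReal (H2.forward_integrable x t ht)
    (ae_of_all _ fun y => H1.green.nonneg x t ht y)]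
  simp only [green_of_mem ht]

lemma DataHypothesis.harmonic_eq (H1 : PotentialHypothesis V T g)
    (H2 : DataHypothesis V T g φ ψ) {t : ℝ} (ht : t ∈ Ico 0 T) (x : Space N) :
    harmonic g T ψ t x = ENNReal.ofReal (backwardSol g T ψ x t) := by
  have ht' : T - t ∈ Ioc 0 T := ⟨sub_pos.2 ht.2, by linarith [ht.1]⟩
  rw [harmonic, if_pos ht.2, backwardSol,
    ofReal_integral_eq_lintegral_ofReal (H2.backward_integrable x t ht)
    (ae_of_all _ fun y => H1.green.nonneg x _ ht' y)]
  simp only [green_of_mem ht']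

lemma DataHypothesis.harmonic_ne_top (H1 : PotentialHypothesis V T g)
    (H2 : DataHypothesis V T g φ ψ) {t : ℝ} (ht : t ∈ Icc 0 T) (x : Space N) :
    harmonic g T ψ t x ≠ ∞ := by
  rcases ht.2.lt_or_eq with h | h
  · rw [H2.harmonic_eq H1 ⟨ht.1, h⟩]; exact ENNReal.ofReal_ne_top
  · simp [harmonic, h]

lemma DataHypothesis.harmonic_ne_zero (H1 : PotentialHypothesis V T g)
    (H2 : DataHypothesis V T g φ ψ) {t : ℝ} (ht : t ∈ Icc 0 T) (x : Space N) :
    harmonic g T ψ t x ≠ 0 := by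
  rcases ht.2.lt_or_eq with h | h
  · rw [H2.harmonic_eq H1 ⟨ht.1, h⟩]
    simpa using H2.backward_solution.pos x t ⟨ht.1, h⟩
  · simp [harmonic, h]

lemma lintegral_markovKernel (H1 : PotentialHypothesis V T g) [SFinite ψ] (s t : ℝ) (x : Space N)
    {f : Space N → ℝ≥0∞} (hf : Measurable f) :
    ∫⁻ y, f y ∂(markovKernel g T ψ s t x) = ∫⁻ y,
      greenDensity g T (t - s) x y * harmonic g T ψ t y / harmonic g T ψ s x * f y
        ∂(refMeasure T ψ t) := by
  have h : Measurable (Function.uncurry fun x y =>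
      greenDensity g T (t - s) x y * harmonic g T ψ t y / harmonic g T ψ s x) :=
    ((H1.measurable_green_prod (t - s)).mul ((measurable_harmonic H1 t).comp measurable_snd)).div
      ((measurable_harmonic H1 s).comp measurable_fst)
  rw [markovKernel, Kernel.lintegral_withDensity _ h _ hf, Kernel.const_apply]

lemma lintegral_bridgeKernel (H1 : PotentialHypothesis V T g) (s r t : ℝ) (p : Space N × Space N)
    {f : Space N → ℝ≥0∞} (hf : Measurable f) :
    ∫⁻ z, f z ∂(bridgeKernel g T s r t p) = ∫⁻ z,
      greenDensity g T (t - r) p.1 z * greenDensity g T (r - s) z p.2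
        / greenDensity g T (t - s) p.1 p.2 * f z := by
  have h : Measurable (Function.uncurry fun (p : Space N × Space N) z =>
      greenDensity g T (t - r) p.1 z * greenDensity g T (r - s) z p.2
        / greenDensity g T (t - s) p.1 p.2) :=
    (((H1.measurable_green_prod (t - r)).comp
      ((measurable_fst.comp measurable_fst).prodMk measurable_snd)).mul
      ((H1.measurable_green_prod (r - s)).comp
      (measurable_snd.prodMk (measurable_snd.comp measurable_fst)))).div
      ((H1.measurable_green_prod (t - s)).comp measurable_fst)
  rw [bridgeKernel, Kernel.lintegral_withDensity _ h _ hf, Kernel.const_apply]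

/-- Space-time harmonicity of `v_ψ`: Chapman-Kolmogorov under the integral against `ψ`. At `t = T`
it is the definition of `v_ψ`, thanks to the convention `h = 1` with reference measure `ψ`. -/
lemma lintegral_markov_density (H1 : PotentialHypothesis V T g)
    [SFinite ψ] {s t : ℝ} (hs : 0 ≤ s) (hst : s < t) (htT : t ≤ T) (x : Space N) :
    ∫⁻ y, greenDensity g T (t - s) x y * harmonic g T ψ t y ∂(refMeasure T ψ t)
      = harmonic g T ψ s x := by
  rcases htT.lt_or_eq with h | rfl
  · have : ∀ y, greenDensity g T (t - s) x y * harmonic g T ψ t y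
        = ∫⁻ w, greenDensity g T (t - s) x y * greenDensity g T (T - t) y w ∂ψ := by
      intro y
      rw [lintegral_const_mul _ (H1.measurable_green_right _ _), harmonic, if_pos h]
    simp only [this]
    rw [lintegral_lintegral_swap, harmonic, if_pos (hst.trans h), refMeasure, if_pos h]
    · refine lintegral_congr fun w => ?_
      rw [H1.lintegral_green_mul (sub_pos.2 hst) (sub_pos.2 h) (by linarith)]
      congr 1; ring
    · exact (((H1.measurable_green_right _ x).comp measurable_fst).mul
        (H1.measurable_green_prod _)).aemeasurable
  · simp [harmonic, refMeasure, hst]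

lemma isMarkovKernel_markovKernel (H1 : PotentialHypothesis V T g) (H2 : DataHypothesis V T g φ ψ)
    [SFinite ψ] {s t : ℝ} (hs : 0 ≤ s) (hst : s < t) (htT : t ≤ T) :
    IsMarkovKernel (markovKernel g T ψ s t) := by
  refine ⟨fun x => ⟨?_⟩⟩
  have hs' : s ∈ Icc 0 T := ⟨hs, hst.le.trans htT⟩
  rw [← lintegral_one, lintegral_markovKernel H1 _ _ _ measurable_const]
  simp only [mul_one, div_eq_mul_inv]
  have hm : Measurable fun y => greenDensity g T (t - s) x y * harmonic g T ψ t y :=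
    (H1.measurable_green_right _ _).mul (measurable_harmonic H1 t)
  rw [lintegral_mul_const _ hm, lintegral_markov_density H1 hs hst htT,
    ENNReal.mul_inv_cancel (H2.harmonic_ne_zero H1 hs' x) (H2.harmonic_ne_top H1 hs' x)]

lemma isMarkovKernel_bridgeKernel (H1 : PotentialHypothesis V T g)
    {s r t : ℝ} (hs : 0 ≤ s) (hsr : s < r) (hrt : r < t) (htT : t ≤ T) :
    IsMarkovKernel (bridgeKernel g T s r t) := by
  refine ⟨fun p => ⟨?_⟩⟩
  rw [← lintegral_one, lintegral_bridgeKernel H1 _ _ _ _ measurable_const]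
  simp only [mul_one, div_eq_mul_inv]
  have hts : t - s ∈ Ioc 0 T := ⟨by linarith, by linarith⟩
  have hm : Measurable fun z => greenDensity g T (t - r) p.1 z * greenDensity g T (r - s) z p.2 :=
    (H1.measurable_green_right _ _).mul (H1.measurable_green_left _ _)
  rw [lintegral_mul_const _ hm,
    H1.lintegral_green_mul (sub_pos.2 hrt) (sub_pos.2 hsr) (by linarith),
    show t - r + (r - s) = t - s by ring,
    ENNReal.mul_inv_cancel (H1.green_ne_zero hts _ _) (green_ne_top _ _ _)]

/-- In the variables `(y, z)` both sides have the density `g(x, r-s, z) g(z, t-r, y) h(y, t) / h(x,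
s)`: on the left `g(x, t-s, y)` cancels, on the right `h(z, r)`. Symmetry of `g` reconciles the
order of the arguments, and Tonelli exchanges the integrals. -/
lemma lintegral_bridge_markovKernel (H1 : PotentialHypothesis V T g)
    (H2 : DataHypothesis V T g φ ψ) [SFinite ψ] {s r t : ℝ} (hs : 0 ≤ s) (hsr : s < r) (hrt : r < t)
    (htT : t ≤ T) (x : Space N) (f β : Space N → ℝ≥0∞) (hf : Measurable f) (hβ : Measurable β) :
    ∫⁻ y, β y * ∫⁻ z, f z ∂(bridgeKernel g T s r t (y, x)) ∂(markovKernel g T ψ s t x)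
      = ∫⁻ z, f z * ∫⁻ y, β y ∂(markovKernel g T ψ r t z) ∂(markovKernel g T ψ s r x) := by
  have := isMarkovKernel_bridgeKernel H1 hs hsr hrt htT
  have := isMarkovKernel_markovKernel H1 H2 (hs.trans hsr.le) hrt htT
  have hts : t - s ∈ Ioc 0 T := ⟨by linarith, by linarith⟩
  have hm1 : Measurable fun y => ∫⁻ z, f z ∂(bridgeKernel g T s r t (y, x)) :=
    (hf.lintegral_kernel (κ := bridgeKernel g T s r t)).comp measurable_prodMk_right
  have hm2 : Measurable fun z => ∫⁻ y, β y ∂(markovKernel g T ψ r t z) := hβ.lintegral_kernel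
  have hm3 : Measurable fun y => β y * ∫⁻ z, f z ∂(bridgeKernel g T s r t (y, x)) := hβ.mul hm1
  have hm4 : Measurable fun z => f z * ∫⁻ y, β y ∂(markovKernel g T ψ r t z) := hf.mul hm2
  rw [lintegral_markovKernel H1 _ _ _ hm3, lintegral_markovKernel H1 _ _ _ hm4]
  have hr : refMeasure T ψ r = volume := if_pos (hrt.trans_le htT)
  rw [hr]
  have hL : ∀ y, greenDensity g T (t - s) x y * harmonic g T ψ t y / harmonic g T ψ s x
        * (β y * ∫⁻ z, f z ∂(bridgeKernel g T s r t (y, x)))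
      = ∫⁻ z, greenDensity g T (r - s) x z * greenDensity g T (t - r) z y * harmonic g T ψ t y
          / harmonic g T ψ s x * β y * f z := by
    intro y
    rw [lintegral_bridgeKernel H1 _ _ _ _ hf, ← mul_assoc, ← lintegral_const_mul]
    · refine lintegral_congr fun z => ?_
      have h1 := ENNReal.mul_inv_cancel (H1.green_ne_zero hts x y) (green_ne_top _ _ _)
      rw [H1.green_symm (t - r) y z, H1.green_symm (r - s) z x, H1.green_symm (t - s) y x]
      simp only [div_eq_mul_inv]
      calc _ = (greenDensity g T (t - s) x y * (greenDensity g T (t - s) x y)⁻¹) *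
            (greenDensity g T (r - s) x z * greenDensity g T (t - r) z y * harmonic g T ψ t y
          * (harmonic g T ψ s x)⁻¹ * β y * f z) := by ring
        _ = _ := by rw [h1, one_mul]
    · exact (((H1.measurable_green_right _ _).mul (H1.measurable_green_left _ _)).div_const _).mul hf
  have hR : ∀ z, greenDensity g T (r - s) x z * harmonic g T ψ r z / harmonic g T ψ s x
        * (f z * ∫⁻ y, β y ∂(markovKernel g T ψ r t z))
      = ∫⁻ y, greenDensity g T (r - s) x z * greenDensity g T (t - r) z y * harmonic g T ψ t y
          / harmonic g T ψ s x * β y * f z ∂(refMeasure T ψ t) := by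
    intro z
    rw [lintegral_markovKernel H1 _ _ _ hβ, ← mul_assoc, ← lintegral_const_mul]
    · refine lintegral_congr fun y => ?_
      have hr' : r ∈ Icc 0 T := ⟨hs.trans hsr.le, hrt.le.trans htT⟩
      have h1 := ENNReal.mul_inv_cancel (H2.harmonic_ne_zero H1 hr' z)
        (H2.harmonic_ne_top H1 hr' z)
      simp only [div_eq_mul_inv]
      calc _ = (harmonic g T ψ r z * (harmonic g T ψ r z)⁻¹) *
            (greenDensity g T (r - s) x z * greenDensity g T (t - r) z y * harmonic g T ψ t y
          * (harmonic g T ψ s x)⁻¹ * β y * f z) := by ring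
        _ = _ := by rw [h1, one_mul]
    · exact (((H1.measurable_green_right _ _).mul (measurable_harmonic H1 t)).div_const _).mul hβ
  simp only [hL, hR]
  refine lintegral_lintegral_swap ?_
  exact (((((((H1.measurable_green_right _ x).comp measurable_snd).mul
    ((H1.measurable_green_prod (t - r)).comp measurable_swap)).mul
    ((measurable_harmonic H1 t).comp measurable_fst)).div_const _).mul
    (hβ.comp measurable_fst)).mul (hf.comp measurable_snd)).aemeasurable

/-- The bridge has mass one, so taking `f = 1` in the bridge identity integrates out the
intermediate point. -/
lemma lintegral_markovKernel_markovKernel (H1 : PotentialHypothesis V T g)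
    (H2 : DataHypothesis V T g φ ψ) [SFinite ψ] {s r t : ℝ} (hs : 0 ≤ s) (hsr : s < r) (hrt : r < t)
    (htT : t ≤ T) (x : Space N) {C : Set (Space N)} (hC : MeasurableSet C) :
    ∫⁻ z, markovKernel g T ψ r t z C ∂(markovKernel g T ψ s r x) = markovKernel g T ψ s t x C := by
  have := isMarkovKernel_bridgeKernel H1 hs hsr hrt htT
  have h := lintegral_bridge_markovKernel H1 H2 hs hsr hrt htT x (fun _ => 1) (C.indicator 1)
    measurable_const (measurable_one.indicator hC)
  simpa [lintegral_indicator_one hC] using h.symm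

/-- The law of `Z 0`. -/
def initialLaw (g : Space N → ℝ → Space N → ℝ) (T : ℝ) (φ ψ : Measure (Space N)) :
    Measure (Space N) :=
  φ.withDensity (harmonic g T ψ 0)

lemma markovianMeasure_prod (H1 : PotentialHypothesis V T g)
    [SFinite φ] [SFinite ψ] (hT : 0 < T) {C D : Set (Space N)} (hC : MeasurableSet C)
    (hD : MeasurableSet D) : markovianMeasure g T φ ψ (C ×ˢ D)
      = ∫⁻ x in C, ∫⁻ y in D, greenDensity g T T x y ∂ψ ∂φ := by
  have h : (fun p : Space N × Space N => ENNReal.ofReal (g p.1 T p.2))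
      = fun p => greenDensity g T T p.1 p.2 := by
    ext p; rw [green_of_mem ⟨hT, le_rfl⟩]
  rw [markovianMeasure, h, withDensity_apply _ (hC.prod hD), ← Measure.prod_restrict,
    lintegral_prod _ (H1.measurable_green_prod T).aemeasurable]

/-- The density `h(x, 0)` of the initial law cancels the denominator of the kernel, leaving `φ(dx)
g(x, T, y) ψ(dy)`. -/
lemma markovianMeasure_prod_eq_initialLaw (H1 : PotentialHypothesis V T g)
    (H2 : DataHypothesis V T g φ ψ)
    [SFinite φ] [SFinite ψ] (hT : 0 < T) {C D : Set (Space N)} (hC : MeasurableSet C)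
    (hD : MeasurableSet D) : markovianMeasure g T φ ψ (C ×ˢ D)
      = ∫⁻ x in C, markovKernel g T ψ 0 T x D ∂(initialLaw g T φ ψ) := by
  have hQ : Measurable fun x => markovKernel g T ψ 0 T x D := Kernel.measurable_coe _ hD
  rw [markovianMeasure_prod H1 hT hC hD, initialLaw,
    setLIntegral_withDensity_eq_setLIntegral_mul _ (measurable_harmonic H1 0) hQ hC]
  refine lintegral_congr fun x => ?_
  have h0 : (0 : ℝ) ∈ Icc 0 T := ⟨le_rfl, hT.le⟩
  rw [Pi.mul_apply, ← lintegral_indicator_one hD,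
    lintegral_markovKernel H1 _ _ _ (measurable_one.indicator hD),
    ← lintegral_const_mul, ← lintegral_indicator hD]
  · rw [refMeasure, if_neg (lt_irrefl T)]
    refine lintegral_congr fun y => ?_
    have h1 := ENNReal.mul_inv_cancel (H2.harmonic_ne_zero H1 h0 x) (H2.harmonic_ne_top H1 h0 x)
    by_cases hy : y ∈ D
    · have hT1 : harmonic g T ψ T y = 1 := if_neg (lt_irrefl T)
      simp only [hy, indicator_of_mem, Pi.one_apply, mul_one, sub_zero, hT1, div_eq_mul_inv]
      rw [mul_left_comm, h1, mul_one]
    · simp [hy]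
  · exact (((H1.measurable_green_right _ _).mul (measurable_harmonic H1 T)).div_const _).mul
      (measurable_one.indicator hD)

end Bernstein
end

/-! ### Change of time, completion, iterated integrals and conditional probabilities. -/

noncomputable section

namespace MarkovProcess
open ProbabilityTheory

universe u

variable {ι κ Ω Ω' E S : Type*} [MeasurableSpace E] [MeasurableSpace S]

lemma biInter_mem_cylinders {Z : ι → Ω → E} {J : Set ι} (F : Finset κ) {A : κ → Set Ω}
    (h : ∀ k ∈ F, A k ∈ cylinders Z J) : ⋂ k ∈ F, A k ∈ cylinders Z J := by
  classical
  induction F using Finset.induction_on with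
  | empty => simpa using univ_mem_cylinders
  | insert a F _ ih =>
    rw [Finset.set_biInter_insert]
    exact inter_mem_cylinders (h a (Finset.mem_insert_self _ _))
      (ih fun k hk => h k (Finset.mem_insert_of_mem hk))

lemma exists_eq_inter_of_mem_cylinders_union {Z : ι → Ω → E} {J K : Set ι} {A : Set Ω}
    (hA : A ∈ cylinders Z (J ∪ K)) :
    ∃ B ∈ cylinders Z J, ∃ C ∈ cylinders Z K, A = B ∩ C := by
  classical
  obtain ⟨F, f, hF, hf, rfl⟩ := mem_cylinders_iff.1 hA
  refine ⟨⋂ j ∈ F.filter (· ∈ J), Z j ⁻¹' f j, biInter_mem_cylinders _ fun j hj =>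
      preimage_mem_cylinders (Finset.mem_filter.1 hj).2 (hf j),
    ⋂ j ∈ F.filter (· ∉ J), Z j ⁻¹' f j, biInter_mem_cylinders _ fun j hj =>
      preimage_mem_cylinders ?_ (hf j), ?_⟩
  · exact (hF (Finset.mem_filter.1 hj).1).resolve_left (Finset.mem_filter.1 hj).2
  · ext ω
    simp only [mem_iInter, mem_preimage, Set.mem_inter_iff, Finset.mem_filter]
    exact ⟨fun h => ⟨fun i hi => h i hi.1, fun i hi => h i hi.1⟩, fun h i hi =>
      (em (i ∈ J)).elim (fun hJ => h.1 i ⟨hi, hJ⟩) fun hJ => h.2 i ⟨hi, hJ⟩⟩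

/-- The Markov property is stable under changes of time and of probability space. -/
lemma IsMarkovOn.comp [LinearOrder ι] [LinearOrder κ] [MeasurableSpace Ω] [MeasurableSpace Ω']
    {Q : ι → ι → Kernel E E} {J : Set ι} {Z : ι → Ω → E} {P : Measure Ω'} {h : Ω' → Ω}
    (hh : Measurable h) (hM : IsMarkovOn Q J (P.map h) Z) (hZ : ∀ i ∈ J, Measurable (Z i))
    {K : Set κ} {f : κ → ι} (hf : StrictMonoOn f K) (hfK : MapsTo f K J)
    {Q' : κ → κ → Kernel E E} (hQ : ∀ s ∈ K, ∀ t ∈ K, Q' s t = Q (f s) (f t)) :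
    IsMarkovOn Q' K P fun i ω => Z (f i) (h ω) := by
  intro s hs t ht hst A hA C hC
  obtain ⟨F, B, hF, hB, rfl⟩ := mem_cylinders_iff.1 hA
  have hA' : (⋂ j ∈ F, Z (f j) ⁻¹' B j) ∈ cylinders Z (J ∩ Iic (f s)) :=
    biInter_mem_cylinders F fun j hj => preimage_mem_cylinders (J := J ∩ Iic (f s))
      ⟨hfK (hF hj).1, hf.monotoneOn (hF hj).1 hs (hF hj).2⟩ (hB j)
  have hm := measurableSet_of_mem_cylinders (fun i hi => hZ i hi.1) hA'
  have hpre : ⋂ j ∈ F, (fun ω => Z (f j) (h ω)) ⁻¹' B j = h ⁻¹' ⋂ j ∈ F, Z (f j) ⁻¹' B j := by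
    ext ω; simp
  have key := hM (f s) (hfK hs) (f t) (hfK ht) (hf hs ht hst) _ hA' C hC
  have hmQ : Measurable fun ω => Q (f s) (f t) (Z (f s) ω) C :=
    (Kernel.measurable_coe _ hC).comp (hZ _ (hfK hs))
  rw [Measure.map_apply hh (hm.inter (hZ _ (hfK ht) hC)), setLIntegral_map hm hmQ hh] at key
  rw [hpre, hQ s hs t ht, ← key]
  rfl

/-- The completion of `P` lives on the same set with more measurable sets, and the identity map
carries it back to `P`. -/
lemma exists_isComplete_map_eq {Ω : Type u} [MeasurableSpace Ω] (P : Measure Ω) :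
    ∃ (Ω' : Type u) (_ : MeasurableSpace Ω') (P' : Measure Ω') (h : Ω' → Ω), P'.IsComplete ∧
      Measurable h ∧ P'.map h = P := by
  have hid : @Measurable (NullMeasurableSpace Ω P) Ω _ _ (fun ω => ω) :=
    fun s hs => (MeasurableSet.nullMeasurableSet hs : NullMeasurableSet s P)
  refine ⟨NullMeasurableSpace Ω P, _, P.completion, fun ω => ω, inferInstance, hid, ?_⟩
  ext s hs
  exact Measure.map_apply hid hs

lemma lintegral_snoc {X : Type*} [MeasureSpace X] [SigmaFinite (volume : Measure X)] {n : ℕ}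
    (E : Fin (n + 1) → Set X) {F : (Fin (n + 1) → X) → ℝ≥0∞}
    (hF : Measurable F) :
    ∫⁻ x in Set.pi univ E, F x
      = ∫⁻ x in Set.pi univ (fun k : Fin n => E k.castSucc), ∫⁻ y in E (Fin.last n),
          F (Fin.snoc x y) := by
  have h := (volume_preserving_piFinSuccAbove (fun _ : Fin (n + 1) => X) (Fin.last n)).symm
  have hpre : (MeasurableEquiv.piFinSuccAbove (fun _ : Fin (n + 1) => X) (Fin.last n)).symm ⁻¹'
      (Set.pi univ E) = E (Fin.last n) ×ˢ Set.pi univ fun k : Fin n => E k.castSucc := by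
    ext p
    simp [MeasurableEquiv.piFinSuccAbove, Set.mem_pi, Fin.forall_fin_succ', and_comm]
  rw [← h.setLIntegral_comp_preimage_emb (MeasurableEquiv.measurableEmbedding _), hpre,
    Measure.volume_eq_prod, ← Measure.prod_restrict, lintegral_prod_symm]
  · refine lintegral_congr fun x => lintegral_congr fun y => ?_
    simp only [MeasurableEquiv.piFinSuccAbove]
    exact congrArg F (Fin.insertNth_last' y x)
  · exact (hF.comp (MeasurableEquiv.measurable _)).aemeasurable

/-- Converts a real-valued conditional expectation into the extended nonnegative form in which
bridges and Markov kernels are handled. -/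
lemma measure_inter_preimage_of_condExp {m m0 : MeasurableSpace Ω} {P : Measure[m0] Ω}
    [IsFiniteMeasure P] (hm : m ≤ m0) {X : Ω → E} {Y : Ω → S} (hX : Measurable[m0] X)
    (hY : Measurable[m0] Y) {b : Kernel S E} [IsMarkovKernel b] {C : Set E}
    (hC : MeasurableSet C)
    (h : P[(X ⁻¹' C).indicator (fun _ => (1 : ℝ)) | m] =ᵐ[P] fun ω => (b (Y ω)).real C)
    {A : Set Ω} (hA : MeasurableSet[m] A) :
    P (A ∩ X ⁻¹' C) = ∫⁻ ω in A, b (Y ω) C ∂P := by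
  have hint : Integrable ((X ⁻¹' C).indicator fun _ => (1 : ℝ)) P :=
    (integrable_const 1).indicator (hX hC)
  have h1 := setIntegral_condExp hm hint hA
  have hb : Measurable fun ω => b (Y ω) C := (b.measurable_coe hC).comp hY
  rw [setIntegral_congr_ae (hm A hA) (h.mono fun ω hω _ => hω), setIntegral_indicator (hX hC),
    setIntegral_const, smul_eq_mul, mul_one] at h1
  simp only [Measure.real] at h1
  rw [integral_toReal hb.aemeasurable (ae_of_all _ fun ω => measure_lt_top _ _)] at h1
  refine ((ENNReal.toReal_eq_toReal_iff' ?_ (measure_ne_top _ _)).1 h1).symm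
  refine ((lintegral_mono fun ω => prob_le_one).trans_lt ?_).ne (b := ∞)
  simp

end MarkovProcess
end

/-! ### Existence of the Bernstein process. -/

noncomputable section

namespace Bernstein
open ProbabilityTheory MarkovProcess

variable {N : ℕ} {V : Space N → ℝ} {T : ℝ} {g : Space N → ℝ → Space N → ℝ}
  {φ ψ : Measure (Space N)}

lemma bridgeKernel_real (H1 : PotentialHypothesis V T g) {s r t : ℝ} (hs : 0 ≤ s) (hsr : s < r)
    (hrt : r < t) (htT : t ≤ T) (x y : Space N) {E : Set (Space N)} (hE : MeasurableSet E) :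
    (bridgeKernel g T s r t (x, y)).real E = transitionFunction g x t E r y s := by
  have htr : t - r ∈ Ioc 0 T := ⟨by linarith, by linarith⟩
  have hrs : r - s ∈ Ioc 0 T := ⟨by linarith, by linarith⟩
  have hts : t - s ∈ Ioc 0 T := ⟨by linarith, by linarith⟩
  have hm : Measurable fun z => greenDensity g T (t - r) x z * greenDensity g T (r - s) z y
      / greenDensity g T (t - s) x y :=
    ((H1.measurable_green_right _ _).mul (H1.measurable_green_left _ _)).div_const _
  have hdens : ∀ z, bernsteinDensity g x t z r y s = (greenDensity g T (t - r) x z *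
      greenDensity g T (r - s) z y / greenDensity g T (t - s) x y).toReal := by
    intro z
    rw [green_of_mem htr, green_of_mem hrs, green_of_mem hts, ENNReal.toReal_div,
      ENNReal.toReal_mul, ENNReal.toReal_ofReal (H1.green.nonneg _ _ htr _),
      ENNReal.toReal_ofReal (H1.green.nonneg _ _ hrs _),
      ENNReal.toReal_ofReal (H1.green.nonneg _ _ hts _), bernsteinDensity]
  simp only [transitionFunction, hdens]
  rw [integral_toReal hm.aemeasurable, Measure.real, ← lintegral_indicator_one hE,
    lintegral_bridgeKernel H1 _ _ _ _ (measurable_one.indicator hE), ← lintegral_indicator hE]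
  · congr 1
    refine lintegral_congr fun z => ?_
    by_cases hz : z ∈ E <;> simp [hz]
  · exact ae_of_all _ fun z => ENNReal.div_lt_top
      (ENNReal.mul_ne_top (green_ne_top _ _ _) (green_ne_top _ _ _)) (H1.green_ne_zero hts _ _)

lemma isProbabilityMeasure_initialLaw (H1 : PotentialHypothesis V T g)
    (H2 : DataHypothesis V T g φ ψ) [SFinite φ] [SFinite ψ] (hT : 0 < T)
    (hμ : markovianMeasure g T φ ψ univ = 1) : IsProbabilityMeasure (initialLaw g T φ ψ) := by
  have := isMarkovKernel_markovKernel H1 H2 le_rfl hT le_rfl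
  have h := markovianMeasure_prod_eq_initialLaw H1 H2 hT MeasurableSet.univ MeasurableSet.univ
  rw [univ_prod_univ, hμ] at h
  exact ⟨by simpa using h.symm⟩

section Realization

variable {Ω : Type*} [mΩ : MeasurableSpace Ω] {P : Measure Ω} {Z : ℝ → Ω → Space N}

/-- Conditionally on the values up to time `s` and after time `t`, the law at time `r` is given by
the bridge kernel. -/
lemma condExp_bridgeKernel [IsProbabilityMeasure P] (H1 : PotentialHypothesis V T g)
    (H2 : DataHypothesis V T g φ ψ) [SFinite ψ] (hZ : ∀ τ ∈ Icc 0 T, Measurable (Z τ))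
    (hM : IsMarkovOn (markovKernel g T ψ) (Icc 0 T) P Z) {s r t : ℝ} (hs : 0 ≤ s) (hsr : s < r)
    (hrt : r < t) (htT : t ≤ T) {J K : Set ℝ} (hJ : J ⊆ Icc 0 s) (hK : K ⊆ Icc t T)
    (hsJ : s ∈ J) (htK : t ∈ K) {f : Space N → ℝ} (hf : Measurable f)
    (hbdd : ∃ C, ∀ x, |f x| ≤ C) :
    P[fun ω => f (Z r ω) | (⨆ i ∈ J, MeasurableSpace.comap (Z i) inferInstance) ⊔
        ⨆ i ∈ K, MeasurableSpace.comap (Z i) inferInstance]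
      =ᵐ[P] fun ω => ∫ z, f z ∂(bridgeKernel g T s r t (Z t ω, Z s ω)) := by
  have hsI : s ∈ Icc 0 T := ⟨hs, by linarith⟩
  have hrI : r ∈ Icc 0 T := ⟨by linarith, by linarith⟩
  have htI : t ∈ Icc 0 T := ⟨by linarith, htT⟩
  have := isMarkovKernel_bridgeKernel H1 hs hsr hrt htT
  have := isMarkovKernel_markovKernel H1 H2 hs (hsr.trans hrt) htT
  have hgen : (⨆ i ∈ J, MeasurableSpace.comap (Z i) inferInstance) ⊔
        (⨆ i ∈ K, MeasurableSpace.comap (Z i) inferInstance)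
      = MeasurableSpace.generateFrom (cylinders Z (J ∪ K)) := by
    rw [generateFrom_cylinders, iSup_union]
  have hJI : J ⊆ Icc 0 T ∩ Iic s := fun j hj => ⟨⟨(hJ hj).1, (hJ hj).2.trans hsI.2⟩, (hJ hj).2⟩
  have hKI : K ⊆ Icc 0 T ∩ Ici t := fun j hj => ⟨⟨htI.1.trans (hK hj).1, (hK hj).2⟩, (hK hj).1⟩
  have hm : ∀ i ∈ J ∪ K, Measurable (Z i) := fun i hi =>
    hZ i (hi.elim (fun h => (hJI h).1) fun h => (hKI h).1)
  have hle : (⨆ i ∈ J, MeasurableSpace.comap (Z i) inferInstance) ⊔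
        (⨆ i ∈ K, MeasurableSpace.comap (Z i) inferInstance) ≤ mΩ := by
    rw [← iSup_union]
    exact iSup₂_le fun i hi => (hm i hi).comap_le
  refine condExp_comp_ae_eq_integral hle isPiSystem_cylinders hgen univ_mem_cylinders (hZ r hrI)
    (Y := fun ω => (Z t ω, Z s ω)) ?_ ?_ hf hbdd
  · rw [← iSup_union]
    have : ∀ i ∈ J ∪ K,
        Measurable[⨆ i ∈ J ∪ K, MeasurableSpace.comap (Z i) inferInstance] (Z i) := fun i hi =>
      measurable_iff_comap_le.2 (le_iSup₂_of_le i hi le_rfl)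
    exact (this t (Or.inr htK)).prodMk (this s (Or.inl hsJ))
  · intro A hA C hC
    obtain ⟨A', hA', B', hB', rfl⟩ := exists_eq_inter_of_mem_cylinders_union hA
    exact hM.measure_inter_inter_preimage hZ hsI hrI htI hsr hrt
      (fun x f β => lintegral_bridge_markovKernel H1 H2 hs hsr hrt htT x f β)
      (cylinders_mono hJI hA') (cylinders_mono hKI hB') hC

/-- Conditionally on the values up to time `s`, the law at time `t` is given by the Markov
kernel. -/
lemma condExp_markovKernel [IsProbabilityMeasure P] (H1 : PotentialHypothesis V T g)
    (H2 : DataHypothesis V T g φ ψ) [SFinite ψ] (hZ : ∀ τ ∈ Icc 0 T, Measurable (Z τ))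
    (hM : IsMarkovOn (markovKernel g T ψ) (Icc 0 T) P Z) {s t : ℝ} (hs : 0 ≤ s) (hst : s < t)
    (htT : t ≤ T) {J : Set ℝ} (hJ : J ⊆ Icc 0 s) (hsJ : s ∈ J) {f : Space N → ℝ}
    (hf : Measurable f) (hbdd : ∃ C, ∀ x, |f x| ≤ C) :
    P[fun ω => f (Z t ω) | ⨆ i ∈ J, MeasurableSpace.comap (Z i) inferInstance]
      =ᵐ[P] fun ω => ∫ z, f z ∂(markovKernel g T ψ s t (Z s ω)) := by
  have hsI : s ∈ Icc 0 T := ⟨hs, by linarith⟩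
  have htI : t ∈ Icc 0 T := ⟨by linarith, htT⟩
  have := isMarkovKernel_markovKernel H1 H2 hs hst htT
  have hJI : J ⊆ Icc 0 T ∩ Iic s := fun j hj => ⟨⟨(hJ hj).1, (hJ hj).2.trans hsI.2⟩, (hJ hj).2⟩
  refine condExp_comp_ae_eq_integral (iSup₂_le fun i hi => (hZ i (hJI hi).1).comap_le)
    isPiSystem_cylinders generateFrom_cylinders.symm univ_mem_cylinders (hZ t htI)
    (measurable_iff_comap_le.2 (le_iSup₂_of_le s hsJ le_rfl)) ?_ hf hbdd
  exact fun A hA C hC => hM s hsI t htI hst A (cylinders_mono hJI hA) C hC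

/-- Conditioning on the whole past and conditioning on `Z s` alone both yield the same kernel
integral, a function of `Z s`. -/
lemma isMarkovProcess_of_isMarkovOn [IsProbabilityMeasure P] (H1 : PotentialHypothesis V T g)
    (H2 : DataHypothesis V T g φ ψ) [SFinite ψ] (hZ : ∀ τ ∈ Icc 0 T, Measurable (Z τ))
    (hM : IsMarkovOn (markovKernel g T ψ) (Icc 0 T) P Z) : IsMarkovProcess T P Z := by
  intro f hf hbdd s t hs hst htT
  have h1 := condExp_markovKernel H1 H2 hZ hM hs hst htT subset_rfl (right_mem_Icc.2 hs) hf hbdd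
  have h2 := condExp_markovKernel H1 H2 hZ hM hs hst htT
    (singleton_subset_iff.2 (right_mem_Icc.2 hs)) (mem_singleton s) hf hbdd
  rw [iSup_singleton] at h2
  exact h1.trans h2.symm

lemma isBernsteinProcessOf_of_isMarkovOn [IsProbabilityMeasure P] (hP : P.IsComplete)
    (H1 : PotentialHypothesis V T g) (H2 : DataHypothesis V T g φ ψ) [SFinite φ] [SFinite ψ]
    (hT : 0 < T) (hZ : ∀ τ ∈ Icc 0 T, Measurable (Z τ))
    (hM : IsMarkovOn (markovKernel g T ψ) (Icc 0 T) P Z)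
    (h0 : P.map (Z 0) = initialLaw g T φ ψ) :
    IsBernsteinProcessOf g T (markovianMeasure g T φ ψ) P Z := by
  have h0I : (0 : ℝ) ∈ Icc 0 T := ⟨le_rfl, hT.le⟩
  have hTI : T ∈ Icc 0 T := ⟨hT.le, le_rfl⟩
  -- The case of singletons: given only `Z s` and `Z t`, the bridge kernel already gives the law at
  -- time `r`. The Bernstein property compares this with the full past and future.
  have hpair : ∀ {f : Space N → ℝ}, Measurable f → (∃ C, ∀ x, |f x| ≤ C) → ∀ {s r t : ℝ}, 0 ≤ s →
      s < r → r < t → t ≤ T → P[fun ω => f (Z r ω) | timeAlgebra Z s ⊔ timeAlgebra Z t]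
        =ᵐ[P] fun ω => ∫ z, f z ∂(bridgeKernel g T s r t (Z t ω, Z s ω)) := by
    intro f hf hbdd s r t hs hsr hrt htT
    have h := condExp_bridgeKernel H1 H2 hZ hM hs hsr hrt htT
      (singleton_subset_iff.2 (right_mem_Icc.2 hs)) (singleton_subset_iff.2 (left_mem_Icc.2 htT))
      (mem_singleton s) (mem_singleton t) hf hbdd
    rwa [iSup_singleton, iSup_singleton] at h
  refine ⟨⟨inferInstance, hP, hZ, fun f hf hbdd s r t hs hsr hrt htT => ?_⟩,
    fun E hE s r t hs hsr hrt htT => ?_, ?_⟩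
  · exact (condExp_bridgeKernel H1 H2 hZ hM hs hsr hrt htT subset_rfl subset_rfl
      (right_mem_Icc.2 hs) (left_mem_Icc.2 htT) hf hbdd).trans (hpair hf hbdd hs hsr hrt htT).symm
  · have h := hpair (f := E.indicator 1) (measurable_one.indicator hE)
      ⟨1, fun x => by by_cases hx : x ∈ E <;> simp [hx]⟩ hs hsr hrt htT
    refine (Eq.eventuallyEq ?_).trans (h.trans (Eq.eventuallyEq ?_))
    · rfl
    · ext ω
      rw [integral_indicator_one hE, bridgeKernel_real H1 hs hsr hrt htT _ _ hE]
  · refine Measure.ext_prod fun {C D} hC hD => ?_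
    have hQ : Measurable fun x => markovKernel g T ψ 0 T x D := Kernel.measurable_coe _ hD
    rw [Measure.map_apply ((hZ 0 h0I).prodMk (hZ T hTI)) (hC.prod hD),
      markovianMeasure_prod_eq_initialLaw H1 H2 hT hC hD, ← h0, setLIntegral_map hC hQ (hZ 0 h0I),
      ← hM 0 h0I T hTI hT _ (preimage_mem_cylinders (J := Icc 0 T ∩ Iic 0) ⟨h0I, le_refl (0 :
          ℝ)⟩ hC) D hD]
    rfl

end Realization

/-- Existence of the Bernstein process on the completion of a space of paths. -/
theorem exists_isBernsteinProcessOf (H1 : PotentialHypothesis V T g) (H2 : DataHypothesis V T g φ ψ)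
    [SFinite φ] [SFinite ψ] (hT : 0 < T) (hμ : markovianMeasure g T φ ψ univ = 1) :
    ∃ (Ω : Type) (_ : MeasurableSpace Ω) (P : Measure Ω) (Z : ℝ → Ω → Space N),
      IsBernsteinProcessOf g T (markovianMeasure g T φ ψ) P Z := by
  have : Fact ((0 : ℝ) ≤ T) := ⟨hT.le⟩
  have := isProbabilityMeasure_initialLaw H1 H2 hT hμ
  obtain ⟨P, hP, hP0, hM⟩ := exists_isMarkovOn_univ (ι := Icc (0 : ℝ) T)
    (Q := fun s t => markovKernel g T ψ s t)
    (fun s t hst => isMarkovKernel_markovKernel H1 H2 s.2.1 hst t.2.2)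
    (fun r s t hrs hst x C hC =>
      lintegral_markovKernel_markovKernel H1 H2 r.2.1 hrs hst t.2.2 x hC) (initialLaw g T φ ψ)
  obtain ⟨Ω, _, P', h, hP', hh, hmap⟩ := exists_isComplete_map_eq P
  have hprob : IsProbabilityMeasure P' := ⟨by
    have h1 := measure_univ (μ := P)
    rwa [← hmap, Measure.map_apply hh MeasurableSet.univ] at h1⟩
  -- The process is built on the time set `[0, T]` and extended to real times by projecting onto
  -- that interval.
  have hZ : ∀ τ : ℝ, Measurable fun ω => h ω (projIcc 0 T hT.le τ) :=
    fun τ => (measurable_pi_apply (projIcc 0 T hT.le τ)).comp hh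
  refine ⟨Ω, _, P', fun τ ω => h ω (projIcc 0 T hT.le τ),
    isBernsteinProcessOf_of_isMarkovOn hP' H1 H2 hT (fun τ _ => hZ τ) ?_ ?_⟩
  · refine IsMarkovOn.comp (Q := fun s t : Icc (0 : ℝ) T => markovKernel g T ψ s t) (J := univ)
      (Z := fun (i : Icc (0 : ℝ) T) (ω : Icc (0 : ℝ) T → Space N) => ω i) hh (hmap.symm ▸ hM)
      (fun i _ => measurable_pi_apply i)
      (strictMonoOn_projIcc hT.le) (mapsTo_univ _ _) fun s hs t ht => ?_
    rw [projIcc_of_mem hT.le hs, projIcc_of_mem hT.le ht]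
  · have h1 := Measure.map_map (μ := P') (measurable_pi_apply (⊥ : Icc (0 : ℝ) T)) hh
    rw [hmap, hP0] at h1
    rw [h1, projIcc_left]
    rfl

end Bernstein
end

/-! ### Markov property and laws of an arbitrary realization. -/

noncomputable section

namespace Bernstein
open ProbabilityTheory MarkovProcess

variable {N : ℕ} {V : Space N → ℝ} {T : ℝ} {g : Space N → ℝ → Space N → ℝ}
  {φ ψ : Measure (Space N)} {Ω : Type*} [mΩ : MeasurableSpace Ω] {P : Measure Ω}
  {Z : ℝ → Ω → Space N}

/-! ### Every realization is Markov -/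

namespace IsBernsteinProcessOf

lemma measure_inter_preimage (hB : IsBernsteinProcessOf g T (markovianMeasure g T φ ψ) P Z)
    (hT : 0 < T) {C D : Set (Space N)} (hC : MeasurableSet C) (hD : MeasurableSet D) :
    P (Z 0 ⁻¹' C ∩ Z T ⁻¹' D) = markovianMeasure g T φ ψ (C ×ˢ D) := by
  have hZ := hB.isBernstein.measurable
  rw [← hB.endpoints, Measure.map_apply
    ((hZ 0 ⟨le_rfl, hT.le⟩).prodMk (hZ T ⟨hT.le, le_rfl⟩)) (hC.prod hD)]
  rfl

lemma map_zero (hB : IsBernsteinProcessOf g T (markovianMeasure g T φ ψ) P Z)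
    (H1 : PotentialHypothesis V T g) (H2 : DataHypothesis V T g φ ψ) [SFinite φ] [SFinite ψ]
    (hT : 0 < T) : P.map (Z 0) = initialLaw g T φ ψ := by
  have := isMarkovKernel_markovKernel H1 H2 le_rfl hT le_rfl
  ext C hC
  have h := hB.measure_inter_preimage hT hC MeasurableSet.univ
  rw [markovianMeasure_prod_eq_initialLaw H1 H2 hT hC MeasurableSet.univ] at h
  rw [Measure.map_apply (hB.isBernstein.measurable 0 ⟨le_rfl, hT.le⟩) hC]
  simpa using h

/-- The Bernstein property with `t = T` reduces conditioning on the past up to `s` and on `Z T` to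
conditioning on the pair `(Z s, Z T)`, for which the transition function is prescribed. -/
lemma measure_inter_inter_preimage
    (hB : IsBernsteinProcessOf g T (markovianMeasure g T φ ψ) P Z)
    (H1 : PotentialHypothesis V T g) {s r : ℝ} (hs : 0 ≤ s) (hsr : s < r) (hrT : r < T)
    {A : Set Ω} (hA : A ∈ cylinders Z (Icc 0 T ∩ Iic s)) {C D : Set (Space N)}
    (hC : MeasurableSet C) (hD : MeasurableSet D) :
    P (A ∩ Z T ⁻¹' D ∩ Z r ⁻¹' C)
      = ∫⁻ ω in A ∩ Z T ⁻¹' D, bridgeKernel g T s r T (Z T ω, Z s ω) C ∂P := by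
  have hP := hB.isBernstein.probability
  have hZ := hB.isBernstein.measurable
  have := isMarkovKernel_bridgeKernel H1 hs hsr hrT le_rfl
  have hTI : T ∈ Icc 0 T := ⟨by linarith, le_rfl⟩
  have hle : pastAlgebra Z s ⊔ futureAlgebra T Z T ≤ mΩ :=
    sup_le (iSup₂_le fun i hi => (hZ i ⟨hi.1, by linarith [hi.2]⟩).comap_le)
      (iSup₂_le fun i hi => (hZ i ⟨by linarith [hi.1], hi.2⟩).comap_le)
  refine measure_inter_preimage_of_condExp hle (hZ r ⟨by linarith, hrT.le⟩)
    (Y := fun ω => (Z T ω, Z s ω)) ((hZ T hTI).prodMk (hZ s ⟨hs, by linarith⟩)) hC ?_ ?_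
  · have h1 := hB.isBernstein.bernstein (C.indicator 1) (measurable_one.indicator hC)
      ⟨1, fun x => by by_cases hx : x ∈ C <;> simp [hx]⟩ s r T hs hsr hrT le_rfl
    refine (Eq.eventuallyEq ?_).trans (h1.trans ((Eq.eventuallyEq ?_).trans
      ((hB.transition C hC s r T hs hsr hrT le_rfl).trans (Eq.eventuallyEq ?_))))
    · rfl
    · rfl
    · ext ω
      rw [bridgeKernel_real H1 hs hsr hrT le_rfl _ _ hC]
  · refine MeasurableSet.inter ?_ ?_
    · refine (le_sup_left : pastAlgebra Z s ≤ _) _ ?_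
      rw [pastAlgebra, ← generateFrom_cylinders]
      exact MeasurableSpace.measurableSet_generateFrom
        (cylinders_mono (K := Icc 0 s) (fun i hi => ⟨hi.1.1, hi.2⟩) hA)
    · refine (le_sup_right : futureAlgebra T Z T ≤ _) _ ?_
      exact (le_iSup₂_of_le T (left_mem_Icc.2 le_rfl) le_rfl :
        MeasurableSpace.comap (Z T) inferInstance ≤ _) _ ⟨D, hD, rfl⟩

theorem isMarkovOn (hB : IsBernsteinProcessOf g T (markovianMeasure g T φ ψ) P Z)
    (H1 : PotentialHypothesis V T g) (H2 : DataHypothesis V T g φ ψ) [SFinite φ] [SFinite ψ]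
    (hT : 0 < T) : IsMarkovOn (markovKernel g T ψ) (Icc 0 T) P Z := by
  have hP := hB.isBernstein.probability
  have h0I : (0 : ℝ) ∈ Icc 0 T := ⟨le_rfl, hT.le⟩
  refine isMarkovOn_of_bridge h0I ⟨hT.le, le_rfl⟩ (fun j hj => hj.1) (fun j hj => hj.2) hT
    (fun s hs t ht hst => isMarkovKernel_markovKernel H1 H2 hs.1 hst ht.2) hB.isBernstein.measurable
    (b := fun s r => bridgeKernel g T s r T) (fun C hC D hD => ?_)
    (fun s hs r _ hsr hrT A hA D hD C hC =>
      hB.measure_inter_inter_preimage H1 hs.1 hsr hrT hA hC hD)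
    (fun s hs r _ hsr hrT x f β => lintegral_bridge_markovKernel H1 H2 hs.1 hsr hrT le_rfl x f β)
  have hQ : Measurable fun x => markovKernel g T ψ 0 T x D := Kernel.measurable_coe _ hD
  rw [hB.measure_inter_preimage hT hC hD, markovianMeasure_prod_eq_initialLaw H1 H2 hT hC hD,
    ← hB.map_zero H1 H2 hT, setLIntegral_map hC hQ (hB.isBernstein.measurable 0 h0I)]

end IsBernsteinProcessOf

/-! ### Finite-dimensional laws -/

/-- The part of the density of the law at the times `t 0 < ... < t m` which depends on the
initial measure. -/
def forwardDensity (g : Space N → ℝ → Space N → ℝ) (T : ℝ) (φ : Measure (Space N)) {m : ℕ}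
    (t : Fin (m + 1) → ℝ) (x : Fin (m + 1) → Space N) : ℝ≥0∞ :=
  (∏ k : Fin m, greenDensity g T (t k.succ - t k.castSucc) (x k.succ) (x k.castSucc)) *
    ∫⁻ y, greenDensity g T (t 0) (x 0) y ∂φ

lemma measurable_forwardDensity (H1 : PotentialHypothesis V T g) [SFinite φ] {m : ℕ}
    (t : Fin (m + 1) → ℝ) : Measurable (forwardDensity g T φ t) := by
  have he : ∀ k, Measurable fun x : Fin (m + 1) → Space N => x k := measurable_pi_apply
  refine (Finset.measurable_prod _ fun k _ => ?_).mul ?_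
  · exact (H1.measurable_green_prod _).comp ((he k.succ).prodMk (he k.castSucc))
  · exact ((H1.measurable_green_prod (t 0)).lintegral_prod_right' (ν := φ)).comp (he 0)

lemma forwardDensity_snoc (H1 : PotentialHypothesis V T g) {m : ℕ} (t : Fin (m + 2) → ℝ)
    (x : Fin (m + 1) → Space N) (y : Space N) :
    forwardDensity g T φ t (Fin.snoc x y)
      = forwardDensity g T φ (fun k => t k.castSucc) x * greenDensity g T
        (t (Fin.last (m + 1)) - t (Fin.last m).castSucc) (x (Fin.last m)) y := by
  have h0 : (Fin.snoc x y : Fin (m + 2) → Space N) 0 = x 0 := by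
    rw [← Fin.castSucc_zero, Fin.snoc_castSucc]
  simp only [forwardDensity, Fin.prod_univ_castSucc, Fin.snoc_castSucc, Fin.succ_last,
      Fin.snoc_last,
    Fin.succ_castSucc, h0, Fin.castSucc_zero]
  rw [H1.green_symm _ y]
  ring

/-- The weight `h(y, 0)` of the initial law cancels the denominator of the kernel from time `0`, so
that integrating over `y` leaves `u_φ`. -/
lemma setLIntegral_eq_of_isMarkovOn (H1 : PotentialHypothesis V T g)
    (H2 : DataHypothesis V T g φ ψ) [SFinite φ] [SFinite ψ]
    (hZ : ∀ τ ∈ Icc 0 T, Measurable (Z τ)) (hM : IsMarkovOn (markovKernel g T ψ) (Icc 0 T) P Z)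
    (h0 : P.map (Z 0) = initialLaw g T φ ψ) {t : ℝ} (ht : t ∈ Ioo 0 T) {E : Set (Space N)}
    (hE : MeasurableSet E) {f : Space N → ℝ≥0∞} (hf : Measurable f) :
    ∫⁻ ω in Z t ⁻¹' E, f (Z t ω) ∂P
      = ∫⁻ x in E, (∫⁻ y, greenDensity g T t x y ∂φ) * harmonic g T ψ t x * f x := by
  have htI : t ∈ Icc 0 T := ⟨ht.1.le, ht.2.le⟩
  have h0I : (0 : ℝ) ∈ Icc 0 T := ⟨le_rfl, htI.1.trans htI.2⟩
  have hEf : Measurable (E.indicator f) := hf.indicator hE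
  have hQ : Measurable fun x => ∫⁻ y, E.indicator f y ∂(markovKernel g T ψ 0 t x) := by
    have := isMarkovKernel_markovKernel H1 H2 le_rfl ht.1 ht.2.le
    exact hEf.lintegral_kernel
  have h1 := hM.setLIntegral hZ h0I htI ht.1 univ_mem_cylinders hEf
  rw [setLIntegral_univ, setLIntegral_univ, ← lintegral_map hQ (hZ 0 h0I), h0, initialLaw,
    lintegral_withDensity_eq_lintegral_mul _ (measurable_harmonic H1 0) hQ] at h1
  rw [← lintegral_indicator (hZ t htI hE)]
  refine Eq.trans (lintegral_congr fun ω => ?_) (h1.trans ?_)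
  · rfl
  have h2 : ∀ y, harmonic g T ψ 0 y * ∫⁻ x, E.indicator f x ∂(markovKernel g T ψ 0 t y)
      = ∫⁻ x in E, greenDensity g T t x y * harmonic g T ψ t x * f x := by
    intro y
    have h3 := ENNReal.mul_inv_cancel (H2.harmonic_ne_zero H1 h0I y) (H2.harmonic_ne_top H1 h0I y)
    rw [lintegral_markovKernel H1 _ _ _ hEf, ← lintegral_const_mul, refMeasure, if_pos ht.2,
      ← lintegral_indicator hE]
    · refine lintegral_congr fun x => ?_
      by_cases hx : x ∈ E
      · simp only [hx, indicator_of_mem, div_eq_mul_inv, sub_zero]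
        rw [H1.green_symm t y x]
        calc _ = (harmonic g T ψ 0 y * (harmonic g T ψ 0 y)⁻¹) *
              (greenDensity g T t x y * harmonic g T ψ t x * f x) := by ring
          _ = _ := by rw [h3, one_mul]
      · simp [hx]
    · exact (((H1.measurable_green_right _ _).mul (measurable_harmonic H1 t)).div_const _).mul hEf
  simp only [Pi.mul_apply, h2]
  rw [lintegral_lintegral_swap]
  · refine lintegral_congr fun x => ?_
    simp only [mul_assoc]
    rw [lintegral_mul_const _ (H1.measurable_green_right _ _)]
  · exact (((H1.measurable_green_prod t).comp measurable_swap).mul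
      ((measurable_harmonic H1 t).comp measurable_snd)).mul (hf.comp measurable_snd) |>.aemeasurable

/-- The test function `f` at the last time carries the induction on the number of times: one
transition is absorbed into `f`, and its denominator cancels the factor `h` at the previous time. -/
lemma setLIntegral_iInter_eq_of_isMarkovOn (H1 : PotentialHypothesis V T g)
    (H2 : DataHypothesis V T g φ ψ) [SFinite φ] [SFinite ψ]
    (hZ : ∀ τ ∈ Icc 0 T, Measurable (Z τ)) (hM : IsMarkovOn (markovKernel g T ψ) (Icc 0 T) P Z)
    (h0 : P.map (Z 0) = initialLaw g T φ ψ) {m : ℕ} {t : Fin (m + 1) → ℝ}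
    {E : Fin (m + 1) → Set (Space N)} (ht : StrictMono t) (htT : ∀ k, t k ∈ Ioo 0 T)
    (hE : ∀ k, MeasurableSet (E k)) {f : Space N → ℝ≥0∞} (hf : Measurable f) :
    ∫⁻ ω in ⋂ k, Z (t k) ⁻¹' E k, f (Z (t (Fin.last m)) ω) ∂P
      = ∫⁻ x in Set.pi univ E, forwardDensity g T φ t x *
        (harmonic g T ψ (t (Fin.last m)) (x (Fin.last m)) * f (x (Fin.last m))) := by
  have hFm : ∀ {m : ℕ} (t : Fin (m + 1) → ℝ) {f : Space N → ℝ≥0∞}, Measurable f →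
      Measurable fun x : Fin (m + 1) → Space N => forwardDensity g T φ t x *
        (harmonic g T ψ (t (Fin.last m)) (x (Fin.last m)) * f (x (Fin.last m))) := by
    intro m t f hf
    have he : Measurable fun x : Fin (m + 1) → Space N => x (Fin.last m) := measurable_pi_apply _
    exact (measurable_forwardDensity H1 t).mul (((measurable_harmonic H1 _).comp he).mul
      (hf.comp he))
  induction m generalizing f with
  | zero =>
    have hone : ⋂ k, Z (t k) ⁻¹' E k = Z (t (Fin.last 0)) ⁻¹' E (Fin.last 0) := by
      ext; simp
    rw [lintegral_snoc _ (hFm t hf), hone,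
      setLIntegral_eq_of_isMarkovOn H1 H2 hZ hM h0 (htT _) (hE _) hf]
    have hpi : (Set.pi univ fun k : Fin 0 => E k.castSucc) = univ := by
      ext; simp
    -- Over an empty set of coordinates the product measure is a Dirac mass, so only the last
    -- integral remains.
    rw [hpi, setLIntegral_univ, volume_pi, Measure.pi_of_empty, lintegral_dirac]
    refine lintegral_congr fun y => ?_
    simp [forwardDensity, mul_assoc, Fin.snoc]
  | succ m ih =>
    have ht' : StrictMono fun k : Fin (m + 1) => t k.castSucc :=
      ht.comp Fin.strictMono_castSucc
    have hlt : t (Fin.last m).castSucc < t (Fin.last (m + 1)) := ht (Fin.castSucc_lt_last _)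
    have hI : ∀ k, t k ∈ Icc 0 T := fun k => ⟨(htT k).1.le, (htT k).2.le⟩
    have hEf : Measurable ((E (Fin.last (m + 1))).indicator f) := hf.indicator (hE _)
    have hQ : Measurable fun x => ∫⁻ y, (E (Fin.last (m + 1))).indicator f y
        ∂(markovKernel g T ψ (t (Fin.last m).castSucc) (t (Fin.last (m + 1))) x) := by
      have := isMarkovKernel_markovKernel H1 H2 (hI (Fin.last m).castSucc).1 hlt (hI _).2
      exact hEf.lintegral_kernel
    have hA : (⋂ k : Fin (m + 1), Z (t k.castSucc) ⁻¹' E k.castSucc)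
        ∈ cylinders Z (Icc 0 T ∩ Iic (t (Fin.last m).castSucc)) := by
      have := biInter_mem_cylinders (Z := Z) (J := Icc 0 T ∩ Iic (t (Fin.last m).castSucc))
        (A := fun k : Fin (m + 1) => Z (t k.castSucc) ⁻¹' E k.castSucc) Finset.univ
        fun k _ => preimage_mem_cylinders (J := Icc 0 T ∩ Iic (t (Fin.last m).castSucc))
          ⟨hI _, ht'.monotone (Fin.le_last k)⟩ (hE _)
      simpa using this
    have hsplit : ⋂ k, Z (t k) ⁻¹' E k
        = Z (t (Fin.last (m + 1))) ⁻¹' E (Fin.last (m + 1)) ∩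
          ⋂ k : Fin (m + 1), Z (t k.castSucc) ⁻¹' E k.castSucc := by
      ext ω
      simp only [mem_iInter, mem_preimage, Set.mem_inter_iff]
      rw [Fin.forall_fin_succ', and_comm]
    have hmE := hZ _ (hI (Fin.last (m + 1))) (hE (Fin.last (m + 1)))
    have h1 := hM.setLIntegral hZ (hI _) (hI _) hlt hA hEf
    rw [ih ht' (fun k => htT _) (fun k => hE _) hQ] at h1
    rw [hsplit, ← Measure.restrict_restrict hmE, ← lintegral_indicator hmE]
    refine Eq.trans (lintegral_congr fun ω => ?_) (h1.trans ?_)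
    · rfl
    rw [lintegral_snoc _ (hFm t hf)]
    refine lintegral_congr fun x => ?_
    set z := x (Fin.last m)
    have h3 := ENNReal.mul_inv_cancel (H2.harmonic_ne_zero H1 (hI (Fin.last m).castSucc) z)
      (H2.harmonic_ne_top H1 (hI (Fin.last m).castSucc) z)
    rw [lintegral_markovKernel H1 _ _ _ hEf, ← mul_assoc, ← lintegral_const_mul, refMeasure,
      if_pos (htT _).2, ← lintegral_indicator (hE _)]
    · refine lintegral_congr fun y => ?_
      by_cases hy : y ∈ E (Fin.last (m + 1))
      · simp only [hy, indicator_of_mem, div_eq_mul_inv, forwardDensity_snoc H1, Fin.snoc_last]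
        calc _ = (harmonic g T ψ (t (Fin.last m).castSucc) z *
              (harmonic g T ψ (t (Fin.last m).castSucc) z)⁻¹) *
              (forwardDensity g T φ (fun k => t k.castSucc) x * greenDensity g T
                (t (Fin.last (m + 1)) - t (Fin.last m).castSucc) z y *
                (harmonic g T ψ (t (Fin.last (m + 1))) y * f y)) := by ring
          _ = _ := by rw [h3, one_mul]
      · simp [hy]
    · exact (((H1.measurable_green_right _ _).mul (measurable_harmonic H1 _)).div_const _).mul hEf

lemma forwardDensity_mul_harmonic (H1 : PotentialHypothesis V T g) (H2 : DataHypothesis V T g φ ψ)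
    {m : ℕ} {t : Fin (m + 1) → ℝ} (ht : StrictMono t) (htT : ∀ k, t k ∈ Ioo 0 T)
    (x : Fin (m + 1) → Space N) :
    forwardDensity g T φ t x * harmonic g T ψ (t (Fin.last m)) (x (Fin.last m))
      = ENNReal.ofReal
        ((∏ k : Fin m, g (x k.succ) (t k.succ - t k.castSucc) (x k.castSucc)) *
          (forwardSol g φ (x 0) (t 0) * backwardSol g T ψ (x (Fin.last m)) (t (Fin.last m)))) := by
  have hΔ : ∀ k : Fin m, t k.succ - t k.castSucc ∈ Ioc 0 T := fun k =>
    ⟨sub_pos.2 (ht (Fin.castSucc_lt_succ)), by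
      linarith [(htT k.succ).2, (htT k.castSucc).1]⟩
  have hg : ∀ k : Fin m, 0 ≤ g (x k.succ) (t k.succ - t k.castSucc) (x k.castSucc) := fun k =>
    H1.green.nonneg _ _ (hΔ k) _
  have hu := H2.forward_solution.pos (x 0) (t 0) ⟨(htT 0).1, (htT 0).2.le⟩
  rw [ENNReal.ofReal_mul (Finset.prod_nonneg fun k _ => hg k), ENNReal.ofReal_mul hu.le,
    ENNReal.ofReal_prod_of_nonneg fun k _ => hg k, forwardDensity,
    H2.lintegral_forward H1 ⟨(htT 0).1, (htT 0).2.le⟩,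
    H2.harmonic_eq H1 ⟨(htT _).1.le, (htT _).2⟩, mul_assoc]
  simp only [green_of_mem (hΔ _)]

namespace IsBernsteinProcessOf

lemma measure_preimage_zero (hB : IsBernsteinProcessOf g T (markovianMeasure g T φ ψ) P Z)
    (H1 : PotentialHypothesis V T g) (H2 : DataHypothesis V T g φ ψ) [SFinite φ] [SFinite ψ]
    (hT : 0 < T) {E : Set (Space N)} (hE : MeasurableSet E) :
    P (Z 0 ⁻¹' E) = ∫⁻ x in E, ENNReal.ofReal (backwardSol g T ψ x 0) ∂φ := by
  rw [← Measure.map_apply (hB.isBernstein.measurable 0 ⟨le_rfl, hT.le⟩) hE,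
    hB.map_zero H1 H2 hT, initialLaw, withDensity_apply _ hE]
  simp only [H2.harmonic_eq H1 ⟨le_refl (0 : ℝ), hT⟩]

/-- At the final time `μ` is integrated over its first variable; symmetry of `g` turns the result
into `u_φ(·, T)`. -/
lemma measure_preimage_final (hB : IsBernsteinProcessOf g T (markovianMeasure g T φ ψ) P Z)
    (H1 : PotentialHypothesis V T g) (H2 : DataHypothesis V T g φ ψ) [SFinite φ] [SFinite ψ]
    (hT : 0 < T) {E : Set (Space N)} (hE : MeasurableSet E) :
    P (Z T ⁻¹' E) = ∫⁻ x in E, ENNReal.ofReal (forwardSol g φ x T) ∂ψ := by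
  have h := hB.measure_inter_preimage hT MeasurableSet.univ hE
  rw [preimage_univ, univ_inter, markovianMeasure_prod H1 hT MeasurableSet.univ hE,
    setLIntegral_univ, lintegral_lintegral_swap (H1.measurable_green_prod T).aemeasurable] at h
  rw [h]
  refine lintegral_congr fun y => ?_
  rw [← H2.lintegral_forward H1 ⟨hT, le_rfl⟩]
  simp only [H1.green_symm T _ y]

lemma law_eq (hB : IsBernsteinProcessOf g T (markovianMeasure g T φ ψ) P Z)
    (H1 : PotentialHypothesis V T g) (H2 : DataHypothesis V T g φ ψ) [SFinite φ] [SFinite ψ]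
    (hT : 0 < T) {t : ℝ} (ht : t ∈ Ioo 0 T) {E : Set (Space N)} (hE : MeasurableSet E) :
    P (Z t ⁻¹' E)
      = ∫⁻ x in E, ENNReal.ofReal (forwardSol g φ x t * backwardSol g T ψ x t) := by
  have h := setLIntegral_eq_of_isMarkovOn H1 H2 hB.isBernstein.measurable (hB.isMarkovOn H1 H2 hT)
    (hB.map_zero H1 H2 hT) ht hE (f := fun _ => 1) measurable_const
  rw [setLIntegral_one] at h
  rw [h]
  refine lintegral_congr fun x => ?_
  rw [mul_one, H2.lintegral_forward H1 ⟨ht.1, ht.2.le⟩, H2.harmonic_eq H1 ⟨ht.1.le, ht.2⟩,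
    ENNReal.ofReal_mul (H2.forward_solution.pos x t ⟨ht.1, ht.2.le⟩).le]

lemma finiteDimensionalLaw_eq (hB : IsBernsteinProcessOf g T (markovianMeasure g T φ ψ) P Z)
    (H1 : PotentialHypothesis V T g) (H2 : DataHypothesis V T g φ ψ) [SFinite φ] [SFinite ψ]
    (hT : 0 < T) {m : ℕ} {t : Fin (m + 1) → ℝ} {E : Fin (m + 1) → Set (Space N)}
    (ht : StrictMono t) (htT : ∀ k, t k ∈ Ioo 0 T) (hE : ∀ k, MeasurableSet (E k)) :
    P (⋂ k, Z (t k) ⁻¹' E k) = ∫⁻ x in Set.pi univ E, ENNReal.ofReal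
      ((∏ k : Fin m, g (x k.succ) (t k.succ - t k.castSucc) (x k.castSucc)) *
        (forwardSol g φ (x 0) (t 0) *
          backwardSol g T ψ (x (Fin.last m)) (t (Fin.last m)))) := by
  have h := setLIntegral_iInter_eq_of_isMarkovOn H1 H2 hB.isBernstein.measurable
    (hB.isMarkovOn H1 H2 hT) (hB.map_zero H1 H2 hT) ht htT hE (f := fun _ => 1) measurable_const
  rw [setLIntegral_one] at h
  rw [h]
  refine lintegral_congr fun x => ?_
  rw [mul_one, forwardDensity_mul_harmonic H1 H2 ht htT]

end IsBernsteinProcessOf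

end Bernstein
end

theorem corollary1 {N : ℕ} (hN : 0 < N) (T : ℝ) (hT : 0 < T)
    (V : Bernstein.Space N → ℝ) (g : Bernstein.Space N → ℝ → Bernstein.Space N → ℝ)
    (φ₀ ψT : Measure (Bernstein.Space N))
    (H1 : Bernstein.PotentialHypothesis V T g) (H2 : Bernstein.DataHypothesis V T g φ₀ ψT)
    (hμ : Bernstein.markovianMeasure g T φ₀ ψT univ = 1) :
    -- the Bernstein process exists
    (∃ (Ω : Type) (_ : MeasurableSpace Ω) (P : Measure Ω) (Z : ℝ → Ω → Bernstein.Space N),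
      Bernstein.IsBernsteinProcessOf g T (Bernstein.markovianMeasure g T φ₀ ψT) P Z) ∧
    -- every realization of it has the following properties
    ∀ (Ω : Type*) [MeasurableSpace Ω] (P : Measure Ω) (Z : ℝ → Ω → Bernstein.Space N),
      Bernstein.IsBernsteinProcessOf g T (Bernstein.markovianMeasure g T φ₀ ψT) P Z →
      Bernstein.IsMarkovProcess T P Z ∧
      -- the law at `n = m + 1` times `t_1 < ... < t_n`, here numbered from `0` to `m`
      (∀ (m : ℕ) (t : Fin (m + 1) → ℝ) (E : Fin (m + 1) → Set (Bernstein.Space N)),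
        StrictMono t → (∀ k, t k ∈ Ioo 0 T) → (∀ k, MeasurableSet (E k)) →
        P (⋂ k, Z (t k) ⁻¹' E k) =
          ∫⁻ x : Fin (m + 1) → Bernstein.Space N in Set.pi univ E,
            ENNReal.ofReal
              ((∏ k : Fin m, g (x k.succ) (t k.succ - t k.castSucc) (x k.castSucc)) *
                (Bernstein.forwardSol g φ₀ (x 0) (t 0) *
                  Bernstein.backwardSol g T ψT (x (Fin.last m)) (t (Fin.last m))))) ∧
      (∀ t ∈ Ioo 0 T, ∀ E : Set (Bernstein.Space N), MeasurableSet E →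
        P (Z t ⁻¹' E) =
          ∫⁻ x in E, ENNReal.ofReal
            (Bernstein.forwardSol g φ₀ x t * Bernstein.backwardSol g T ψT x t)) ∧
      (∀ E : Set (Bernstein.Space N), MeasurableSet E →
        P (Z 0 ⁻¹' E) = ∫⁻ x in E, ENNReal.ofReal (Bernstein.backwardSol g T ψT x 0) ∂φ₀) ∧
      (∀ E : Set (Bernstein.Space N), MeasurableSet E →
        P (Z T ⁻¹' E) = ∫⁻ x in E, ENNReal.ofReal (Bernstein.forwardSol g φ₀ x T) ∂ψT) := by
  -- Locally finite measures on `ℝ^N` are s-finite, which the Tonelli arguments require.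
  have := H2.locallyFinite_initial
  have := H2.locallyFinite_final
  refine ⟨Bernstein.exists_isBernsteinProcessOf H1 H2 hT hμ, fun Ω _ P Z hB => ?_⟩
  have := hB.isBernstein.probability
  exact ⟨Bernstein.isMarkovProcess_of_isMarkovOn H1 H2 hB.isBernstein.measurable
      (hB.isMarkovOn H1 H2 hT),
    fun m t E ht htT hE => hB.finiteDimensionalLaw_eq H1 H2 hT ht htT hE,
    fun t ht E hE => hB.law_eq H1 H2 hT ht hE,
    fun E hE => hB.measure_preimage_zero H1 H2 hT hE,
    fun E hE => hB.measure_preimage_final H1 H2 hT hE⟩
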